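/- **Setting.** Let $\mathbb R^{(n+1,n)}=\{(v,\tau,X)\}$, with $v,X\in\mathbb R^n$ and $\tau\in\mathbb R$, carry the metric $h\big((v,\tau,X),(w,\nu,Y)\big)=\frac12\big(w(X)+v(Y)+\tau\nu\big)$. Let $\mathfrak g=\mathfrak{so}(n+1,n)$, let $P\subset SO(n+1,n)$ be the stabiliser of the isotropic $n$-plane $\{(v,0,0)\}$, $\mathfrak p$ its Lie algebra and $\mathfrak p^\perp$ the nilradical of $\mathfrak p$. Let $\mathcal P\to M$ be a smooth principal $P$-bundle with a Cartan connection $\omega:T\mathcal P\to\mathfrak g$ (for example the regular normal one of a free $n$-distribution; normality is not needed). Then $T=TM=\mathcal P\times_P\mathfrak g/\mathfrak p$ and $T^*=\mathcal P\times_P\mathfrak p^\perp$. The tractor bundle $\mathcal T=\mathcal P\times_P\mathbb R^{(n+1,n)}$ carries $h$, the tractor connection $\overrightarrow\nabla$ and the filtration $H^*\subset\mathbb R\oplus H^*\subset\mathcal T$; its quotient $H=\mathcal T/(\mathbb R\oplus H^*)$ is the distribution $H=T_{-1}\subset T$. A Weyl structure is a smooth $P$-equivariant function $\eta:\mathcal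 P\to\mathfrak p$ that lifts the grading element of $\mathfrak p/\mathfrak p^\perp$. It splits $\mathcal T=H\oplus\mathbb R\oplus H^*$, $T=T_{-2}\oplus H$ and $T^*=H^*\oplus T^*_2$. Its preferred connection $\nabla$ and rho-tensor $\mathsf P:T\to T^*$ are defined by $\nabla\eta=0$ and $\overrightarrow\nabla_Z=\nabla_Z+Z+\mathsf P(Z)$; preferred connections correspond one-to-one to Weyl structures. Identify $T_{-2}\cong H\wedge H$ so that $X\wedge Y$ acts on $\mathcal T$ by $H^*\to H$, $v\mapsto v(X)Y-v(Y)X$. Identify $T^*_2\cong\wedge^2H^*$ so that $\Upsilon_2$ acts by $H\to H^*$, $X\mapsto-\Upsilon_2(X,\cdot)$. Identify $T^*_1$ with $H^*$ so that $\Upsilon_1$ acts on $\mathbb R$ by $\tau\mapsto\tau\Upsilon_1$. Let $\mathsf P_{ij}:T_{-i}\to T^*_j$ be the components of $\mathsf P$. Let $V\subset\mathcal T$ be a smooth subbundle of rank $n$ that is generic: the projection $\mathcal T\to H$ is injective on $V$ over an open dense subset of $M$. Let $M_0$ be the set of all points of $M$ over which it is injective. Over $M_0$ the projection $V\to H$ is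 an isomorphism. Given a Weyl structure, lifting $H\cong V\subset\mathcal T$ and projecting to $H^*$ gives a map $\mu:H\to H^*$. The preferred connection $\nabla$ is called $V$-preferred if $\mu(X)(Y)=h(\check X,\check Y)$ for all $X,Y\in H$, where $\check X,\check Y\in V$ are the lifts. It is called strongly $V$-preferred if, in addition, $\mu(H)\cap A^\perp=0$, where $A=H$ is the image of $V$ and $A^\perp\subset H^*$ its annihilator. Extend $\mu$ to $T=T_{-2}\oplus H$ by $\mu(X\wedge Y,X'\wedge Y')=\mu(X,X')\mu(Y,Y')-\mu(X,Y')\mu(Y,X')$ on $T_{-2}\cong H\wedge H$, with $T_{-2}\perp H$. **Theorem.** Over $M_0$ there is a unique $V$-preferred connection $\nabla$ (given by a unique Weyl structure over $M_0$), and it is strongly $V$-preferred. Its $\mu$ is a smooth symmetric bilinear form on $TM_0$. At each point of $M_0$, $\mu$ is non-degenerate on $T$ if and only if it is non-degenerate on $H$, if and only if $h|_V$ is non-degenerate; and the same holds with "positive definite" in place of "non-degenerate". So $\mu$ gives a (pseudo-)Riemannian metric on $M_0$ and a sub-Riemannian metric on $H$ where $h|_V$ has these properties. If $\overrightarrow\nabla$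 preserves $V$, then over $M_0$: - $\nabla\mu=0$, on $H$ and on $T$; - $\mathsf P_{12}=0$ and $\mathsf P_{21}=0$; - $\mathsf P_{11}=-\mu$ on $H$ and $\mathsf P_{22}=-\mu$ on $T_{-2}$; - $\nabla\mathsf P=0$. If $\overrightarrow\nabla$ preserves $V$ only in the directions of $H$, then still $\nabla_Z\mu=0$ on $H$ over $M_0$ for every $Z\in H$. -/

import Mathlib

open scoped Manifold ContDiff
open Matrix

/-! ### The Lie algebra `so(n+1,n)` and its parabolic subalgebra -/

/-- Indices of `ℝ^{(n+1,n)}`: the blocks are, in this order, `H^*`, `ℝ` and `H`. -/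
abbrev TIdx (n : ℕ) : Type := Fin n ⊕ Unit ⊕ Fin n

/-- The standard representation space `ℝ^{(n+1,n)}`. -/
abbrev TVec (n : ℕ) : Type := TIdx n → ℝ

/-- Square matrices on `ℝ^{(n+1,n)}`. -/
abbrev TMat (n : ℕ) : Type := Matrix (TIdx n) (TIdx n) ℝ

/-- The index of the middle block. -/
abbrev midIdx (n : ℕ) : TIdx n := Sum.inr (Sum.inl ())

/-- The `H^*`-block of a vector. -/
def topBlock {n : ℕ} (t : TVec n) : Fin n → ℝ := fun i => t (Sum.inl i)

/-- The middle coordinate of a vector. -/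
def midCoord {n : ℕ} (t : TVec n) : ℝ := t (midIdx n)

/-- The `H`-block of a vector. As `H` is the quotient of the tractor bundle by `ℝ ⊕ H^*`, this is the
canonical projection of the tractor bundle to `H`, written in a frame. -/
def hBlock {n : ℕ} (t : TVec n) : Fin n → ℝ := fun i => t (Sum.inr (Sum.inr i))

/-- The matrix with blocks `(0, 0, 1), (0, 1, 0), (1, 0, 0)`, of signature `(n+1, n)`. -/
def Jmat (n : ℕ) : TMat n :=
  Matrix.of fun a b => match a, b with
    | Sum.inl i, Sum.inr (Sum.inr j) => if i = j then 1 else 0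
    | Sum.inr (Sum.inl _), Sum.inr (Sum.inl _) => 1
    | Sum.inr (Sum.inr i), Sum.inl j => if i = j then 1 else 0
    | _, _ => 0

/-- The tractor metric `h`, including the factor `1/2`:
`h ((v,τ,X),(w,ν,Y)) = (w(X) + v(Y) + τ ν) / 2`. -/
noncomputable def tractorMetric {n : ℕ} (s t : TVec n) : ℝ :=
  (1 / 2) * (topBlock t ⬝ᵥ hBlock s + topBlock s ⬝ᵥ hBlock t + midCoord s * midCoord t)

/-- `𝔤 = so(n+1,n)`: the matrices `A` with `Aᵀ J + J A = 0`. -/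
abbrev soAlg (n : ℕ) : Submodule ℝ (TMat n) := skewAdjointMatricesSubmodule (Jmat n)

/-- Membership in the canonical isotropic `n`-plane (the fibre of `H^*`). -/
def InTop {n : ℕ} (t : TVec n) : Prop := midCoord t = 0 ∧ hBlock t = 0

/-- The parabolic subgroup `P` of `SO(n+1,n)`: the stabiliser of the canonical isotropic `n`-plane. -/
def Parabolic (n : ℕ) : Subgroup (GL (TIdx n) ℝ) where
  carrier := {g | (g : TMat n)ᵀ * Jmat n * (g : TMat n) = Jmat n ∧ (g : TMat n).det = 1 ∧
    ∀ t : TVec n, InTop ((g : TMat n) *ᵥ t) ↔ InTop t}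
  one_mem' := by simp
  mul_mem' := by
    rintro a b ⟨ha, hda, hta⟩ ⟨hb, hdb, htb⟩
    refine ⟨?_, by simp [hda, hdb], fun t => ?_⟩
    · calc ((a * b : GL (TIdx n) ℝ) : TMat n)ᵀ * Jmat n * ((a * b : GL (TIdx n) ℝ) : TMat n)
          = (b : TMat n)ᵀ * ((a : TMat n)ᵀ * Jmat n * (a : TMat n)) * (b : TMat n) := by
            simp [Matrix.mul_assoc]
        _ = Jmat n := by rw [ha, hb]
    · rw [Units.val_mul, ← Matrix.mulVec_mulVec, hta, htb]
  inv_mem' := by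
    rintro a ⟨ha, hda, hta⟩
    have h1 : (a : TMat n) * ((a⁻¹ : GL (TIdx n) ℝ) : TMat n) = 1 := by
      rw [← Units.val_mul, mul_inv_cancel, Units.val_one]
    refine ⟨?_, ?_, fun t => ?_⟩
    · calc ((a⁻¹ : GL (TIdx n) ℝ) : TMat n)ᵀ * Jmat n * ((a⁻¹ : GL (TIdx n) ℝ) : TMat n)
          = ((a : TMat n) * ((a⁻¹ : GL (TIdx n) ℝ) : TMat n))ᵀ * Jmat n *
              ((a : TMat n) * ((a⁻¹ : GL (TIdx n) ℝ) : TMat n)) := by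
            have h2 : ((a⁻¹ : GL (TIdx n) ℝ) : TMat n)ᵀ * (a : TMat n)ᵀ = 1 := by
              rw [← Matrix.transpose_mul, h1, Matrix.transpose_one]
            rw [h1, Matrix.transpose_one, Matrix.one_mul, Matrix.mul_one]
            conv_lhs => rw [← ha]
            rw [← Matrix.mul_assoc, ← Matrix.mul_assoc, h2, Matrix.one_mul, Matrix.mul_assoc, h1,
              Matrix.mul_one]
        _ = Jmat n := by rw [h1]; simp
    · have := congrArg Matrix.det h1
      rw [Matrix.det_mul, hda, Matrix.det_one, one_mul] at this
      exact this
    · rw [← hta, Matrix.mulVec_mulVec, h1, Matrix.one_mulVec]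

/-- The matrix of an element of `P`. -/
abbrev pmat {n : ℕ} (p : Parabolic n) : TMat n := ((p : GL (TIdx n) ℝ) : TMat n)

/-- `𝔭^⊥`, the nilradical of `𝔭`: the elements of `𝔤` that move the filtration
`𝒯 ⊃ ℝ ⊕ H^* ⊃ H^* ⊃ 0` down by one step. -/
def InNilradical {n : ℕ} (Y : TMat n) : Prop :=
  Y ∈ soAlg n ∧ (∀ t : TVec n, hBlock (Y *ᵥ t) = 0) ∧
    (∀ t : TVec n, hBlock t = 0 → midCoord (Y *ᵥ t) = 0) ∧
    (∀ t : TVec n, InTop t → Y *ᵥ t = 0)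

/-- The standard grading element `diag (1, 0, -1)`. -/
def gradingElt (n : ℕ) : TMat n :=
  Matrix.diagonal fun a => match a with
    | Sum.inl _ => 1
    | Sum.inr (Sum.inl _) => 0
    | Sum.inr (Sum.inr _) => -1

/-- For a lift `N` of the grading element (whose eigenvalues on `ℝ^{(n+1,n)}` are `1, 0, -1`), the
projection to the eigenspace of eigenvalue `a`. The three eigenspaces are the summands
`H^*`, `ℝ`, `H` of the splitting that `N` defines. -/
noncomputable def specProj {n : ℕ} (N : TMat n) (a : ℤ) : TMat n :=
  if a = 1 then (1 / 2 : ℝ) • (N * N + N)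
  else if a = 0 then 1 - N * N
  else if a = -1 then (1 / 2 : ℝ) • (N * N - N)
  else 0

/-- The component of degree `k` of `y` in the grading defined by `N`, that is, its component in the
eigenspace `k` of `ad N`. -/
noncomputable def gradeComp {n : ℕ} (N : TMat n) (k : ℤ) (y : TMat n) : TMat n :=
  ∑ a ∈ Finset.Icc (-1 : ℤ) 1, specProj N a * y * specProj N (a - k)

/-- The `H^*`-component of a tractor in the splitting `H ⊕ ℝ ⊕ H^*` defined by `N`. -/
noncomputable def starComp {n : ℕ} (N : TMat n) (t : TVec n) : Fin n → ℝ :=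
  topBlock (specProj N 1 *ᵥ t)

/-- The `T_{-1} = H` component, in the splitting defined by `N`, of the tangent vector represented by
`y ∈ 𝔤 / 𝔭`: the vector `Z_{-1}` for which `τ ↦ τ Z_{-1}` is the action of `T_{-1}` on `ℝ`. -/
noncomputable def tanOne {n : ℕ} (N : TMat n) (y : TMat n) : Fin n → ℝ :=
  fun i => gradeComp N (-1) y (Sum.inr (Sum.inr i)) (midIdx n)

/-- The `T_{-2} ≅ H ∧ H` component of the tangent vector represented by `y ∈ 𝔤 / 𝔭`, as the
skew matrix through which it maps `H^*` to `H`. -/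
noncomputable def tanTwo {n : ℕ} (N : TMat n) (y : TMat n) : Matrix (Fin n) (Fin n) ℝ :=
  Matrix.of fun i j => gradeComp N (-2) y (Sum.inr (Sum.inr i)) (Sum.inl j)

/-- The `T^*_1 = H^*` component of an element of `T^* = 𝔭^⊥`: the covector `Υ₁` for which `τ ↦ τ Υ₁`
is its action on `ℝ`. -/
def covOne {n : ℕ} (Y : TMat n) : Fin n → ℝ := fun i => Y (Sum.inl i) (midIdx n)

/-- The `T^*_2 ≅ ∧² H^*` component of an element of `T^* = 𝔭^⊥`: the two-form `Υ₂` for which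
`X ↦ - Υ₂ (X, ·)` is its action from `H` to `H^*`. -/
noncomputable def covTwo {n : ℕ} (N : TMat n) (Y : TMat n) (X X' : Fin n → ℝ) : ℝ :=
  -∑ i, ∑ j, gradeComp N 2 Y (Sum.inl i) (Sum.inr (Sum.inr j)) * X j * X' i

/-- The bivector `X ∧ X'`, as the skew map `v ↦ v(X) X' - v(X') X`; it is the value of the algebraic
bracket `H × H → T_{-2}`. -/
def bivector {n : ℕ} (X X' : Fin n → ℝ) : Matrix (Fin n) (Fin n) ℝ :=
  Matrix.of fun i j => X' i * X j - X i * X' j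

/-- The form that a bilinear form `b` on `H` induces on `H ∧ H`; see `wedgeForm_bivector`. -/
noncomputable def wedgeForm {n : ℕ} (b : (Fin n → ℝ) → (Fin n → ℝ) → ℝ)
    (C C' : Matrix (Fin n) (Fin n) ℝ) : ℝ :=
  (1 / 2) * ∑ i, ∑ j, ∑ k, ∑ l,
    C i j * C' k l * b (Pi.single i 1) (Pi.single k 1) * b (Pi.single j 1) (Pi.single l 1)

/-- On decomposable bivectors `wedgeForm` is the usual determinant. -/
theorem wedgeForm_bivector {n : ℕ} (b : (Fin n → ℝ) →ₗ[ℝ] (Fin n → ℝ) →ₗ[ℝ] ℝ)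
    (X Y X' Y' : Fin n → ℝ) :
    wedgeForm (fun v w => b v w) (bivector X Y) (bivector X' Y') =
      b X X' * b Y Y' - b X Y' * b Y X' := by
  have hb : ∀ v w : Fin n → ℝ,
      b v w = ∑ i, ∑ k, v i * w k * b (Pi.single i 1) (Pi.single k 1) := by
    intro v w
    conv_lhs => rw [pi_eq_sum_univ' v, pi_eq_sum_univ' w]
    simp only [map_sum, map_smul, LinearMap.sum_apply, LinearMap.smul_apply, smul_eq_mul,
      Finset.mul_sum]
    rw [Finset.sum_comm]
    exact Finset.sum_congr rfl fun i _ => Finset.sum_congr rfl fun k _ => by ring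
  have key : ∀ v w v' w' : Fin n → ℝ,
      (∑ i, ∑ j, ∑ k, ∑ l, (v i * w j) * (v' k * w' l) * b (Pi.single i 1) (Pi.single k 1) *
        b (Pi.single j 1) (Pi.single l 1)) = b v v' * b w w' := by
    intro v w v' w'
    rw [hb v v', hb w w', Finset.sum_mul]
    refine Finset.sum_congr rfl fun i _ => ?_
    rw [Finset.sum_mul, Finset.sum_comm]
    refine Finset.sum_congr rfl fun k _ => ?_
    rw [Finset.mul_sum]
    refine Finset.sum_congr rfl fun j _ => ?_
    rw [Finset.mul_sum]
    exact Finset.sum_congr rfl fun l _ => by ring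
  have : wedgeForm (fun v w => b v w) (bivector X Y) (bivector X' Y') =
      (1 / 2) * (b Y Y' * b X X' - b Y X' * b X Y' - b X Y' * b Y X' + b X X' * b Y Y') := by
    rw [← key Y X Y' X', ← key Y X X' Y', ← key X Y Y' X', ← key X Y X' Y']
    simp only [wedgeForm, bivector, Matrix.of_apply, ← Finset.sum_sub_distrib,
      ← Finset.sum_add_distrib]
    congr 1
    refine Finset.sum_congr rfl fun i _ => Finset.sum_congr rfl fun j _ =>
      Finset.sum_congr rfl fun k _ => Finset.sum_congr rfl fun l _ => by ring
  rw [this]; ring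

/-! ### Cartan geometries -/

section Geometry

variable {n : ℕ} {EM EP M Q : Type*}
  [NormedAddCommGroup EM] [NormedSpace ℝ EM] [NormedAddCommGroup EP] [NormedSpace ℝ EP]
  [TopologicalSpace M] [ChartedSpace EM M] [IsManifold 𝓘(ℝ, EM) ∞ M]
  [TopologicalSpace Q] [ChartedSpace EP Q] [IsManifold 𝓘(ℝ, EP) ∞ Q]

/-- A Cartan geometry on `M` for the parabolic `𝔭 ⊂ so(n+1,n)`: a smooth principal right `P`-bundle
`Q → M` and a Cartan connection `ω` on it. Smoothness of maps into or out of the embedded Lie group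
`P` is smoothness of the matrix entries, respectively smoothness along all smooth maps `ℝ^k → P`. -/
structure CartanGeometry (n : ℕ) (EM EP M Q : Type*)
    [NormedAddCommGroup EM] [NormedSpace ℝ EM] [NormedAddCommGroup EP] [NormedSpace ℝ EP]
    [TopologicalSpace M] [ChartedSpace EM M] [IsManifold 𝓘(ℝ, EM) ∞ M]
    [TopologicalSpace Q] [ChartedSpace EP Q] [IsManifold 𝓘(ℝ, EP) ∞ Q] where
  /-- The bundle projection. -/
  proj : Q → M
  contMDiff_proj : ContMDiff 𝓘(ℝ, EP) 𝓘(ℝ, EM) ∞ proj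
  /-- The right action of `P`. -/
  act : Q → Parabolic n → Q
  act_one : ∀ u, act u 1 = u
  act_mul : ∀ u p q, act u (p * q) = act (act u p) q
  contMDiff_act : ∀ (k : ℕ) (f : (Fin k → ℝ) → Parabolic n),
    (∀ i j, ContDiff ℝ ∞ fun x => pmat (f x) i j) →
    ContMDiff (𝓘(ℝ, EP).prod 𝓘(ℝ, Fin k → ℝ)) 𝓘(ℝ, EP) ∞
      fun q : Q × (Fin k → ℝ) => act q.1 (f q.2)
  act_free : ∀ u p, act u p = u → p = 1
  proj_eq_iff : ∀ u v, proj u = proj v ↔ ∃ p, act u p = v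
  local_triv : ∀ x : M, ∃ W : Set M, IsOpen W ∧ x ∈ W ∧
    ∃ (σ : M → Q) (φ : Q → Parabolic n),
      ContMDiffOn 𝓘(ℝ, EM) 𝓘(ℝ, EP) ∞ σ W ∧
      (∀ i j, ContMDiffOn 𝓘(ℝ, EP) 𝓘(ℝ, ℝ) ∞ (fun u => pmat (φ u) i j) (proj ⁻¹' W)) ∧
      (∀ y ∈ W, proj (σ y) = y) ∧
      (∀ u ∈ proj ⁻¹' W, act (σ (proj u)) (φ u) = u)
  /-- The Cartan connection, a linear isomorphism to `𝔤` on every tangent space. -/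
  conn : ∀ u : Q, TangentSpace 𝓘(ℝ, EP) u ≃ₗ[ℝ] soAlg n
  contMDiff_conn : ∀ i j, ContMDiff 𝓘(ℝ, EP).tangent 𝓘(ℝ, ℝ) ∞
    fun v : TangentBundle 𝓘(ℝ, EP) Q => (conn v.proj v.snd : TMat n) i j
  conn_equivariant : ∀ (u : Q) (p : Parabolic n) (ξ : TangentSpace 𝓘(ℝ, EP) u),
    (conn (act u p) (mfderiv 𝓘(ℝ, EP) 𝓘(ℝ, EP) (fun v => act v p) u ξ) : TMat n) =
      pmat p⁻¹ * (conn u ξ : TMat n) * pmat p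
  /-- `ω` sends the fundamental vector of `A ∈ 𝔭` to `A`. -/
  conn_fundamental : ∀ (u : Q) (c : ℝ → Parabolic n), (∀ i j, ContDiff ℝ ∞ fun r => pmat (c r) i j) →
    c 0 = 1 → ∀ i j,
    (conn (act u (c 0)) (mfderiv 𝓘(ℝ, ℝ) 𝓘(ℝ, EP) (fun r => act u (c r)) 0 (1 : ℝ)) : TMat n) i j =
      deriv (fun r => pmat (c r) i j) 0

/-- The derivative of a matrix-valued function along a tangent vector, entry by entry. -/
noncomputable def dMat (f : Q → TMat n) (u : Q) (ξ : TangentSpace 𝓘(ℝ, EP) u) : TMat n :=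
  Matrix.of fun i j => (mfderiv 𝓘(ℝ, EP) 𝓘(ℝ, ℝ) (fun v => f v i j) u ξ : ℝ)

/-- The derivative of a vector-valued function along a tangent vector, entry by entry. -/
noncomputable def dVec (s : Q → TVec n) (u : Q) (ξ : TangentSpace 𝓘(ℝ, EP) u) : TVec n :=
  fun i => (mfderiv 𝓘(ℝ, EP) 𝓘(ℝ, ℝ) (fun v => s v i) u ξ : ℝ)

namespace CartanGeometry

variable (G : CartanGeometry n EM EP M Q)

/-- The value of the Cartan connection, as a matrix. -/
noncomputable def form (u : Q) (ξ : TangentSpace 𝓘(ℝ, EP) u) : TMat n := (G.conn u ξ : TMat n)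

/-- The tangent vector on which `ω` has the value `y ∈ 𝔤` (and `0` for matrices outside `𝔤`, a case
that never matters). -/
noncomputable def vec (u : Q) (y : TMat n) : TangentSpace 𝓘(ℝ, EP) u :=
  open Classical in if hy : y ∈ soAlg n then (G.conn u).symm ⟨y, hy⟩ else 0

/-- The image of `ξ` in `T M` lies in the distribution `H`: the lower left block of `ω(ξ)` is zero. -/
def AlongH (u : Q) (ξ : TangentSpace 𝓘(ℝ, EP) u) : Prop :=
  ∀ i j, G.form u ξ (Sum.inr (Sum.inr i)) (Sum.inl j) = 0

/-- A smooth section over `W ⊆ M` of the tractor bundle `Q ×_P ℝ^{(n+1,n)}`, as a `P`-equivariant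
function on `Q`. -/
def IsTractorSection (W : Set M) (s : Q → TVec n) : Prop :=
  (∀ i, ContMDiffOn 𝓘(ℝ, EP) 𝓘(ℝ, ℝ) ∞ (fun u => s u i) (G.proj ⁻¹' W)) ∧
    ∀ u ∈ G.proj ⁻¹' W, ∀ p : Parabolic n, s (G.act u p) = pmat p⁻¹ *ᵥ s u

/-- The tractor connection, in the direction of `ξ` (that is, of its image in `T M`). -/
noncomputable def tractorDeriv (s : Q → TVec n) (u : Q) (ξ : TangentSpace 𝓘(ℝ, EP) u) : TVec n :=
  dVec s u ξ + G.form u ξ *ᵥ s u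

/-- A Weyl structure over `D ⊆ M`: a smooth `P`-equivariant function to `𝔭` that lifts the grading
element of `𝔭 / 𝔭^⊥`. Only its values over `D` matter. -/
structure IsWeylStructure (D : Set M) (η : Q → TMat n) : Prop where
  smooth : ∀ i j, ContMDiffOn 𝓘(ℝ, EP) 𝓘(ℝ, ℝ) ∞ (fun u => η u i j) (G.proj ⁻¹' D)
  lift : ∀ u ∈ G.proj ⁻¹' D, InNilradical (η u - gradingElt n)
  equivariant : ∀ u ∈ G.proj ⁻¹' D, ∀ p : Parabolic n,
    η (G.act u p) = pmat p⁻¹ * η u * pmat p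

/-- The rho-tensor of the Weyl structure `η`, as a function of `y ∈ 𝔤 / 𝔭 ≅ T` with values in
`𝔭^⊥ ≅ T^*`. The preferred connection `∇` has `∇ η = 0`, and the tractor connection is
`∇ + Z + P(Z)`; so the tractor derivative of `η` in the direction `Z` is `[Z + P(Z), η]`, whose
components of degree `1` and `2` are `- P(Z)_1` and `- 2 P(Z)_2`. (On the reduction of `Q` to
`GL(n)` where `η` is the standard grading element, this makes `P` the part of degree `1` and `2`
of `ω`.) -/
noncomputable def rho (η : Q → TMat n) (u : Q) (y : TMat n) : TMat n :=
  -(gradeComp (η u) 1 (dMat η u (G.vec u y) + ⁅y, η u⁆) +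
    (1 / 2 : ℝ) • gradeComp (η u) 2 (dMat η u (G.vec u y) + ⁅y, η u⁆))

/-- The connection form of the preferred connection `∇` of the Weyl structure `η`: what remains of
`ω` when `Z` and `P(Z)` are subtracted. (On the reduction where `η` is standard, it is the part of
degree `0` of `ω`.) It has values in `𝔭`, and induces `∇` on all bundles associated to `Q`. -/
noncomputable def weylForm (η : Q → TMat n) (u : Q) (ξ : TangentSpace 𝓘(ℝ, EP) u) : TMat n :=
  G.form u ξ - gradeComp (η u) (-2) (G.form u ξ) - gradeComp (η u) (-1) (G.form u ξ) -
    G.rho η u (G.form u ξ)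

/-- The covariant derivative `∇_ξ P`, evaluated on the tangent vector represented by `y`. -/
noncomputable def nablaRho (η : Q → TMat n) (u : Q) (ξ : TangentSpace 𝓘(ℝ, EP) u) (y : TMat n) :
    TMat n :=
  dMat (fun v => G.rho η v y) u ξ + ⁅G.weylForm η u ξ, G.rho η u y⁆ -
    G.rho η u ⁅G.weylForm η u ξ, y⁆

/-- The covariant derivative `∇_ξ b` of a bilinear form on `H`, evaluated on `X` and `Y`. -/
noncomputable def nablaFormH (η : Q → TMat n) (b : Q → (Fin n → ℝ) → (Fin n → ℝ) → ℝ)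
    (u : Q) (ξ : TangentSpace 𝓘(ℝ, EP) u) (X Y : Fin n → ℝ) : ℝ :=
  let A : Matrix (Fin n) (Fin n) ℝ :=
    Matrix.of fun i j => G.weylForm η u ξ (Sum.inr (Sum.inr i)) (Sum.inr (Sum.inr j))
  (show ℝ from mfderiv 𝓘(ℝ, EP) 𝓘(ℝ, ℝ) (fun v => b v X Y) u ξ) - b u (A *ᵥ X) Y - b u X (A *ᵥ Y)

/-- The covariant derivative `∇_ξ b` of a bilinear form on `T = Q ×_P 𝔤 / 𝔭`, evaluated on the tangent
vectors represented by `y` and `z`. -/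
noncomputable def nablaFormT (η : Q → TMat n) (b : Q → TMat n → TMat n → ℝ)
    (u : Q) (ξ : TangentSpace 𝓘(ℝ, EP) u) (y z : TMat n) : ℝ :=
  (show ℝ from mfderiv 𝓘(ℝ, EP) 𝓘(ℝ, ℝ) (fun v => b v y z) u ξ) -
    b u ⁅G.weylForm η u ξ, y⁆ z - b u y ⁅G.weylForm η u ξ, z⁆

/-- A smooth subbundle of rank `r` of the tractor bundle. -/
structure TractorSubbundle (r : ℕ) where
  /-- The fibre, as a subspace of `ℝ^{(n+1,n)}` in the frame `u`. -/
  fiber : Q → Submodule ℝ (TVec n)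
  finrank_fiber : ∀ u, Module.finrank ℝ (fiber u) = r
  equivariant : ∀ (u : Q) (p : Parabolic n) (t : TVec n),
    t ∈ fiber (G.act u p) ↔ pmat p *ᵥ t ∈ fiber u
  smooth : ∀ u : Q, ∃ O : Set Q, IsOpen O ∧ u ∈ O ∧ ∃ s : Fin r → Q → TVec n,
    (∀ i a, ContMDiffOn 𝓘(ℝ, EP) 𝓘(ℝ, ℝ) ∞ (fun v => s i v a) O) ∧
    ∀ v ∈ O, fiber v = Submodule.span ℝ (Set.range fun i => s i v)

namespace TractorSubbundle

variable {G} {r : ℕ} (V : G.TractorSubbundle r)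

/-- The points of `M` over which the projection from the tractor bundle to `H` is injective on `V`. -/
def injLocus : Set M :=
  {x | ∀ u : Q, G.proj u = x → ∀ t ∈ V.fiber u, hBlock t = 0 → t = 0}

/-- `V` is generic: it is mapped injectively to `H` over an open dense subset of `M`. -/
def IsGeneric : Prop := ∃ O : Set M, IsOpen O ∧ Dense O ∧ O ⊆ V.injLocus

/-- The tractor connection preserves `V`. -/
def IsPreserved : Prop :=
  ∀ (W : Set M) (s : Q → TVec n), IsOpen W → G.IsTractorSection W s →
    (∀ u ∈ G.proj ⁻¹' W, s u ∈ V.fiber u) →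
    ∀ u ∈ G.proj ⁻¹' W, ∀ ξ : TangentSpace 𝓘(ℝ, EP) u, G.tractorDeriv s u ξ ∈ V.fiber u

/-- The tractor connection preserves `V` in the directions of `H`. -/
def IsPreservedAlongH : Prop :=
  ∀ (W : Set M) (s : Q → TVec n), IsOpen W → G.IsTractorSection W s →
    (∀ u ∈ G.proj ⁻¹' W, s u ∈ V.fiber u) →
    ∀ u ∈ G.proj ⁻¹' W, ∀ ξ : TangentSpace 𝓘(ℝ, EP) u, G.AlongH u ξ →
      G.tractorDeriv s u ξ ∈ V.fiber u

/-- The Weyl structure `η` over `D` is `V`-preferred: `g^∇ = g`. With `A ≅ V` the image of `V` in `H`,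
`g^∇` is the map `A → H^* → A^*` given by the splitting, and `g` is the restriction of `h` to `V`. -/
def IsPreferred (D : Set M) (η : Q → TMat n) : Prop :=
  G.IsWeylStructure D η ∧ ∀ u ∈ G.proj ⁻¹' D, ∀ s ∈ V.fiber u, ∀ t ∈ V.fiber u,
    starComp (η u) s ⬝ᵥ hBlock t = tractorMetric s t

/-- The Weyl structure `η` over `D` is strongly `V`-preferred: it is `V`-preferred, and the image of `V`
in `H^*` meets the annihilator of `A` only in zero. -/
def IsStronglyPreferred (D : Set M) (η : Q → TMat n) : Prop :=
  V.IsPreferred D η ∧ ∀ u ∈ G.proj ⁻¹' D, ∀ s ∈ V.fiber u,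
    (∀ t ∈ V.fiber u, starComp (η u) s ⬝ᵥ hBlock t = 0) → starComp (η u) s = 0

/-- The map `μ : A → H^*` at `u`: lift `X ∈ A` to `V`, and take the `H^*`-component. -/
noncomputable def mu (η : Q → TMat n) (u : Q) (X : Fin n → ℝ) : Fin n → ℝ :=
  starComp (η u) (Function.invFunOn hBlock (V.fiber u : Set (TVec n)) X)

/-- `μ` as a bilinear form. -/
noncomputable def muH (η : Q → TMat n) (u : Q) (X Y : Fin n → ℝ) : ℝ := V.mu η u X ⬝ᵥ Y

/-- The extension of `μ` to `T = T_{-2} ⊕ H` (when `A = H`): on `T_{-2} ≅ H ∧ H` it is the form induced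
by `μ`, and the two summands are perpendicular. -/
noncomputable def muT (η : Q → TMat n) (u : Q) (y z : TMat n) : ℝ :=
  V.muH η u (tanOne (η u) y) (tanOne (η u) z) +
    wedgeForm (V.muH η u) (tanTwo (η u) y) (tanTwo (η u) z)

/-- `V` is non-degenerate at `u` for the tractor metric. -/
def IsNondegAt (u : Q) : Prop :=
  ∀ s ∈ V.fiber u, (∀ t ∈ V.fiber u, tractorMetric s t = 0) → s = 0

/-- `V` is positive definite at `u` for the tractor metric. -/
def IsPosDefAt (u : Q) : Prop := ∀ s ∈ V.fiber u, s ≠ 0 → 0 < tractorMetric s s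

/-- The field `g` of bilinear forms on `M` is the metric `μ` on `T M`, over `D`: it pulls back to `μ` and
it is symmetric and smooth. -/
structure IsMetricOf (D : Set M) (η : Q → TMat n)
    (g : ∀ x : M, TangentSpace 𝓘(ℝ, EM) x →ₗ[ℝ] TangentSpace 𝓘(ℝ, EM) x →ₗ[ℝ] ℝ) : Prop where
  pullback : ∀ u ∈ G.proj ⁻¹' D, ∀ ξ ζ : TangentSpace 𝓘(ℝ, EP) u,
    g (G.proj u) (mfderiv 𝓘(ℝ, EP) 𝓘(ℝ, EM) G.proj u ξ) (mfderiv 𝓘(ℝ, EP) 𝓘(ℝ, EM) G.proj u ζ) =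
      V.muT η u (G.form u ξ) (G.form u ζ)
  symm : ∀ x ∈ D, ∀ a b, g x a b = g x b a
  smooth : ContMDiffOn 𝓘(ℝ, EM).tangent 𝓘(ℝ, ℝ) ∞
    (fun v : TangentBundle 𝓘(ℝ, EM) M => g v.proj v.snd v.snd) {v | v.proj ∈ D}

end TractorSubbundle

end CartanGeometry

end Geometry

/-! Over $M_0$ the fibre of $V$ in any frame is a graph $X \mapsto (LX,\ l\cdot X,\ X)$, and a Weyl
structure at a point is a pair $(b, c)$ with $c$ skew: the parts of degree one and two of the lift
of the grading element. In its splitting the $H^*$-part of the graph is $L + b l^T + \frac12(c - b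
b^T)$, while $h|_V$ has the matrix $m = \frac12(L + L^T + l l^T)$. Equality of the two reads $(b_i -
l_i)^2 = 0$ on the diagonal, so $b = l$, and then $c = L^T - L$ (`starComp_eq_tractorMetric_iff`).
So exactly one lift is preferred at each point. Its uniqueness yields its equivariance, and its
smoothness follows from Cramer's rule. As $V$ projects onto all of $H$, the annihilator of $A$ is
zero and the strong condition is automatic.

There is a unipotent frame that carries the standard grading element to this lift. In it $V$ becomes
the graph of the symmetric matrix $m$ with no middle component (`graphMat_eq_weylFrame_mul`), and
$\omega$ becomes an $\mathfrak{so}(n+1,n)$-valued `gaugedForm` whose blocks are $Z_2, Z_1$ (the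
tangent vector), $a$ (the preferred connection) and $P_1, P_2$ (the rho-tensor). That $V$ is
preserved in a direction says $P_1 = -mZ_1$ and $dm + am + ma^T = mZ_2m - P_2$. In the second
equation the left side is symmetric and the right side is skew, so both vanish
(`matDeriv_metricMat`). The left side gives $\nabla\mu = 0$ in that direction alone, which is why
directions in $H$ can be treated separately. The right side and $P_1 = -mZ_1$ give all components of
$\mathsf P$. Then $\mathsf P$ is an algebraic expression in the parallel form $m$, hence parallel.

The form on $T$ is first computed on the total space, from the blocks $Z_1, Z_2$ of $\omega$. It
descends to $M$ because the kernel of the differential of the projection is exactly $Z_1 = Z_2 = 0$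
(`dproj_eq_zero_iff`) and because it is invariant under $P$ (`modelForm_act`). On $H \wedge H$
non-degeneracy follows by pairing $C$ with $mCm$, and positivity by writing $m = B^TB$, which turns
the form into half the squared norm of $BCB^T$. -/

section BlockMatrices

/-! ### Block matrices, the algebra so(n+1,n) and the tractor metric -/

variable {n : ℕ}

/-- A square matrix on `ℝ^{(n+1,n)}`, given by its nine blocks. -/
def ofBlocks (a : Matrix (Fin n) (Fin n) ℝ) (b : Matrix (Fin n) Unit ℝ)
    (c : Matrix (Fin n) (Fin n) ℝ) (d : Matrix Unit (Fin n) ℝ) (e : Matrix Unit Unit ℝ)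
    (f : Matrix Unit (Fin n) ℝ) (g : Matrix (Fin n) (Fin n) ℝ) (h : Matrix (Fin n) Unit ℝ)
    (k : Matrix (Fin n) (Fin n) ℝ) : TMat n :=
  Matrix.of fun x y => match x, y with
    | Sum.inl i, Sum.inl j => a i j
    | Sum.inl i, Sum.inr (Sum.inl j) => b i j
    | Sum.inl i, Sum.inr (Sum.inr j) => c i j
    | Sum.inr (Sum.inl i), Sum.inl j => d i j
    | Sum.inr (Sum.inl i), Sum.inr (Sum.inl j) => e i j
    | Sum.inr (Sum.inl i), Sum.inr (Sum.inr j) => f i j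
    | Sum.inr (Sum.inr i), Sum.inl j => g i j
    | Sum.inr (Sum.inr i), Sum.inr (Sum.inl j) => h i j
    | Sum.inr (Sum.inr i), Sum.inr (Sum.inr j) => k i j

section Entries

variable (a : Matrix (Fin n) (Fin n) ℝ) (b : Matrix (Fin n) Unit ℝ)
    (c : Matrix (Fin n) (Fin n) ℝ) (d : Matrix Unit (Fin n) ℝ) (e : Matrix Unit Unit ℝ)
    (f : Matrix Unit (Fin n) ℝ) (g : Matrix (Fin n) (Fin n) ℝ) (h : Matrix (Fin n) Unit ℝ)
    (k : Matrix (Fin n) (Fin n) ℝ) (i j : Fin n)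

@[simp] theorem ofBlocks_tt : ofBlocks a b c d e f g h k (Sum.inl i) (Sum.inl j) = a i j := rfl
@[simp] theorem ofBlocks_tm (u : Unit) :
    ofBlocks a b c d e f g h k (Sum.inl i) (Sum.inr (Sum.inl u)) = b i u := rfl
@[simp] theorem ofBlocks_tb :
    ofBlocks a b c d e f g h k (Sum.inl i) (Sum.inr (Sum.inr j)) = c i j := rfl
@[simp] theorem ofBlocks_mt (u : Unit) :
    ofBlocks a b c d e f g h k (Sum.inr (Sum.inl u)) (Sum.inl j) = d u j := rfl
@[simp] theorem ofBlocks_mm (u v : Unit) :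
    ofBlocks a b c d e f g h k (Sum.inr (Sum.inl u)) (Sum.inr (Sum.inl v)) = e u v := rfl
@[simp] theorem ofBlocks_mb (u : Unit) :
    ofBlocks a b c d e f g h k (Sum.inr (Sum.inl u)) (Sum.inr (Sum.inr j)) = f u j := rfl
@[simp] theorem ofBlocks_bt :
    ofBlocks a b c d e f g h k (Sum.inr (Sum.inr i)) (Sum.inl j) = g i j := rfl
@[simp] theorem ofBlocks_bm (u : Unit) :
    ofBlocks a b c d e f g h k (Sum.inr (Sum.inr i)) (Sum.inr (Sum.inl u)) = h i u := rfl
@[simp] theorem ofBlocks_bb :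
    ofBlocks a b c d e f g h k (Sum.inr (Sum.inr i)) (Sum.inr (Sum.inr j)) = k i j := rfl

end Entries

variable {a a' c c' g g' k k' : Matrix (Fin n) (Fin n) ℝ} {b b' h h' : Matrix (Fin n) Unit ℝ}
  {d d' f f' : Matrix Unit (Fin n) ℝ} {e e' : Matrix Unit Unit ℝ}

theorem ofBlocks_inj : ofBlocks a b c d e f g h k = ofBlocks a' b' c' d' e' f' g' h' k' ↔
    a = a' ∧ b = b' ∧ c = c' ∧ d = d' ∧ e = e' ∧ f = f' ∧ g = g' ∧ h = h' ∧ k = k' := by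
  constructor
  · intro H
    have H' : ∀ x y, ofBlocks a b c d e f g h k x y = ofBlocks a' b' c' d' e' f' g' h' k' x y :=
      fun x y => by rw [H]
    refine ⟨?_, ?_, ?_, ?_, ?_, ?_, ?_, ?_, ?_⟩ <;> ext i j
    · exact H' (Sum.inl i) (Sum.inl j)
    · exact H' (Sum.inl i) (Sum.inr (Sum.inl j))
    · exact H' (Sum.inl i) (Sum.inr (Sum.inr j))
    · exact H' (Sum.inr (Sum.inl i)) (Sum.inl j)
    · exact H' (Sum.inr (Sum.inl i)) (Sum.inr (Sum.inl j))
    · exact H' (Sum.inr (Sum.inl i)) (Sum.inr (Sum.inr j))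
    · exact H' (Sum.inr (Sum.inr i)) (Sum.inl j)
    · exact H' (Sum.inr (Sum.inr i)) (Sum.inr (Sum.inl j))
    · exact H' (Sum.inr (Sum.inr i)) (Sum.inr (Sum.inr j))
  · rintro ⟨rfl, rfl, rfl, rfl, rfl, rfl, rfl, rfl, rfl⟩
    rfl

theorem exists_eq_ofBlocks (y : TMat n) :
    ∃ a b c d e f g h k, y = ofBlocks a b c d e f g h k :=
  ⟨of fun i j => y (Sum.inl i) (Sum.inl j),
    of fun i j => y (Sum.inl i) (Sum.inr (Sum.inl j)),
    of fun i j => y (Sum.inl i) (Sum.inr (Sum.inr j)),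
    of fun i j => y (Sum.inr (Sum.inl i)) (Sum.inl j),
    of fun i j => y (Sum.inr (Sum.inl i)) (Sum.inr (Sum.inl j)),
    of fun i j => y (Sum.inr (Sum.inl i)) (Sum.inr (Sum.inr j)),
    of fun i j => y (Sum.inr (Sum.inr i)) (Sum.inl j),
    of fun i j => y (Sum.inr (Sum.inr i)) (Sum.inr (Sum.inl j)),
    of fun i j => y (Sum.inr (Sum.inr i)) (Sum.inr (Sum.inr j)), by
    ext (i | i | i) (j | j | j) <;> rfl⟩

theorem ofBlocks_mul :
    ofBlocks a b c d e f g h k * ofBlocks a' b' c' d' e' f' g' h' k' =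
      ofBlocks (a * a' + b * d' + c * g') (a * b' + b * e' + c * h') (a * c' + b * f' + c * k')
        (d * a' + e * d' + f * g') (d * b' + e * e' + f * h') (d * c' + e * f' + f * k')
        (g * a' + h * d' + k * g') (g * b' + h * e' + k * h') (g * c' + h * f' + k * k') := by
  ext (i | i | i) (j | j | j) <;>
    simp [Matrix.mul_apply, Fintype.sum_sum_type, add_assoc]

theorem ofBlocks_add :
    ofBlocks a b c d e f g h k + ofBlocks a' b' c' d' e' f' g' h' k' =
      ofBlocks (a + a') (b + b') (c + c') (d + d') (e + e') (f + f') (g + g') (h + h') (k + k') := by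
  ext (i | i | i) (j | j | j) <;> rfl

theorem ofBlocks_sub :
    ofBlocks a b c d e f g h k - ofBlocks a' b' c' d' e' f' g' h' k' =
      ofBlocks (a - a') (b - b') (c - c') (d - d') (e - e') (f - f') (g - g') (h - h') (k - k') := by
  ext (i | i | i) (j | j | j) <;> rfl

theorem ofBlocks_neg :
    -ofBlocks a b c d e f g h k = ofBlocks (-a) (-b) (-c) (-d) (-e) (-f) (-g) (-h) (-k) := by
  ext (i | i | i) (j | j | j) <;> rfl

theorem ofBlocks_smul (r : ℝ) : r • ofBlocks a b c d e f g h k =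
    ofBlocks (r • a) (r • b) (r • c) (r • d) (r • e) (r • f) (r • g) (r • h) (r • k) := by
  ext (i | i | i) (j | j | j) <;> rfl

theorem ofBlocks_transpose :
    (ofBlocks a b c d e f g h k)ᵀ = ofBlocks aᵀ dᵀ gᵀ bᵀ eᵀ hᵀ cᵀ fᵀ kᵀ := by
  ext (i | i | i) (j | j | j) <;> rfl

theorem one_eq_ofBlocks : (1 : TMat n) = ofBlocks 1 0 0 0 1 0 0 0 1 := by
  ext (i | i | i) (j | j | j) <;> simp [Matrix.one_apply]

theorem zero_eq_ofBlocks : (0 : TMat n) = ofBlocks 0 0 0 0 0 0 0 0 0 := by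
  ext (i | i | i) (j | j | j) <;> rfl

theorem Jmat_eq_ofBlocks : Jmat n = ofBlocks 0 0 1 0 1 0 1 0 0 := by
  ext (i | i | i) (j | j | j) <;> simp [Jmat, Matrix.one_apply]

theorem gradingElt_eq_ofBlocks : gradingElt n = ofBlocks 1 0 0 0 0 0 0 0 (-1) := by
  ext (i | i | i) (j | j | j) <;> simp [gradingElt, Matrix.one_apply, Matrix.diagonal_apply] <;>
    split_ifs <;> simp

theorem Jmat_mul_self : Jmat n * Jmat n = 1 := by
  simp [Jmat_eq_ofBlocks, ofBlocks_mul, one_eq_ofBlocks]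

theorem mem_soAlg_iff {y : TMat n} : y ∈ soAlg n ↔ yᵀ * Jmat n + Jmat n * y = 0 := by
  rw [mem_skewAdjointMatricesSubmodule, Matrix.IsSkewAdjoint, Matrix.IsAdjointPair, Matrix.mul_neg,
    eq_neg_iff_add_eq_zero]

theorem ofBlocks_mem_soAlg (hc : cᵀ = -c) (hg : gᵀ = -g) :
    ofBlocks a b c (-hᵀ) 0 (-bᵀ) g h (-aᵀ) ∈ soAlg n := by
  rw [mem_soAlg_iff]
  simp [Jmat_eq_ofBlocks, ofBlocks_mul, ofBlocks_transpose, ofBlocks_add, zero_eq_ofBlocks, hc, hg]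

theorem exists_eq_ofBlocks_of_mem_soAlg {y : TMat n} (hy : y ∈ soAlg n) :
    ∃ (a : Matrix (Fin n) (Fin n) ℝ) (b : Matrix (Fin n) Unit ℝ) (c g : Matrix (Fin n) (Fin n) ℝ)
      (h : Matrix (Fin n) Unit ℝ), cᵀ = -c ∧ gᵀ = -g ∧
      y = ofBlocks a b c (-hᵀ) 0 (-bᵀ) g h (-aᵀ) := by
  obtain ⟨a, b, c, d, e, f, g, h, k, rfl⟩ := exists_eq_ofBlocks y
  rw [mem_soAlg_iff] at hy
  simp only [Jmat_eq_ofBlocks, ofBlocks_mul, ofBlocks_transpose, ofBlocks_add, zero_eq_ofBlocks,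
    ofBlocks_inj] at hy
  simp only [Matrix.mul_zero, Matrix.mul_one, Matrix.zero_mul, Matrix.one_mul, zero_add,
    add_zero] at hy
  obtain ⟨h1, h2, h3, h4, h5, h6, h7, h8, h9⟩ := hy
  refine ⟨a, b, c, g, h, eq_neg_of_add_eq_zero_left h9, eq_neg_of_add_eq_zero_left h1, ?_⟩
  rw [ofBlocks_inj]
  refine ⟨rfl, rfl, rfl, eq_neg_of_add_eq_zero_right h4, ?_, eq_neg_of_add_eq_zero_right h6, rfl, rfl,
    eq_neg_of_add_eq_zero_right h3⟩
  ext i j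
  have := congrFun (congrFun h5 i) j
  simp only [Matrix.add_apply, Matrix.transpose_apply, Matrix.zero_apply] at this
  simp only [Matrix.zero_apply]
  -- The middle block is 1 × 1, hence its own transpose, so skewness makes it vanish.
  have e1 : e j i = e i j := rfl
  linarith

/-- The three blocks of a product of a matrix with a vector. -/
theorem topBlock_ofBlocks_mulVec (t : TVec n) :
    topBlock (ofBlocks a b c d e f g h k *ᵥ t) =
      a *ᵥ topBlock t + b *ᵥ (fun _ => midCoord t) + c *ᵥ hBlock t := by
  ext i
  simp [topBlock, hBlock, midCoord, midIdx, Matrix.mulVec, dotProduct, Fintype.sum_sum_type, add_assoc]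

theorem midCoord_ofBlocks_mulVec (t : TVec n) :
    midCoord (ofBlocks a b c d e f g h k *ᵥ t) =
      (d *ᵥ topBlock t + e *ᵥ (fun _ => midCoord t) + f *ᵥ hBlock t) () := by
  simp [topBlock, hBlock, midCoord, midIdx, Matrix.mulVec, dotProduct, Fintype.sum_sum_type, add_assoc]

theorem hBlock_ofBlocks_mulVec (t : TVec n) :
    hBlock (ofBlocks a b c d e f g h k *ᵥ t) =
      g *ᵥ topBlock t + h *ᵥ (fun _ => midCoord t) + k *ᵥ hBlock t := by
  ext i
  simp [topBlock, hBlock, midCoord, midIdx, Matrix.mulVec, dotProduct, Fintype.sum_sum_type, add_assoc]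

/-- The vector with the given blocks. -/
def ofVecBlocks (v : Fin n → ℝ) (r : ℝ) (X : Fin n → ℝ) : TVec n :=
  Sum.elim v (Sum.elim (fun _ => r) X)

@[simp] theorem topBlock_ofVecBlocks (v : Fin n → ℝ) (r : ℝ) (X : Fin n → ℝ) :
    topBlock (ofVecBlocks v r X) = v := rfl
@[simp] theorem midCoord_ofVecBlocks (v : Fin n → ℝ) (r : ℝ) (X : Fin n → ℝ) :
    midCoord (ofVecBlocks v r X) = r := rfl
@[simp] theorem hBlock_ofVecBlocks (v : Fin n → ℝ) (r : ℝ) (X : Fin n → ℝ) :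
    hBlock (ofVecBlocks v r X) = X := rfl

theorem ofVecBlocks_eta (t : TVec n) : ofVecBlocks (topBlock t) (midCoord t) (hBlock t) = t := by
  ext (i | i | i) <;> rfl

theorem tvec_ext {s t : TVec n} (h1 : topBlock s = topBlock t) (h2 : midCoord s = midCoord t)
    (h3 : hBlock s = hBlock t) : s = t := by
  rw [← ofVecBlocks_eta s, ← ofVecBlocks_eta t, h1, h2, h3]

theorem tractorMetric_eq (s t : TVec n) :
    tractorMetric s t = (1 / 2) * (s ⬝ᵥ (Jmat n *ᵥ t)) := by
  have h2 : s ⬝ᵥ (Jmat n *ᵥ t) = topBlock s ⬝ᵥ topBlock (Jmat n *ᵥ t) +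
      midCoord s * midCoord (Jmat n *ᵥ t) + hBlock s ⬝ᵥ hBlock (Jmat n *ᵥ t) := by
    simp [dotProduct, Fintype.sum_sum_type, topBlock, midCoord, hBlock, add_assoc]
  rw [h2, Jmat_eq_ofBlocks, topBlock_ofBlocks_mulVec, midCoord_ofBlocks_mulVec,
    hBlock_ofBlocks_mulVec, tractorMetric]
  simp only [Matrix.zero_mulVec, Matrix.one_mulVec, zero_add, add_zero]
  rw [dotProduct_comm (topBlock t)]
  ring

theorem tractorMetric_mulVec {A : TMat n} (hA : Aᵀ * Jmat n * A = Jmat n) (s t : TVec n) :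
    tractorMetric (A *ᵥ s) (A *ᵥ t) = tractorMetric s t := by
  rw [tractorMetric_eq, tractorMetric_eq, Matrix.mulVec_mulVec, dotProduct_comm,
    Matrix.dotProduct_mulVec, ← Matrix.mulVec_transpose, dotProduct_comm, Matrix.mulVec_mulVec]
  conv_rhs => rw [← hA]
  rw [Matrix.mul_assoc]

theorem tractorMetric_of_inTop {s : TVec n} (hs : InTop s) (t : TVec n) :
    tractorMetric s t = (1 / 2) * (topBlock s ⬝ᵥ hBlock t) := by
  simp [tractorMetric, hs.1, hs.2]

/-- $\mathbb R \oplus H^*$ is the orthogonal complement of $H^*$. This recovers the whole filtration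
from its smallest member, the only one that the definition of `Parabolic` mentions. For the
converse, $t$ is tested against the covector with the coordinates of its own $H$-block. -/
theorem hBlock_eq_zero_iff {t : TVec n} :
    hBlock t = 0 ↔ ∀ s, InTop s → tractorMetric s t = 0 := by
  constructor
  · intro h s hs
    simp [tractorMetric_of_inTop hs, h]
  · intro H
    have := H (ofVecBlocks (hBlock t) 0 0) ⟨rfl, rfl⟩
    rw [tractorMetric_of_inTop ⟨rfl, rfl⟩] at this
    simpa using this

end BlockMatrices

/-! ### Lifts of the grading element and the unipotent frames adapted to them -/

section WeylLifts

variable {n : ℕ}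

/-- The lift of the grading element with the given off-diagonal blocks. -/
def weylLift (b : Matrix (Fin n) Unit ℝ) (c : Matrix (Fin n) (Fin n) ℝ) : TMat n :=
  ofBlocks 1 b c 0 0 (-bᵀ) 0 0 (-1)

/-- The unipotent matrix that conjugates the grading element to `weylLift b c`. -/
noncomputable def weylFrame (b : Matrix (Fin n) Unit ℝ) (c : Matrix (Fin n) (Fin n) ℝ) : TMat n :=
  ofBlocks 1 (-b) (-((1 / 2 : ℝ) • (b * bᵀ + c))) 0 1 bᵀ 0 0 1

/-- The inverse of `weylFrame b c`. -/
noncomputable def weylFrameInv (b : Matrix (Fin n) Unit ℝ) (c : Matrix (Fin n) (Fin n) ℝ) : TMat n :=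
  ofBlocks 1 b ((1 / 2 : ℝ) • (c - b * bᵀ)) 0 1 (-bᵀ) 0 0 1

variable (b : Matrix (Fin n) Unit ℝ) (c : Matrix (Fin n) (Fin n) ℝ)

theorem weylFrame_mul_weylFrameInv : weylFrame b c * weylFrameInv b c = 1 := by
  rw [weylFrame, weylFrameInv, ofBlocks_mul, one_eq_ofBlocks, ofBlocks_inj]
  refine ⟨by simp, by simp, ?_, by simp, by simp, by simp, by simp, by simp, by simp⟩
  simp only [Matrix.one_mul, Matrix.mul_one, Matrix.neg_mul, Matrix.mul_neg]
  module

theorem weylFrameInv_mul_weylFrame : weylFrameInv b c * weylFrame b c = 1 := by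
  rw [weylFrame, weylFrameInv, ofBlocks_mul, one_eq_ofBlocks, ofBlocks_inj]
  refine ⟨by simp, by simp, ?_, by simp, by simp, by simp, by simp, by simp, by simp⟩
  simp only [Matrix.one_mul, Matrix.mul_one]
  module

/-- The frame is the exponential of $-(Y_1 + \frac12 Y_2)$, where $Y_1, Y_2$ are the parts of degree
1 and 2 of `weylLift b c - gradingElt n`. The factor ½ compensates the weight 2 with which the
grading element acts on degree 2. Every question about a splitting can thereby be moved to the
standard one. -/
theorem weylFrame_conj_gradingElt : weylFrame b c * gradingElt n * weylFrameInv b c = weylLift b c := by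
  rw [weylFrame, weylFrameInv, gradingElt_eq_ofBlocks, ofBlocks_mul, ofBlocks_mul, weylLift, ofBlocks_inj]
  refine ⟨by simp, by simp, ?_, by simp, by simp, by simp, by simp, by simp, by simp⟩
  simp only [Matrix.one_mul, Matrix.mul_one, Matrix.mul_zero, Matrix.mul_neg, zero_add, add_zero,
    Matrix.zero_mul]
  module

variable {b c}

/-- Only the last block is not immediate: there the terms $bb^T$ cancel, and $-\frac12(c + c^T)$
remains. -/
theorem weylFrame_isometry (hc : cᵀ = -c) : (weylFrame b c)ᵀ * Jmat n * weylFrame b c = Jmat n := by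
  rw [weylFrame, ofBlocks_transpose, Jmat_eq_ofBlocks, ofBlocks_mul, ofBlocks_mul, ofBlocks_inj]
  refine ⟨by simp, by simp, by simp, by simp, by simp, by simp, by simp, by simp, ?_⟩
  simp only [Matrix.mul_one, Matrix.mul_zero, zero_add, add_zero, Matrix.transpose_neg,
    Matrix.transpose_smul, Matrix.transpose_add, Matrix.transpose_mul, Matrix.transpose_transpose,
    hc, Matrix.transpose_one, Matrix.one_mul]
  module

/-- Conjugation of the spectral projections. -/
theorem specProj_conj {T T' : TMat n} (h2 : T' * T = 1) (h1 : T * T' = 1) (E : TMat n) (a : ℤ) :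
    specProj (T * E * T') a = T * specProj E a * T' := by
  have h3 : T * E * T' * (T * E * T') = T * (E * E) * T' := by
    calc T * E * T' * (T * E * T') = T * E * (T' * T) * E * T' := by noncomm_ring
      _ = T * (E * E) * T' := by rw [h2]; noncomm_ring
  unfold specProj
  split_ifs
  · rw [h3, Matrix.mul_smul, Matrix.smul_mul]; congr 1; noncomm_ring
  · rw [h3, Matrix.mul_sub, Matrix.sub_mul, Matrix.mul_one, h1]
  · rw [h3, Matrix.mul_smul, Matrix.smul_mul]; congr 1; noncomm_ring
  · simp

theorem gradeComp_conj {T T' : TMat n} (h2 : T' * T = 1) (h1 : T * T' = 1) (E : TMat n) (k : ℤ)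
    (y : TMat n) : gradeComp (T * E * T') k y = T * gradeComp E k (T' * y * T) * T' := by
  simp only [gradeComp, specProj_conj h2 h1, Finset.mul_sum, Finset.sum_mul]
  refine Finset.sum_congr rfl fun a _ => ?_
  noncomm_ring

theorem specProj_gradingElt_one : specProj (gradingElt n) 1 = ofBlocks 1 0 0 0 0 0 0 0 0 := by
  rw [specProj, if_pos rfl, gradingElt_eq_ofBlocks, ofBlocks_mul, ofBlocks_add, ofBlocks_smul,
    ofBlocks_inj]
  simp only [Matrix.mul_zero, Matrix.zero_mul, add_zero, smul_zero, Matrix.mul_one, zero_add,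
    mul_neg, neg_neg, add_neg_cancel, and_true]
  module

theorem specProj_gradingElt_zero : specProj (gradingElt n) 0 = ofBlocks 0 0 0 0 1 0 0 0 0 := by
  rw [specProj, if_neg (by norm_num), if_pos rfl, gradingElt_eq_ofBlocks, ofBlocks_mul,
    one_eq_ofBlocks, ofBlocks_sub, ofBlocks_inj]
  simp

theorem specProj_gradingElt_neg_one :
    specProj (gradingElt n) (-1) = ofBlocks 0 0 0 0 0 0 0 0 1 := by
  rw [specProj, if_neg (by norm_num), if_neg (by norm_num), if_pos rfl, gradingElt_eq_ofBlocks,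
    ofBlocks_mul, ofBlocks_sub, ofBlocks_smul, ofBlocks_inj]
  simp only [Matrix.mul_zero, Matrix.zero_mul, add_zero, smul_zero, Matrix.mul_one, zero_add,
    mul_neg, neg_neg, sub_self, true_and]
  exact ⟨by module, by module⟩

/-- In `gradeComp` the index `a - k` can leave the range $-1, 0, 1$. The default value 0 removes
just those summands, for which there is no eigenspace to start from. -/
theorem specProj_eq_zero (N : TMat n) {a : ℤ} (h1 : a ≠ 1) (h0 : a ≠ 0) (h2 : a ≠ -1) :
    specProj N a = 0 := by
  simp [specProj, h1, h0, h2]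

section GradeComp

variable {a c' g k : Matrix (Fin n) (Fin n) ℝ} {b' h : Matrix (Fin n) Unit ℝ}
  {d f : Matrix Unit (Fin n) ℝ} {e : Matrix Unit Unit ℝ}

theorem gradeComp_eq_sum (N : TMat n) (k : ℤ) (y : TMat n) : gradeComp N k y =
    specProj N (-1) * y * specProj N (-1 - k) + specProj N 0 * y * specProj N (0 - k) +
      specProj N 1 * y * specProj N (1 - k) := by
  have : Finset.Icc (-1 : ℤ) 1 = {-1, 0, 1} := by decide
  rw [gradeComp, this, Finset.sum_insert (by decide), Finset.sum_insert (by decide),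
    Finset.sum_singleton, add_assoc]

theorem gradeComp_gradingElt_neg_two : gradeComp (gradingElt n) (-2) (ofBlocks a b' c' d e f g h k) =
    ofBlocks 0 0 0 0 0 0 g 0 0 := by
  rw [gradeComp_eq_sum, specProj_eq_zero _ (a := 0 - -2) (by decide) (by decide) (by decide),
    specProj_eq_zero _ (a := 1 - -2) (by decide) (by decide) (by decide)]
  norm_num [specProj_gradingElt_one, specProj_gradingElt_neg_one, ofBlocks_mul]

theorem gradeComp_gradingElt_neg_one : gradeComp (gradingElt n) (-1) (ofBlocks a b' c' d e f g h k) =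
    ofBlocks 0 0 0 d 0 0 0 h 0 := by
  rw [gradeComp_eq_sum, specProj_eq_zero _ (a := 1 - -1) (by decide) (by decide) (by decide)]
  norm_num [specProj_gradingElt_one, specProj_gradingElt_neg_one, specProj_gradingElt_zero,
    ofBlocks_mul, ofBlocks_add]

theorem gradeComp_gradingElt_one : gradeComp (gradingElt n) 1 (ofBlocks a b' c' d e f g h k) =
    ofBlocks 0 b' 0 0 0 f 0 0 0 := by
  rw [gradeComp_eq_sum, specProj_eq_zero _ (a := -1 - 1) (by decide) (by decide) (by decide)]
  norm_num [specProj_gradingElt_one, specProj_gradingElt_neg_one, specProj_gradingElt_zero,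
    ofBlocks_mul, ofBlocks_add]

theorem gradeComp_gradingElt_two : gradeComp (gradingElt n) 2 (ofBlocks a b' c' d e f g h k) =
    ofBlocks 0 0 c' 0 0 0 0 0 0 := by
  rw [gradeComp_eq_sum, specProj_eq_zero _ (a := -1 - 2) (by decide) (by decide) (by decide),
    specProj_eq_zero _ (a := 0 - 2) (by decide) (by decide) (by decide)]
  norm_num [specProj_gradingElt_one, specProj_gradingElt_neg_one, ofBlocks_mul]

theorem gradeComp_weylLift (k : ℤ) (y : TMat n) : gradeComp (weylLift b c) k y =
    weylFrame b c * gradeComp (gradingElt n) k (weylFrameInv b c * y * weylFrame b c) * weylFrameInv b c := by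
  rw [← weylFrame_conj_gradingElt, gradeComp_conj (weylFrameInv_mul_weylFrame b c) (weylFrame_mul_weylFrameInv b c)]

end GradeComp

/-- The projection to $H^*$ is the standard one conjugated by the frame, and the frame acts as the
identity on $H^*$. -/
theorem starComp_weylLift (t : TVec n) : starComp (weylLift b c) t = topBlock (weylFrameInv b c *ᵥ t) := by
  rw [starComp, ← weylFrame_conj_gradingElt,
    specProj_conj (weylFrameInv_mul_weylFrame b c) (weylFrame_mul_weylFrameInv b c), specProj_gradingElt_one, weylFrame,
    ofBlocks_mul, weylFrameInv, ofBlocks_mul, topBlock_ofBlocks_mulVec, topBlock_ofBlocks_mulVec]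
  simp

theorem gradingElt_mem_soAlg : gradingElt n ∈ soAlg n := by
  have := ofBlocks_mem_soAlg (n := n) (a := 1) (b := 0) (c := 0) (g := 0) (h := 0) (by simp) (by simp)
  rw [gradingElt_eq_ofBlocks]
  simpa using this

/-- The lifts of the grading element, described by their action on the filtration. -/
theorem inNilradical_sub_gradingElt_iff {N : TMat n} : InNilradical (N - gradingElt n) ↔
    N ∈ soAlg n ∧ (∀ t, InTop t → N *ᵥ t = t) ∧ (∀ t, hBlock t = 0 → InTop (N *ᵥ t)) ∧
      ∀ t, hBlock (N *ᵥ t + t) = 0 := by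
  have hE : ∀ t : TVec n, gradingElt n *ᵥ t = ofVecBlocks (topBlock t) 0 (-hBlock t) := by
    intro t
    rw [gradingElt_eq_ofBlocks]
    refine tvec_ext ?_ ?_ ?_
    · rw [topBlock_ofBlocks_mulVec]; simp
    · rw [midCoord_ofBlocks_mulVec]; simp
    · rw [hBlock_ofBlocks_mulVec]; simp [Matrix.neg_mulVec]
  have hH : ∀ s t : TVec n, hBlock (s - t) = hBlock s - hBlock t := fun _ _ => rfl
  have hA : ∀ s t : TVec n, hBlock (s + t) = hBlock s + hBlock t := fun _ _ => rfl
  have hM : ∀ s t : TVec n, midCoord (s - t) = midCoord s - midCoord t := fun _ _ => rfl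
  have hEtop : ∀ t : TVec n, InTop t → gradingElt n *ᵥ t = t := by
    intro t ht
    rw [hE]
    refine tvec_ext rfl ?_ ?_
    · simp [ht.1]
    · simp [ht.2]
  constructor
  · rintro ⟨h1, h2, h3, h4⟩
    refine ⟨by simpa using (soAlg n).add_mem h1 gradingElt_mem_soAlg, fun t ht => ?_, fun t ht => ?_,
      fun t => ?_⟩
    · have := h4 t ht
      rwa [Matrix.sub_mulVec, hEtop t ht, sub_eq_zero] at this
    · have h5 := h3 t ht
      have h6 := h2 t
      rw [Matrix.sub_mulVec, hM, hE] at h5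
      rw [Matrix.sub_mulVec, hH, hE] at h6
      simp only [midCoord_ofVecBlocks, sub_zero] at h5
      simp only [hBlock_ofVecBlocks, ht, neg_zero, sub_zero] at h6
      exact ⟨h5, h6⟩
    · have h6 := h2 t
      rw [Matrix.sub_mulVec, hH, hE] at h6
      simpa [hA] using h6
  · rintro ⟨h1, h2, h3, h4⟩
    refine ⟨(soAlg n).sub_mem h1 gradingElt_mem_soAlg, fun t => ?_, fun t ht => ?_, fun t ht => ?_⟩
    · rw [Matrix.sub_mulVec, hH, hE]
      simpa [hA] using h4 t
    · rw [Matrix.sub_mulVec, hM, hE, (h3 t ht).1]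
      simp
    · rw [Matrix.sub_mulVec, hEtop t ht, h2 t ht, sub_self]

/-- Basis vectors of $H^*$ and the middle basis vector show that an element of the nilradical has no
blocks of degree $\le 0$; what is left of an element of $\mathfrak{so}(n+1,n)$ is a column and a
skew matrix. -/
theorem exists_eq_weylLift {N : TMat n} (hN : InNilradical (N - gradingElt n)) :
    ∃ b c, cᵀ = -c ∧ N = weylLift b c := by
  obtain ⟨h1, h2, h3, h4⟩ := hN
  obtain ⟨a, b, c, g, h, hc, hg, hY⟩ := exists_eq_ofBlocks_of_mem_soAlg h1
  refine ⟨b, c, hc, ?_⟩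
  rw [hY] at h2 h3 h4
  have ha : a = 0 := by
    refine Matrix.ext_of_mulVec_single fun i => ?_
    have := congrArg topBlock (h4 (ofVecBlocks (Pi.single i 1) 0 0) ⟨rfl, rfl⟩)
    rw [topBlock_ofBlocks_mulVec] at this
    simp only [topBlock_ofVecBlocks, midCoord_ofVecBlocks, hBlock_ofVecBlocks, Matrix.mulVec_zero,
      add_zero, Matrix.zero_mulVec] at this ⊢
    rw [show (fun _ : Unit => (0 : ℝ)) = 0 from rfl, Matrix.mulVec_zero, add_zero] at this
    exact this
  have hg : g = 0 := by
    refine Matrix.ext_of_mulVec_single fun i => ?_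
    have := h2 (ofVecBlocks (Pi.single i 1) 0 0)
    rw [hBlock_ofBlocks_mulVec] at this
    simp only [topBlock_ofVecBlocks, midCoord_ofVecBlocks, hBlock_ofVecBlocks, Matrix.mulVec_zero,
      add_zero, Matrix.zero_mulVec] at this ⊢
    rw [show (fun _ : Unit => (0 : ℝ)) = 0 from rfl, Matrix.mulVec_zero, add_zero] at this
    exact this
  have hh : h = 0 := by
    have := h2 (ofVecBlocks 0 1 0)
    rw [hBlock_ofBlocks_mulVec] at this
    simp only [topBlock_ofVecBlocks, midCoord_ofVecBlocks, hBlock_ofVecBlocks, Matrix.mulVec_zero,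
      add_zero, zero_add] at this
    ext i j
    simpa [Matrix.mulVec, dotProduct] using congrFun this i
  rw [sub_eq_iff_eq_add] at hY
  rw [hY, gradingElt_eq_ofBlocks, ofBlocks_add, weylLift, ofBlocks_inj]
  simp [ha, hg, hh]

theorem weylLift_isLift (hc : cᵀ = -c) : InNilradical (weylLift b c - gradingElt n) := by
  have h0 : weylLift b c - gradingElt n = ofBlocks 0 b c 0 0 (-bᵀ) 0 0 0 := by
    rw [gradingElt_eq_ofBlocks, weylLift, ofBlocks_sub, ofBlocks_inj]
    simp
  rw [h0]
  refine ⟨?_, fun t => ?_, fun t ht => ?_, fun t ht => ?_⟩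
  · have := ofBlocks_mem_soAlg (a := 0) (b := b) (g := 0) (h := 0) hc (by simp)
    simpa using this
  · rw [hBlock_ofBlocks_mulVec]; simp
  · rw [midCoord_ofBlocks_mulVec, ht]; simp
  · have h0 : (fun _ : Unit => midCoord t) = 0 := by ext; simp [ht.1]
    refine tvec_ext ?_ ?_ ?_
    · rw [topBlock_ofBlocks_mulVec, ht.2, h0]; simp; rfl
    · rw [midCoord_ofBlocks_mulVec, ht.2, h0]; simp; rfl
    · rw [hBlock_ofBlocks_mulVec, ht.2, h0]; simp; rfl

/-! ### The group P acts on the filtration and on the lifts -/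

section Parabolic

variable (p : Parabolic n)

theorem pmat_isometry : (pmat p)ᵀ * Jmat n * pmat p = Jmat n := p.2.1

theorem pmat_mul (p q : Parabolic n) : pmat (p * q) = pmat p * pmat q := rfl

theorem pmat_one : pmat (1 : Parabolic n) = 1 := rfl

theorem pmat_inv_mul : pmat p⁻¹ * pmat p = 1 := by
  rw [← pmat_mul, inv_mul_cancel, pmat_one]

theorem pmat_mul_inv : pmat p * pmat p⁻¹ = 1 := by
  rw [← pmat_mul, mul_inv_cancel, pmat_one]

/-- For an isometry the inverse is linear in the entries, so a smooth family in $P$ visibly has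
smooth inverses. -/
theorem pmat_inv_eq : pmat p⁻¹ = Jmat n * (pmat p)ᵀ * Jmat n := by
  have h : Jmat n * (pmat p)ᵀ * Jmat n * pmat p = 1 := by
    rw [Matrix.mul_assoc, Matrix.mul_assoc, ← Matrix.mul_assoc (pmat p)ᵀ, pmat_isometry,
      Jmat_mul_self]
  calc pmat p⁻¹ = Jmat n * (pmat p)ᵀ * Jmat n * pmat p * pmat p⁻¹ := by rw [h, Matrix.one_mul]
    _ = _ := by rw [Matrix.mul_assoc, pmat_mul_inv, Matrix.mul_one]

theorem inTop_pmat_mulVec {t : TVec n} : InTop (pmat p *ᵥ t) ↔ InTop t := p.2.2.2 t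

theorem pmat_inv_mulVec_mulVec (t : TVec n) : pmat p⁻¹ *ᵥ (pmat p *ᵥ t) = t := by
  rw [Matrix.mulVec_mulVec, pmat_inv_mul, Matrix.one_mulVec]

theorem pmat_mulVec_inv_mulVec (t : TVec n) : pmat p *ᵥ (pmat p⁻¹ *ᵥ t) = t := by
  rw [Matrix.mulVec_mulVec, pmat_mul_inv, Matrix.one_mulVec]

/-- An isometry that preserves $H^*$ also preserves its orthogonal complement $\mathbb R \oplus
H^*$. -/
theorem hBlock_pmat_mulVec_eq_zero {t : TVec n} : hBlock (pmat p *ᵥ t) = 0 ↔ hBlock t = 0 := by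
  rw [hBlock_eq_zero_iff, hBlock_eq_zero_iff]
  constructor
  · intro H s hs
    rw [← tractorMetric_mulVec (pmat_isometry p)]
    exact H _ ((inTop_pmat_mulVec p).2 hs)
  · intro H s hs
    rw [← pmat_mulVec_inv_mulVec p s, tractorMetric_mulVec (pmat_isometry p)]
    exact H _ ((inTop_pmat_mulVec p⁻¹).2 hs)

theorem conj_mem_soAlg {A A' y : TMat n} (hA : Aᵀ * Jmat n * A = Jmat n) (h : A * A' = 1)
    (hy : y ∈ soAlg n) : A' * y * A ∈ soAlg n := by
  have h' : A' * A = 1 := mul_eq_one_comm.1 h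
  have hT : A'ᵀ * Aᵀ = 1 := by rw [← Matrix.transpose_mul, h, Matrix.transpose_one]
  have hT' : Aᵀ * A'ᵀ = 1 := by rw [← Matrix.transpose_mul, h', Matrix.transpose_one]
  have h1 : A'ᵀ * Jmat n = Jmat n * A := by
    rw [← hA, ← Matrix.mul_assoc, ← Matrix.mul_assoc, hT, Matrix.one_mul, hA]
  have h2 : Jmat n * A' = Aᵀ * Jmat n := by
    conv_lhs => rw [← hA]
    rw [Matrix.mul_assoc, h, Matrix.mul_one]
  rw [mem_soAlg_iff] at hy ⊢
  rw [Matrix.transpose_mul, Matrix.transpose_mul]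
  calc Aᵀ * (yᵀ * A'ᵀ) * Jmat n + Jmat n * (A' * y * A)
      = Aᵀ * yᵀ * (A'ᵀ * Jmat n) + (Jmat n * A') * y * A := by noncomm_ring
    _ = Aᵀ * (yᵀ * Jmat n + Jmat n * y) * A := by rw [h1, h2]; noncomm_ring
    _ = 0 := by rw [hy]; simp

theorem pmat_conj_mem_soAlg {y : TMat n} (hy : y ∈ soAlg n) : pmat p⁻¹ * y * pmat p ∈ soAlg n :=
  conj_mem_soAlg (pmat_isometry p) (pmat_mul_inv p) hy

/-- The standard grading element is not $P$-invariant, but `inNilradical_sub_gradingElt_iff`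
describes its lifts through the filtration alone, and $P$ respects the filtration. -/
theorem isLift_pmat_conj {N : TMat n} (hN : InNilradical (N - gradingElt n)) :
    InNilradical (pmat p⁻¹ * N * pmat p - gradingElt n) := by
  rw [inNilradical_sub_gradingElt_iff] at hN ⊢
  obtain ⟨h1, h2, h3, h4⟩ := hN
  refine ⟨pmat_conj_mem_soAlg p h1, fun t ht => ?_, fun t ht => ?_, fun t => ?_⟩
  · rw [← Matrix.mulVec_mulVec, ← Matrix.mulVec_mulVec, h2 _ ((inTop_pmat_mulVec p).2 ht),
      pmat_inv_mulVec_mulVec]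
  · rw [← Matrix.mulVec_mulVec, ← Matrix.mulVec_mulVec, inTop_pmat_mulVec]
    exact h3 _ ((hBlock_pmat_mulVec_eq_zero p).2 ht)
  · have : (pmat p⁻¹ * N * pmat p) *ᵥ t + t = pmat p⁻¹ *ᵥ (N *ᵥ (pmat p *ᵥ t) + pmat p *ᵥ t) := by
      rw [Matrix.mulVec_add, pmat_inv_mulVec_mulVec, ← Matrix.mulVec_mulVec, ← Matrix.mulVec_mulVec]
    rw [this, hBlock_pmat_mulVec_eq_zero]
    exact h4 _

end Parabolic

/-- The spectral projection lands in the isotropic plane $H^*$, where the pairing with $H$ is twice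
the tractor metric. In this form both ingredients of the preferred condition are visibly natural
under isometries, which `starComp_conj_dotProduct` exploits. -/
theorem starComp_dotProduct {N : TMat n} (hN : InNilradical (N - gradingElt n)) (s t : TVec n) :
    starComp N s ⬝ᵥ hBlock t = 2 * tractorMetric (specProj N 1 *ᵥ s) t := by
  obtain ⟨b, c, -, rfl⟩ := exists_eq_weylLift hN
  have h : InTop (specProj (weylLift b c) 1 *ᵥ s) := by
    rw [← weylFrame_conj_gradingElt, specProj_conj (weylFrameInv_mul_weylFrame b c) (weylFrame_mul_weylFrameInv b c),
      specProj_gradingElt_one, weylFrame, ofBlocks_mul, weylFrameInv, ofBlocks_mul]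
    constructor
    · rw [midCoord_ofBlocks_mulVec]; simp
    · rw [hBlock_ofBlocks_mulVec]; simp
  rw [tractorMetric_of_inTop h, starComp]
  ring

theorem starComp_conj_dotProduct {N : TMat n} (hN : InNilradical (N - gradingElt n))
    (p : Parabolic n) (s t : TVec n) :
    starComp (pmat p⁻¹ * N * pmat p) s ⬝ᵥ hBlock t =
      starComp N (pmat p *ᵥ s) ⬝ᵥ hBlock (pmat p *ᵥ t) := by
  rw [starComp_dotProduct (isLift_pmat_conj p hN), starComp_dotProduct hN,
    specProj_conj (pmat_mul_inv p) (pmat_inv_mul p), ← tractorMetric_mulVec (pmat_isometry p),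
    Matrix.mulVec_mulVec, Matrix.mulVec_mulVec, ← Matrix.mul_assoc, ← Matrix.mul_assoc,
    pmat_mul_inv, Matrix.one_mul]

/-! ### Graphs over H and the preferred lift of a graph -/

section Graph

/-- The matrix whose image is the graph, over the `H`-block, of `X ↦ (L X, l · X)`. -/
def graphMat (L : Matrix (Fin n) (Fin n) ℝ) (l : Matrix (Fin n) Unit ℝ) :
    Matrix (TIdx n) (Fin n) ℝ :=
  Matrix.of fun x j => match x with
    | Sum.inl i => L i j
    | Sum.inr (Sum.inl u) => l j u
    | Sum.inr (Sum.inr i) => (1 : Matrix (Fin n) (Fin n) ℝ) i j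

variable (L : Matrix (Fin n) (Fin n) ℝ) (l : Matrix (Fin n) Unit ℝ)

theorem topBlock_graphMat_mulVec (X : Fin n → ℝ) : topBlock (graphMat L l *ᵥ X) = L *ᵥ X := rfl

theorem midCoord_graphMat_mulVec (X : Fin n → ℝ) :
    midCoord (graphMat L l *ᵥ X) = (lᵀ *ᵥ X) () := rfl

theorem hBlock_graphMat_mulVec (X : Fin n → ℝ) : hBlock (graphMat L l *ᵥ X) = X := by
  have : hBlock (graphMat L l *ᵥ X) = (1 : Matrix (Fin n) (Fin n) ℝ) *ᵥ X := rfl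
  rw [this, Matrix.one_mulVec]

/-- The matrix of the restriction of the tractor metric to a graph. -/
noncomputable def graphMetric : Matrix (Fin n) (Fin n) ℝ := (1 / 2 : ℝ) • (L + Lᵀ + l * lᵀ)

theorem graphMetric_transpose : (graphMetric L l)ᵀ = graphMetric L l := by
  rw [graphMetric, Matrix.transpose_smul, Matrix.transpose_add, Matrix.transpose_add,
    Matrix.transpose_mul, Matrix.transpose_transpose, Matrix.transpose_transpose, add_comm Lᵀ]

theorem col_mulVec_unit (v : Unit → ℝ) (Y : Fin n → ℝ) : (l *ᵥ v) ⬝ᵥ Y = v () * (lᵀ *ᵥ Y) () := by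
  simp only [Matrix.mulVec, dotProduct, Finset.univ_unique, Finset.sum_singleton,
    Matrix.transpose_apply, Finset.mul_sum]
  exact Finset.sum_congr rfl fun i _ => by rw [show (default : Unit) = () from rfl]; ring

theorem tractorMetric_graphMat (X Y : Fin n → ℝ) :
    tractorMetric (graphMat L l *ᵥ X) (graphMat L l *ᵥ Y) = (graphMetric L l *ᵥ X) ⬝ᵥ Y := by
  rw [tractorMetric, topBlock_graphMat_mulVec, topBlock_graphMat_mulVec, hBlock_graphMat_mulVec,
    hBlock_graphMat_mulVec, midCoord_graphMat_mulVec, midCoord_graphMat_mulVec, graphMetric,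
    Matrix.smul_mulVec, smul_dotProduct, Matrix.add_mulVec, Matrix.add_mulVec, add_dotProduct,
    add_dotProduct, ← Matrix.mulVec_mulVec, col_mulVec_unit, Matrix.mulVec_transpose L,
    ← Matrix.dotProduct_mulVec, dotProduct_comm (L *ᵥ Y), smul_eq_mul]
  ring

theorem starComp_weylLift_graphMat (X : Fin n → ℝ) :
    starComp (weylLift b c) (graphMat L l *ᵥ X) =
      (L + b * lᵀ + (1 / 2 : ℝ) • (c - b * bᵀ)) *ᵥ X := by
  rw [starComp_weylLift, weylFrameInv, topBlock_ofBlocks_mulVec, topBlock_graphMat_mulVec,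
    hBlock_graphMat_mulVec, midCoord_graphMat_mulVec, Matrix.one_mulVec, Matrix.add_mulVec,
    Matrix.add_mulVec, ← Matrix.mulVec_mulVec _ b]

theorem matrix_eq_of_dotProduct {A B : Matrix (Fin n) (Fin n) ℝ}
    (h : ∀ X Y, (A *ᵥ X) ⬝ᵥ Y = (B *ᵥ X) ⬝ᵥ Y) : A = B := by
  refine Matrix.ext_of_mulVec_single fun i => ?_
  ext j
  simpa using h (Pi.single i 1) (Pi.single j 1)

/-- This is the algebraic core of existence and uniqueness. As a skew $c$ has zero diagonal, the
diagonal entries contain only $b$ and $l$, and they complete to a square. Once $b = l$, the equation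
is linear in $c$, and its solution is skew. -/
theorem starComp_eq_tractorMetric_iff (hc : cᵀ = -c) :
    (∀ X Y, starComp (weylLift b c) (graphMat L l *ᵥ X) ⬝ᵥ Y =
      tractorMetric (graphMat L l *ᵥ X) (graphMat L l *ᵥ Y)) ↔ b = l ∧ c = Lᵀ - L := by
  constructor
  · intro H
    have h1 : L + b * lᵀ + (1 / 2 : ℝ) • (c - b * bᵀ) = graphMetric L l :=
      matrix_eq_of_dotProduct fun X Y => by
        rw [← starComp_weylLift_graphMat, H, tractorMetric_graphMat]
    have hE : ∀ i j, L i j + b i () * l j () + (1 / 2) * (c i j - b i () * b j ()) =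
        (1 / 2) * (L i j + L j i + l i () * l j ()) := by
      intro i j
      simpa [graphMetric, Matrix.mul_apply] using congrFun (congrFun h1 i) j
    have hC : ∀ i j, c j i = -c i j := fun i j => congrFun (congrFun hc i) j
    have hb : b = l := by
      ext i ⟨⟩
      have h2 := hE i i
      have h3 := hC i i
      have : (b i () - l i ()) ^ 2 = 0 := by linarith
      exact sub_eq_zero.1 (pow_eq_zero_iff (two_ne_zero)|>.1 this)
    subst hb
    refine ⟨rfl, ?_⟩
    ext i j
    have h2 := hE i j
    simp only [Matrix.sub_apply, Matrix.transpose_apply]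
    linarith
  · rintro ⟨rfl, rfl⟩ X Y
    rw [starComp_weylLift_graphMat, tractorMetric_graphMat, graphMetric]
    congr 2
    module

/-- A graph, in the splitting of its preferred lift. -/
theorem starComp_preferred (X : Fin n → ℝ) :
    starComp (weylLift l (Lᵀ - L)) (graphMat L l *ᵥ X) = graphMetric L l *ᵥ X := by
  rw [starComp_weylLift_graphMat, graphMetric]
  congr 1
  module

/-- The normal form on which all later computations rest: in the adapted frame the graph has lost
its middle part and the skew part of $L$, and only the symmetric matrix of the metric survives. -/
theorem graphMat_eq_weylFrame_mul :
    graphMat L l = weylFrame l (Lᵀ - L) * graphMat (graphMetric L l) 0 := by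
  ext (i | i | i) j <;>
    simp [weylFrame, graphMat, Matrix.mul_apply, Fintype.sum_sum_type, graphMetric, Matrix.one_apply]
  ring

end Graph

end WeylLifts

/-! ### Smoothness of matrix-valued functions, entry by entry -/

section EntrywiseSmoothness

/-- Smoothness on a set of a real-valued function. -/
abbrev RealSmoothOn {E H : Type*} [NormedAddCommGroup E] [NormedSpace ℝ E] [TopologicalSpace H]
    (I : ModelWithCorners ℝ E H) {N : Type*} [TopologicalSpace N] [ChartedSpace H N] (f : N → ℝ)
    (D : Set N) : Prop :=
  ContMDiffOn I 𝓘(ℝ, ℝ) ∞ f D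

/-- Smoothness of all entries. -/
def MatSmoothOn {E H : Type*} [NormedAddCommGroup E] [NormedSpace ℝ E] [TopologicalSpace H]
    (I : ModelWithCorners ℝ E H) {N : Type*} [TopologicalSpace N] [ChartedSpace H N] {α β : Type*}
    (f : N → Matrix α β ℝ) (D : Set N) : Prop :=
  ∀ i j, RealSmoothOn I (fun v => f v i j) D

variable {E H N : Type*} [NormedAddCommGroup E] [NormedSpace ℝ E] [TopologicalSpace H]
  {I : ModelWithCorners ℝ E H} [TopologicalSpace N] [ChartedSpace H N] {α β γ : Type*} {D : Set N}

theorem RealSmoothOn.const (c : ℝ) : RealSmoothOn I (fun _ : N => c) D := contMDiffOn_const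

theorem RealSmoothOn.add {f g : N → ℝ} (hf : RealSmoothOn I f D) (hg : RealSmoothOn I g D) :
    RealSmoothOn I (fun v => f v + g v) D := ContMDiffOn.add hf hg

theorem RealSmoothOn.mul {f g : N → ℝ} (hf : RealSmoothOn I f D) (hg : RealSmoothOn I g D) :
    RealSmoothOn I (fun v => f v * g v) D := ContMDiffOn.mul hf hg

theorem RealSmoothOn.const_mul {f : N → ℝ} (c : ℝ) (hf : RealSmoothOn I f D) :
    RealSmoothOn I (fun v => c * f v) D := RealSmoothOn.mul (RealSmoothOn.const c) hf

theorem RealSmoothOn.sum {ι : Type*} {s : Finset ι} {f : ι → N → ℝ}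
    (hf : ∀ i ∈ s, RealSmoothOn I (f i) D) : RealSmoothOn I (fun v => ∑ i ∈ s, f i v) D :=
  contMDiffOn_finsetSum hf

theorem RealSmoothOn.prod {ι : Type*} {s : Finset ι} {f : ι → N → ℝ}
    (hf : ∀ i ∈ s, RealSmoothOn I (f i) D) : RealSmoothOn I (fun v => ∏ i ∈ s, f i v) D :=
  contMDiffOn_finsetProd hf

theorem RealSmoothOn.inv {f : N → ℝ} (hf : RealSmoothOn I f D) (h0 : ∀ v ∈ D, f v ≠ 0) :
    RealSmoothOn I (fun v => (f v)⁻¹) D := by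
  intro v hv
  have h : ContMDiffAt 𝓘(ℝ, ℝ) 𝓘(ℝ, ℝ) ∞ (fun x : ℝ => x⁻¹) (f v) :=
    (contDiffAt_inv ℝ (h0 v hv)).contMDiffAt
  exact h.comp_contMDiffWithinAt v (hf v hv)

theorem MatSmoothOn.const (c : Matrix α β ℝ) : MatSmoothOn I (fun _ : N => c) D :=
  fun _ _ => contMDiffOn_const

theorem MatSmoothOn.add {f g : N → Matrix α β ℝ} (hf : MatSmoothOn I f D) (hg : MatSmoothOn I g D) :
    MatSmoothOn I (fun v => f v + g v) D := fun i j => RealSmoothOn.add (hf i j) (hg i j)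

theorem MatSmoothOn.smul {f : N → Matrix α β ℝ} (c : ℝ) (hf : MatSmoothOn I f D) :
    MatSmoothOn I (fun v => c • f v) D := fun i j => RealSmoothOn.const_mul c (hf i j)

theorem MatSmoothOn.neg {f : N → Matrix α β ℝ} (hf : MatSmoothOn I f D) :
    MatSmoothOn I (fun v => -f v) D := fun i j => ContMDiffOn.neg (hf i j)

theorem MatSmoothOn.sub {f g : N → Matrix α β ℝ} (hf : MatSmoothOn I f D) (hg : MatSmoothOn I g D) :
    MatSmoothOn I (fun v => f v - g v) D := fun i j => ContMDiffOn.sub (hf i j) (hg i j)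

theorem MatSmoothOn.transpose {f : N → Matrix α β ℝ} (hf : MatSmoothOn I f D) :
    MatSmoothOn I (fun v => (f v)ᵀ) D := fun i j => hf j i

theorem MatSmoothOn.mul [Fintype β] {f : N → Matrix α β ℝ} {g : N → Matrix β γ ℝ}
    (hf : MatSmoothOn I f D) (hg : MatSmoothOn I g D) : MatSmoothOn I (fun v => f v * g v) D := by
  intro i j
  simp only [Matrix.mul_apply]
  exact RealSmoothOn.sum fun k _ => RealSmoothOn.mul (hf i k) (hg k j)

theorem MatSmoothOn.mulVec [Fintype β] {f : N → Matrix α β ℝ} {s : N → β → ℝ}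
    (hf : MatSmoothOn I f D) (hs : ∀ j, RealSmoothOn I (fun v => s v j) D) (i : α) :
    RealSmoothOn I (fun v => (f v *ᵥ s v) i) D := by
  simp only [Matrix.mulVec, dotProduct]
  exact RealSmoothOn.sum fun k _ => RealSmoothOn.mul (hf i k) (hs k)

theorem MatSmoothOn.mono {f : N → Matrix α β ℝ} {D' : Set N} (hf : MatSmoothOn I f D)
    (h : D' ⊆ D) : MatSmoothOn I f D' := fun i j => (hf i j).mono h

theorem MatSmoothOn.congr {f g : N → Matrix α β ℝ} (hf : MatSmoothOn I f D)
    (h : ∀ v ∈ D, g v = f v) : MatSmoothOn I g D :=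
  fun i j => (hf i j).congr fun v hv => by rw [h v hv]

theorem MatSmoothOn.det [Fintype α] [DecidableEq α] {f : N → Matrix α α ℝ}
    (hf : MatSmoothOn I f D) : RealSmoothOn I (fun v => (f v).det) D := by
  simp only [Matrix.det_apply']
  exact RealSmoothOn.sum fun σ _ => RealSmoothOn.const_mul _ (RealSmoothOn.prod fun i _ => hf _ _)

theorem MatSmoothOn.inv [Fintype α] [DecidableEq α] {f : N → Matrix α α ℝ}
    (hf : MatSmoothOn I f D) (h0 : ∀ v ∈ D, (f v).det ≠ 0) : MatSmoothOn I (fun v => (f v)⁻¹) D := by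
  intro i j
  simp only [Matrix.inv_def, Matrix.smul_apply, smul_eq_mul, Ring.inverse_eq_inv',
    Matrix.adjugate_apply]
  -- Cramer's rule: an entry of the adjugate is the determinant of the matrix with one row replaced
  -- by a constant unit vector.
  refine RealSmoothOn.mul (RealSmoothOn.inv hf.det h0) (MatSmoothOn.det fun k l => ?_)
  by_cases hk : k = j
  · subst hk
    simp only [Matrix.updateRow_self]
    exact RealSmoothOn.const _
  · simp only [Matrix.updateRow_ne hk]
    exact hf k l

theorem MatSmoothOn.ofBlocks {n : ℕ} {a c g k : N → Matrix (Fin n) (Fin n) ℝ}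
    {b h : N → Matrix (Fin n) Unit ℝ} {d f : N → Matrix Unit (Fin n) ℝ}
    {e : N → Matrix Unit Unit ℝ} (ha : MatSmoothOn I a D) (hb : MatSmoothOn I b D)
    (hc : MatSmoothOn I c D) (hd : MatSmoothOn I d D) (he : MatSmoothOn I e D)
    (hf : MatSmoothOn I f D) (hg : MatSmoothOn I g D) (hh : MatSmoothOn I h D)
    (hk : MatSmoothOn I k D) :
    MatSmoothOn I (fun v => ofBlocks (a v) (b v) (c v) (d v) (e v) (f v) (g v) (h v) (k v)) D := by
  rintro (i | i | i) (j | j | j)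
  exacts [ha i j, hb i j, hc i j, hd i j, he i j, hf i j, hg i j, hh i j, hk i j]

end EntrywiseSmoothness

/-! ### Derivatives of matrix-valued functions along tangent vectors -/

section EntrywiseCalculus

variable {E N : Type*} [NormedAddCommGroup E] [NormedSpace ℝ E] [TopologicalSpace N]
  [ChartedSpace E N] {α β γ : Type*}

/-- The derivative of a real-valued function along a tangent vector. -/
noncomputable def realDeriv (f : N → ℝ) (u : N) (ξ : TangentSpace 𝓘(ℝ, E) u) : ℝ :=
  (mfderiv 𝓘(ℝ, E) 𝓘(ℝ, ℝ) f u ξ : ℝ)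

/-- Differentiability at a point of a real-valued function. -/
abbrev RealDiffAt (E : Type*) [NormedAddCommGroup E] [NormedSpace ℝ E] {N : Type*}
    [TopologicalSpace N] [ChartedSpace E N] (f : N → ℝ) (u : N) : Prop :=
  MDifferentiableAt 𝓘(ℝ, E) 𝓘(ℝ, ℝ) f u

variable {u : N} (ξ : TangentSpace 𝓘(ℝ, E) u)

theorem realDeriv_add {f g : N → ℝ} (hf : RealDiffAt E f u) (hg : RealDiffAt E g u) :
    realDeriv (fun v => f v + g v) u ξ = realDeriv f u ξ + realDeriv g u ξ := by
  have h := (hf.hasMFDerivAt.add hg.hasMFDerivAt).mfderiv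
  unfold realDeriv
  exact congrArg (fun (L : E →L[ℝ] ℝ) => L ξ) h

theorem realDeriv_mul {f g : N → ℝ} (hf : RealDiffAt E f u) (hg : RealDiffAt E g u) :
    realDeriv (fun v => f v * g v) u ξ = realDeriv f u ξ * g u + f u * realDeriv g u ξ := by
  have h := (hf.hasMFDerivAt.mul hg.hasMFDerivAt).mfderiv
  have e : f u * realDeriv g u ξ + g u * realDeriv f u ξ =
      realDeriv f u ξ * g u + f u * realDeriv g u ξ := by ring
  exact (congrArg (fun (L : E →L[ℝ] ℝ) => L ξ) h).trans e

theorem realDeriv_const (c : ℝ) : realDeriv (fun _ : N => c) u ξ = 0 := by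
  unfold realDeriv
  rw [mfderiv_const]
  rfl

theorem realDeriv_congr {f g : N → ℝ} (h : f =ᶠ[nhds u] g) : realDeriv f u ξ = realDeriv g u ξ := by
  unfold realDeriv
  exact congrArg (fun (L : E →L[ℝ] ℝ) => L ξ) h.mfderiv_eq

theorem RealDiffAt.mul {f g : N → ℝ} (hf : RealDiffAt E f u) (hg : RealDiffAt E g u) :
    RealDiffAt E (fun v => f v * g v) u := MDifferentiableAt.mul hf hg

theorem RealDiffAt.add {f g : N → ℝ} (hf : RealDiffAt E f u) (hg : RealDiffAt E g u) :
    RealDiffAt E (fun v => f v + g v) u := MDifferentiableAt.add hf hg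

theorem RealDiffAt.sum {ι : Type*} (s : Finset ι) {f : ι → N → ℝ}
    (hf : ∀ i ∈ s, RealDiffAt E (f i) u) : RealDiffAt E (fun v => ∑ i ∈ s, f i v) u := by
  classical
  induction s using Finset.induction_on with
  | empty => simpa using mdifferentiableAt_const
  | insert i s hi ih =>
    simp only [Finset.sum_insert hi]
    exact RealDiffAt.add (hf i (by simp)) (ih fun j hj => hf j (by simp [hj]))

theorem realDeriv_sum {ι : Type*} (s : Finset ι) {f : ι → N → ℝ}
    (hf : ∀ i ∈ s, RealDiffAt E (f i) u) :
    realDeriv (fun v => ∑ i ∈ s, f i v) u ξ = ∑ i ∈ s, realDeriv (f i) u ξ := by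
  classical
  induction s using Finset.induction_on with
  | empty => simpa using realDeriv_const ξ 0
  | insert i s hi ih =>
    simp only [Finset.sum_insert hi]
    rw [realDeriv_add ξ (hf i (by simp)) (RealDiffAt.sum s fun j hj => hf j (by simp [hj])),
      ih fun j hj => hf j (by simp [hj])]

/-- The derivative of a vector-valued function along a tangent vector, entry by entry. -/
noncomputable def vecDeriv (s : N → α → ℝ) (u : N) (ξ : TangentSpace 𝓘(ℝ, E) u) : α → ℝ :=
  fun i => realDeriv (fun v => s v i) u ξ

/-- The derivative of a matrix-valued function along a tangent vector, entry by entry. -/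
noncomputable def matDeriv (f : N → Matrix α β ℝ) (u : N) (ξ : TangentSpace 𝓘(ℝ, E) u) :
    Matrix α β ℝ :=
  Matrix.of fun i j => realDeriv (fun v => f v i j) u ξ

/-- Differentiability of all entries. -/
def MatDiffAt (E : Type*) [NormedAddCommGroup E] [NormedSpace ℝ E] {N : Type*}
    [TopologicalSpace N] [ChartedSpace E N] {α β : Type*} (f : N → Matrix α β ℝ) (u : N) : Prop :=
  ∀ i j, RealDiffAt E (fun v => f v i j) u

theorem RealSmoothOn.diffAt {f : N → ℝ} {D : Set N} (hf : RealSmoothOn 𝓘(ℝ, E) f D) (hD : IsOpen D)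
    (hu : u ∈ D) : RealDiffAt E f u :=
  (hf.contMDiffAt (hD.mem_nhds hu)).mdifferentiableAt (by simp)

theorem MatSmoothOn.diffAt {f : N → Matrix α β ℝ} {D : Set N} (hf : MatSmoothOn 𝓘(ℝ, E) f D)
    (hD : IsOpen D) (hu : u ∈ D) : MatDiffAt E f u := fun i j => (hf i j).diffAt hD hu

theorem matDeriv_const (c : Matrix α β ℝ) : matDeriv (fun _ : N => c) u ξ = 0 := by
  ext i j
  exact realDeriv_const ξ _

theorem MatDiffAt.const (c : Matrix α β ℝ) : MatDiffAt E (fun _ : N => c) u :=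
  fun _ _ => mdifferentiableAt_const

theorem matDeriv_congr {f g : N → Matrix α β ℝ} (h : f =ᶠ[nhds u] g) :
    matDeriv f u ξ = matDeriv g u ξ := by
  ext i j
  exact realDeriv_congr ξ (h.mono fun v hv => by simp [hv])

theorem vecDeriv_congr {f g : N → α → ℝ} (h : f =ᶠ[nhds u] g) :
    vecDeriv f u ξ = vecDeriv g u ξ := by
  ext i
  exact realDeriv_congr ξ (h.mono fun v hv => by simp [hv])

theorem MatDiffAt.mul [Fintype β] {f : N → Matrix α β ℝ} {g : N → Matrix β γ ℝ}
    (hf : MatDiffAt E f u) (hg : MatDiffAt E g u) : MatDiffAt E (fun v => f v * g v) u := by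
  intro i j
  simp only [Matrix.mul_apply]
  exact RealDiffAt.sum _ fun k _ => RealDiffAt.mul (hf i k) (hg k j)

theorem matDeriv_mul [Fintype β] {f : N → Matrix α β ℝ} {g : N → Matrix β γ ℝ}
    (hf : MatDiffAt E f u) (hg : MatDiffAt E g u) :
    matDeriv (fun v => f v * g v) u ξ = matDeriv f u ξ * g u + f u * matDeriv g u ξ := by
  ext i j
  simp only [matDeriv, Matrix.of_apply, Matrix.mul_apply, Matrix.add_apply]
  rw [realDeriv_sum ξ _ fun k _ => RealDiffAt.mul (hf i k) (hg k j), ← Finset.sum_add_distrib]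
  exact Finset.sum_congr rfl fun k _ => realDeriv_mul ξ (hf i k) (hg k j)

theorem vecDeriv_mulVec [Fintype β] {f : N → Matrix α β ℝ} {s : N → β → ℝ}
    (hf : MatDiffAt E f u) (hs : ∀ j, RealDiffAt E (fun v => s v j) u) :
    vecDeriv (fun v => f v *ᵥ s v) u ξ = matDeriv f u ξ *ᵥ s u + f u *ᵥ vecDeriv s u ξ := by
  ext i
  simp only [vecDeriv, matDeriv, Matrix.mulVec, dotProduct, Pi.add_apply, Matrix.of_apply]
  rw [realDeriv_sum ξ _ fun k _ => RealDiffAt.mul (hf i k) (hs k), ← Finset.sum_add_distrib]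
  exact Finset.sum_congr rfl fun k _ => realDeriv_mul ξ (hf i k) (hs k)

theorem matDeriv_transpose (f : N → Matrix α β ℝ) :
    matDeriv (fun v => (f v)ᵀ) u ξ = (matDeriv f u ξ)ᵀ := rfl

theorem matDeriv_neg {f : N → Matrix α β ℝ} (hf : MatDiffAt E f u) :
    matDeriv (fun v => -f v) u ξ = -matDeriv f u ξ := by
  ext i j
  have h1 := realDeriv_mul ξ (mdifferentiableAt_const (c := (-1 : ℝ))) (hf i j)
  rw [realDeriv_const, zero_mul, zero_add, neg_one_mul] at h1
  simp only [neg_one_mul] at h1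
  exact h1

theorem RealDiffAt.trace [Fintype α] {f : N → Matrix α α ℝ} (hf : MatDiffAt E f u) :
    RealDiffAt E (fun v => (f v).trace) u :=
  RealDiffAt.sum _ fun i _ => hf i i

theorem realDeriv_trace [Fintype α] {f : N → Matrix α α ℝ} (hf : MatDiffAt E f u) :
    realDeriv (fun v => (f v).trace) u ξ = (matDeriv f u ξ).trace :=
  realDeriv_sum ξ _ fun i _ => hf i i

theorem MatDiffAt.transpose {f : N → Matrix α β ℝ} (hf : MatDiffAt E f u) :
    MatDiffAt E (fun v => (f v)ᵀ) u := fun i j => hf j i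

theorem matDeriv_ofBlocks {n : ℕ} (a c g k : N → Matrix (Fin n) (Fin n) ℝ)
    (b h : N → Matrix (Fin n) Unit ℝ) (d f : N → Matrix Unit (Fin n) ℝ)
    (e : N → Matrix Unit Unit ℝ) :
    matDeriv (fun v => ofBlocks (a v) (b v) (c v) (d v) (e v) (f v) (g v) (h v) (k v)) u ξ =
      ofBlocks (matDeriv a u ξ) (matDeriv b u ξ) (matDeriv c u ξ) (matDeriv d u ξ)
        (matDeriv e u ξ) (matDeriv f u ξ) (matDeriv g u ξ) (matDeriv h u ξ) (matDeriv k u ξ) := by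
  ext (i | i | i) (j | j | j) <;> rfl

/-- The $H$-part of a graph is the constant identity matrix. -/
theorem matDeriv_graphMat {n : ℕ} (L : N → Matrix (Fin n) (Fin n) ℝ)
    (l : N → Matrix (Fin n) Unit ℝ) (X : Fin n → ℝ) :
    hBlock (matDeriv (fun v => graphMat (L v) (l v)) u ξ *ᵥ X) = 0 := by
  ext i
  have : ∀ j, matDeriv (fun v => graphMat (L v) (l v)) u ξ (Sum.inr (Sum.inr i)) j = 0 :=
    fun j => realDeriv_const ξ _
  simp [hBlock, Matrix.mulVec, dotProduct, this]

end EntrywiseCalculus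

/-! ### The subbundle V as a smooth graph, and its preferred Weyl structure -/

section Subbundle

variable {n : ℕ} {EM EP M Q : Type*}
  [NormedAddCommGroup EM] [NormedSpace ℝ EM] [NormedAddCommGroup EP] [NormedSpace ℝ EP]
  [TopologicalSpace M] [ChartedSpace EM M] [IsManifold 𝓘(ℝ, EM) ∞ M]
  [TopologicalSpace Q] [ChartedSpace EP Q] [IsManifold 𝓘(ℝ, EP) ∞ Q]

namespace CartanGeometry

variable (G : CartanGeometry n EM EP M Q)

theorem proj_act (u : Q) (p : Parabolic n) : G.proj (G.act u p) = G.proj u :=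
  ((G.proj_eq_iff u (G.act u p)).2 ⟨p, rfl⟩).symm

theorem act_left_injective {u : Q} {p q : Parabolic n} (h : G.act u p = G.act u q) : p = q := by
  have h1 : G.act u (p * q⁻¹) = u := by
    rw [G.act_mul, h, ← G.act_mul, mul_inv_cancel, G.act_one]
  exact mul_inv_eq_one.1 (G.act_free u _ h1)

theorem isOpen_preimage_proj {W : Set M} (hW : IsOpen W) : IsOpen (G.proj ⁻¹' W) :=
  hW.preimage G.contMDiff_proj.continuous

namespace TractorSubbundle

variable {G} (V : G.TractorSubbundle n)

/-- One frame of the fibre suffices, because $P$ preserves the kernel of the projection to $H$. -/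
theorem proj_mem_injLocus_iff {u : Q} :
    G.proj u ∈ V.injLocus ↔ ∀ t ∈ V.fiber u, hBlock t = 0 → t = 0 := by
  refine ⟨fun H => H u rfl, fun H v hv t ht h0 => ?_⟩
  obtain ⟨p, rfl⟩ := (G.proj_eq_iff u v).1 hv.symm
  have h1 := H _ ((V.equivariant u p t).1 ht) ((hBlock_pmat_mulVec_eq_zero p).2 h0)
  rw [← pmat_inv_mulVec_mulVec p t, h1, Matrix.mulVec_zero]

theorem act_mem_preimage_injLocus {u : Q} (hu : u ∈ G.proj ⁻¹' V.injLocus) (p : Parabolic n) :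
    G.act u p ∈ G.proj ⁻¹' V.injLocus := by
  rw [Set.mem_preimage, G.proj_act]
  exact hu

/-- The projection to the `H`-block, as a linear map. -/
def hBlockLin (n : ℕ) : TVec n →ₗ[ℝ] (Fin n → ℝ) where
  toFun := hBlock
  map_add' _ _ := rfl
  map_smul' _ _ := rfl

theorem injOn_hBlock {u : Q} (hu : u ∈ G.proj ⁻¹' V.injLocus) :
    Set.InjOn hBlock (V.fiber u : Set (TVec n)) := by
  intro s hs t ht hst
  refine sub_eq_zero.1 (V.proj_mem_injLocus_iff.1 hu (s - t) (sub_mem hs ht) ?_)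
  exact ((hBlockLin n).map_sub s t).trans (sub_eq_zero.2 hst)

/-- $V$ and $H$ both have rank $n$, so injectivity is bijectivity. -/
theorem exists_mem_fiber {u : Q} (hu : u ∈ G.proj ⁻¹' V.injLocus) (X : Fin n → ℝ) :
    ∃ t ∈ V.fiber u, hBlock t = X := by
  have hinj : Function.Injective ((hBlockLin n).comp (V.fiber u).subtype) := by
    intro s t hst
    exact Subtype.ext (V.injOn_hBlock hu s.2 t.2 hst)
  have hsurj := (LinearMap.injective_iff_surjective_of_finrank_eq_finrank
    (by rw [V.finrank_fiber u]; simp)).1 hinj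
  obtain ⟨t, ht⟩ := hsurj X
  exact ⟨t, t.2, ht⟩

/-- The lift of `X` to the fibre, where the projection to `H` is bijective. -/
noncomputable def lift (u : Q) (X : Fin n → ℝ) : TVec n :=
  Function.invFunOn hBlock (V.fiber u : Set (TVec n)) X

theorem lift_mem {u : Q} (hu : u ∈ G.proj ⁻¹' V.injLocus) (X : Fin n → ℝ) :
    V.lift u X ∈ V.fiber u :=
  Function.invFunOn_mem (V.exists_mem_fiber hu X)

theorem hBlock_lift {u : Q} (hu : u ∈ G.proj ⁻¹' V.injLocus) (X : Fin n → ℝ) :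
    hBlock (V.lift u X) = X :=
  Function.invFunOn_eq (V.exists_mem_fiber hu X)

/-- The `H^*`-part of the lift, as a matrix. -/
noncomputable def topMat (u : Q) : Matrix (Fin n) (Fin n) ℝ :=
  Matrix.of fun i j => V.lift u (Pi.single j 1) (Sum.inl i)

/-- The middle part of the lift, as a column. -/
noncomputable def midCol (u : Q) : Matrix (Fin n) Unit ℝ :=
  Matrix.of fun j _ => V.lift u (Pi.single j 1) (midIdx n)

/-- The lift, as a matrix. -/
noncomputable def liftMat (u : Q) : Matrix (TIdx n) (Fin n) ℝ := graphMat (V.topMat u) (V.midCol u)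

/-- `lift` comes from a choice of preimages and is not linear by definition. The combination of the
lifted basis vectors lies in $V$ and has the same $H$-part as the chosen lift, so injectivity
identifies the two. -/
theorem liftMat_mulVec {u : Q} (hu : u ∈ G.proj ⁻¹' V.injLocus) (X : Fin n → ℝ) :
    V.liftMat u *ᵥ X = V.lift u X := by
  have hcol : ∀ j, V.liftMat u *ᵥ Pi.single j 1 = V.lift u (Pi.single j 1) := by
    intro j
    rw [Matrix.mulVec_single_one]
    ext (i | i | i)
    · rfl
    · rfl
    · have := congrFun (V.hBlock_lift hu (Pi.single j 1)) i
      refine Eq.trans ?_ this.symm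
      simp [liftMat, graphMat, Matrix.one_apply, Pi.single_apply]
  have hmem : V.liftMat u *ᵥ X ∈ V.fiber u := by
    rw [Matrix.mulVec_eq_sum]
    refine Submodule.sum_mem _ fun j _ => ?_
    have h1 := V.lift_mem hu (Pi.single j 1)
    rw [← hcol j, Matrix.mulVec_single_one] at h1
    have h2 := (V.fiber u).smul_mem (X j) h1
    convert h2 using 1
    ext a
    simp [Matrix.col, mul_comm]
  exact V.injOn_hBlock hu hmem (V.lift_mem hu X)
    ((hBlock_graphMat_mulVec _ _ X).trans (V.hBlock_lift hu X).symm)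

theorem liftMat_mulVec_mem {u : Q} (hu : u ∈ G.proj ⁻¹' V.injLocus) (X : Fin n → ℝ) :
    V.liftMat u *ᵥ X ∈ V.fiber u := by
  rw [V.liftMat_mulVec hu]
  exact V.lift_mem hu X

theorem hBlock_liftMat_mulVec (u : Q) (X : Fin n → ℝ) : hBlock (V.liftMat u *ᵥ X) = X :=
  hBlock_graphMat_mulVec _ _ X

theorem eq_liftMat_mulVec {u : Q} (hu : u ∈ G.proj ⁻¹' V.injLocus) {t : TVec n}
    (ht : t ∈ V.fiber u) : t = V.liftMat u *ᵥ hBlock t :=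
  V.injOn_hBlock hu ht (V.liftMat_mulVec_mem hu _) (V.hBlock_liftMat_mulVec u _).symm

/-- The definition of a subbundle provides only spanning sections; being $n$ in number and spanning
a space of dimension $n$, they are independent. -/
theorem exists_frame (u : Q) : ∃ O : Set Q, IsOpen O ∧ u ∈ O ∧
    ∃ S : Q → Matrix (TIdx n) (Fin n) ℝ, MatSmoothOn 𝓘(ℝ, EP) S O ∧
      (∀ v ∈ O, ∀ t, t ∈ V.fiber v ↔ ∃ x, S v *ᵥ x = t) ∧
      ∀ v ∈ O, ∀ x, S v *ᵥ x = 0 → x = 0 := by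
  obtain ⟨O, hO, hu, s, hs, hspan⟩ := V.smooth u
  have hmul : ∀ v x, (Matrix.of fun a j => s j v a) *ᵥ x = Fintype.linearCombination ℝ (fun i => s i v) x := by
    intro v x
    ext a
    simp [Matrix.mulVec, dotProduct, Fintype.linearCombination_apply, mul_comm]
  refine ⟨O, hO, hu, fun v => Matrix.of fun a j => s j v a, fun a j => hs j a, fun v hv t => ?_,
    fun v hv x hx => ?_⟩
  · rw [hspan v hv, ← Fintype.range_linearCombination ℝ, LinearMap.mem_range]
    simp only [hmul]
  · have hli : LinearIndependent ℝ fun i => s i v := by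
      rw [linearIndependent_iff_card_eq_finrank_span, Set.finrank, ← hspan v hv, V.finrank_fiber,
        Fintype.card_fin]
    rw [hmul] at hx
    exact hli.fintypeLinearCombination_injective (hx.trans (map_zero _).symm)

/-- The lower square block of a matrix. -/
def lowerBlock (S : Matrix (TIdx n) (Fin n) ℝ) : Matrix (Fin n) (Fin n) ℝ :=
  S.submatrix (fun i => Sum.inr (Sum.inr i)) id

theorem hBlock_mulVec (S : Matrix (TIdx n) (Fin n) ℝ) (x : Fin n → ℝ) :
    hBlock (S *ᵥ x) = lowerBlock S *ᵥ x := rfl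

theorem proj_mem_injLocus_iff_det {u : Q} {S : Matrix (TIdx n) (Fin n) ℝ}
    (hS : ∀ t, t ∈ V.fiber u ↔ ∃ x, S *ᵥ x = t) (hS' : ∀ x, S *ᵥ x = 0 → x = 0) :
    G.proj u ∈ V.injLocus ↔ (lowerBlock S).det ≠ 0 := by
  rw [V.proj_mem_injLocus_iff, Ne, ← Matrix.exists_mulVec_eq_zero_iff]
  constructor
  · rintro H ⟨x, hx0, hx⟩
    exact hx0 (hS' x (H _ ((hS _).2 ⟨x, rfl⟩) hx))
  · intro H t ht h0
    obtain ⟨x, rfl⟩ := (hS t).1 ht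
    by_contra hne
    exact H ⟨x, fun hx => hne (by rw [hx, Matrix.mulVec_zero]), h0⟩

theorem liftMat_eq {u : Q} {S : Matrix (TIdx n) (Fin n) ℝ}
    (hS : ∀ t, t ∈ V.fiber u ↔ ∃ x, S *ᵥ x = t) (hu : u ∈ G.proj ⁻¹' V.injLocus)
    (hd : (lowerBlock S).det ≠ 0) : V.liftMat u = S * (lowerBlock S)⁻¹ := by
  refine Matrix.ext_of_mulVec_single fun j => ?_
  have h1 : S *ᵥ ((lowerBlock S)⁻¹ *ᵥ Pi.single j 1) ∈ V.fiber u := (hS _).2 ⟨_, rfl⟩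
  rw [← Matrix.mulVec_mulVec]
  refine V.injOn_hBlock hu (V.liftMat_mulVec_mem hu _) h1 ?_
  rw [V.hBlock_liftMat_mulVec, hBlock_mulVec, Matrix.mulVec_mulVec,
    Matrix.mul_nonsing_inv _ (isUnit_iff_ne_zero.2 hd), Matrix.one_mulVec]

/-- In a local frame $S$ of $V$ the locus is where the determinant of the $H$-block of $S$ is
non-zero, and there the lift is $S$ times the inverse of this block. Openness and smoothness both
follow. -/
theorem exists_nhds_liftMat {u : Q} (hu : u ∈ G.proj ⁻¹' V.injLocus) :
    ∃ O : Set Q, IsOpen O ∧ u ∈ O ∧ O ⊆ G.proj ⁻¹' V.injLocus ∧ MatSmoothOn 𝓘(ℝ, EP) V.liftMat O := by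
  obtain ⟨O, hO, huO, S, hSm, hS, hS'⟩ := V.exists_frame u
  have hdet : RealSmoothOn 𝓘(ℝ, EP) (fun v => (lowerBlock (S v)).det) O :=
    MatSmoothOn.det fun i j => hSm _ _
  have hO' : IsOpen (O ∩ (fun v => (lowerBlock (S v)).det) ⁻¹' {0}ᶜ) :=
    hdet.continuousOn.isOpen_inter_preimage hO isOpen_compl_singleton
  have hsub : O ∩ (fun v => (lowerBlock (S v)).det) ⁻¹' {0}ᶜ ⊆ G.proj ⁻¹' V.injLocus :=
    fun v hv => (V.proj_mem_injLocus_iff_det (hS v hv.1) (hS' v hv.1)).2 hv.2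
  refine ⟨_, hO', ⟨huO, (V.proj_mem_injLocus_iff_det (hS u huO) (hS' u huO)).1 hu⟩, hsub, ?_⟩
  have h1 : MatSmoothOn 𝓘(ℝ, EP) (fun v => S v * (lowerBlock (S v))⁻¹)
      (O ∩ (fun v => (lowerBlock (S v)).det) ⁻¹' {0}ᶜ) := by
    refine (hSm.mono Set.inter_subset_left).mul (MatSmoothOn.inv (fun i j => ?_) fun v hv => hv.2)
    exact (hSm _ _).mono Set.inter_subset_left
  exact h1.congr fun v hv => V.liftMat_eq (hS v hv.1) (hsub hv) hv.2

theorem isOpen_preimage_injLocus : IsOpen (G.proj ⁻¹' V.injLocus) := by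
  rw [isOpen_iff_forall_mem_open]
  intro u hu
  obtain ⟨O, hO, huO, hsub, -⟩ := V.exists_nhds_liftMat hu
  exact ⟨O, hsub, hO, huO⟩

theorem isOpen_injLocus : IsOpen V.injLocus := by
  rw [isOpen_iff_forall_mem_open]
  intro x hx
  -- Openness is known on the total space and is pulled back along a continuous local section.
  obtain ⟨W, hW, hxW, σ, -, hσ, -, hσp, -⟩ := G.local_triv x
  refine ⟨W ∩ σ ⁻¹' (G.proj ⁻¹' V.injLocus), fun y hy => ?_,
    hσ.continuousOn.isOpen_inter_preimage hW V.isOpen_preimage_injLocus, hxW, ?_⟩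
  · have := hy.2
    rwa [Set.mem_preimage, Set.mem_preimage, hσp y hy.1] at this
  · rwa [Set.mem_preimage, Set.mem_preimage, hσp x hxW]

theorem smoothOn_liftMat : MatSmoothOn 𝓘(ℝ, EP) V.liftMat (G.proj ⁻¹' V.injLocus) := by
  intro i j u hu
  obtain ⟨O, hO, huO, -, hs⟩ := V.exists_nhds_liftMat hu
  exact ((hs i j).contMDiffAt (hO.mem_nhds huO)).contMDiffWithinAt

theorem smoothOn_topMat : MatSmoothOn 𝓘(ℝ, EP) V.topMat (G.proj ⁻¹' V.injLocus) :=
  fun i j => V.smoothOn_liftMat (Sum.inl i) j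

theorem smoothOn_midCol : MatSmoothOn 𝓘(ℝ, EP) V.midCol (G.proj ⁻¹' V.injLocus) :=
  fun j _ => V.smoothOn_liftMat (midIdx n) j

/-- The skew part of the preferred Weyl structure. -/
noncomputable def skewMat (u : Q) : Matrix (Fin n) (Fin n) ℝ := (V.topMat u)ᵀ - V.topMat u

theorem skewMat_transpose (u : Q) : (V.skewMat u)ᵀ = -V.skewMat u := by
  rw [skewMat, Matrix.transpose_sub, Matrix.transpose_transpose, neg_sub]

theorem smoothOn_skewMat : MatSmoothOn 𝓘(ℝ, EP) V.skewMat (G.proj ⁻¹' V.injLocus) :=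
  V.smoothOn_topMat.transpose.sub V.smoothOn_topMat

/-- The preferred Weyl structure. -/
noncomputable def preferredLift (u : Q) : TMat n := weylLift (V.midCol u) (V.skewMat u)

/-- The matrix of `μ`. -/
noncomputable def metricMat (u : Q) : Matrix (Fin n) (Fin n) ℝ :=
  graphMetric (V.topMat u) (V.midCol u)

theorem metricMat_transpose (u : Q) : (V.metricMat u)ᵀ = V.metricMat u := graphMetric_transpose _ _

theorem smoothOn_metricMat : MatSmoothOn 𝓘(ℝ, EP) V.metricMat (G.proj ⁻¹' V.injLocus) :=
  ((V.smoothOn_topMat.add V.smoothOn_topMat.transpose).add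
    (V.smoothOn_midCol.mul V.smoothOn_midCol.transpose)).smul _

theorem starComp_liftMat (u : Q) (X : Fin n → ℝ) :
    starComp (V.preferredLift u) (V.liftMat u *ᵥ X) = V.metricMat u *ᵥ X :=
  starComp_preferred _ _ X

theorem tractorMetric_liftMat (u : Q) (X Y : Fin n → ℝ) :
    tractorMetric (V.liftMat u *ᵥ X) (V.liftMat u *ᵥ Y) = (V.metricMat u *ᵥ X) ⬝ᵥ Y :=
  tractorMetric_graphMat _ _ X Y

theorem eq_preferredLift {u : Q} (hu : u ∈ G.proj ⁻¹' V.injLocus) {N : TMat n}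
    (hN : InNilradical (N - gradingElt n))
    (h : ∀ s ∈ V.fiber u, ∀ t ∈ V.fiber u, starComp N s ⬝ᵥ hBlock t = tractorMetric s t) :
    N = V.preferredLift u := by
  obtain ⟨b, c, hc, rfl⟩ := exists_eq_weylLift hN
  obtain ⟨rfl, rfl⟩ := (starComp_eq_tractorMetric_iff (V.topMat u) (V.midCol u) hc).1 fun X Y => by
    have := h _ (V.liftMat_mulVec_mem hu X) _ (V.liftMat_mulVec_mem hu Y)
    rwa [V.hBlock_liftMat_mulVec] at this
  rfl

theorem starComp_preferredLift {u : Q} (hu : u ∈ G.proj ⁻¹' V.injLocus) {s t : TVec n}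
    (hs : s ∈ V.fiber u) (ht : t ∈ V.fiber u) :
    starComp (V.preferredLift u) s ⬝ᵥ hBlock t = tractorMetric s t := by
  rw [V.eq_liftMat_mulVec hu hs, V.eq_liftMat_mulVec hu ht, starComp_liftMat,
    tractorMetric_liftMat, hBlock_liftMat_mulVec]

theorem preferredLift_isLift (u : Q) : InNilradical (V.preferredLift u - gradingElt n) :=
  weylLift_isLift (V.skewMat_transpose u)

/-- Equivariance needs no formula: the conjugate of the preferred lift at $u$ satisfies the
preferred condition at $u \cdot p$, and that condition has one solution. -/
theorem preferredLift_act {u : Q} (hu : u ∈ G.proj ⁻¹' V.injLocus) (p : Parabolic n) :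
    V.preferredLift (G.act u p) = pmat p⁻¹ * V.preferredLift u * pmat p := by
  refine (V.eq_preferredLift (V.act_mem_preimage_injLocus hu p)
    (isLift_pmat_conj p (V.preferredLift_isLift u)) fun s hs t ht => ?_).symm
  rw [starComp_conj_dotProduct (V.preferredLift_isLift u), V.starComp_preferredLift hu
    ((V.equivariant u p s).1 hs) ((V.equivariant u p t).1 ht), tractorMetric_mulVec (pmat_isometry p)]

theorem isWeylStructure_preferredLift : G.IsWeylStructure V.injLocus V.preferredLift where
  smooth := MatSmoothOn.ofBlocks (MatSmoothOn.const _) V.smoothOn_midCol V.smoothOn_skewMat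
    (MatSmoothOn.const _) (MatSmoothOn.const _) V.smoothOn_midCol.transpose.neg
    (MatSmoothOn.const _) (MatSmoothOn.const _) (MatSmoothOn.const _)
  lift u _ := V.preferredLift_isLift u
  equivariant _ hu p := V.preferredLift_act hu p

theorem isStronglyPreferred_preferredLift : V.IsStronglyPreferred V.injLocus V.preferredLift := by
  refine ⟨⟨V.isWeylStructure_preferredLift, fun u hu s hs t ht => V.starComp_preferredLift hu hs ht⟩,
    fun u hu s _ h => ?_⟩
  -- As $V$ covers $H$, one may test against the lift of the vector whose coordinates are those of
  -- the covector itself; its square norm is then zero.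
  have := h _ (V.liftMat_mulVec_mem hu (starComp (V.preferredLift u) s))
  rw [V.hBlock_liftMat_mulVec] at this
  exact dotProduct_self_eq_zero.1 this

theorem eqOn_preferredLift {η : Q → TMat n} (hη : V.IsPreferred V.injLocus η) :
    Set.EqOn η V.preferredLift (G.proj ⁻¹' V.injLocus) :=
  fun u hu => V.eq_preferredLift hu (hη.1.lift u hu) (hη.2 u hu)

theorem mu_preferredLift {u : Q} (hu : u ∈ G.proj ⁻¹' V.injLocus) (X : Fin n → ℝ) :
    V.mu V.preferredLift u X = V.metricMat u *ᵥ X := by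
  rw [← V.starComp_liftMat, V.liftMat_mulVec hu]
  rfl

theorem muH_preferredLift {u : Q} (hu : u ∈ G.proj ⁻¹' V.injLocus) (X Y : Fin n → ℝ) :
    V.muH V.preferredLift u X Y = (V.metricMat u *ᵥ X) ⬝ᵥ Y := by
  rw [muH, V.mu_preferredLift hu]

end TractorSubbundle

end CartanGeometry

end Subbundle

/-! ### Blocks of so(n+1,n) and their degrees -/

section Blocks

variable {n : ℕ}

/-- The block `H^* → H^*`. -/
def blockTT (y : TMat n) : Matrix (Fin n) (Fin n) ℝ := of fun i j => y (Sum.inl i) (Sum.inl j)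
/-- The block `ℝ → H^*`. -/
def blockTM (y : TMat n) : Matrix (Fin n) Unit ℝ := of fun i u => y (Sum.inl i) (Sum.inr (Sum.inl u))
/-- The block `H → H^*`. -/
def blockTB (y : TMat n) : Matrix (Fin n) (Fin n) ℝ :=
  of fun i j => y (Sum.inl i) (Sum.inr (Sum.inr j))
/-- The block `H^* → H`. -/
def blockBT (y : TMat n) : Matrix (Fin n) (Fin n) ℝ :=
  of fun i j => y (Sum.inr (Sum.inr i)) (Sum.inl j)
/-- The block `ℝ → H`. -/
def blockBM (y : TMat n) : Matrix (Fin n) Unit ℝ :=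
  of fun i u => y (Sum.inr (Sum.inr i)) (Sum.inr (Sum.inl u))

theorem eq_ofBlocks_of_mem_soAlg {y : TMat n} (hy : y ∈ soAlg n) :
    y = ofBlocks (blockTT y) (blockTM y) (blockTB y) (-(blockBM y)ᵀ) 0 (-(blockTM y)ᵀ) (blockBT y)
      (blockBM y) (-(blockTT y)ᵀ) := by
  obtain ⟨a, b, c, g, h, -, -, rfl⟩ := exists_eq_ofBlocks_of_mem_soAlg hy
  rfl

theorem blockTB_transpose {y : TMat n} (hy : y ∈ soAlg n) : (blockTB y)ᵀ = -blockTB y := by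
  obtain ⟨a, b, c, g, h, hc, -, rfl⟩ := exists_eq_ofBlocks_of_mem_soAlg hy
  exact hc

theorem blockBT_transpose {y : TMat n} (hy : y ∈ soAlg n) : (blockBT y)ᵀ = -blockBT y := by
  obtain ⟨a, b, c, g, h, -, hg, rfl⟩ := exists_eq_ofBlocks_of_mem_soAlg hy
  exact hg

/-- The part of positive degree of an element of `so(n+1,n)`. -/
def positivePart (b : Matrix (Fin n) Unit ℝ) (c : Matrix (Fin n) (Fin n) ℝ) : TMat n :=
  ofBlocks 0 b c 0 0 (-bᵀ) 0 0 0

/-- The element of degree zero of `so(n+1,n)` with the given action on `H^*`. -/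
def levi (a : Matrix (Fin n) (Fin n) ℝ) : TMat n := ofBlocks a 0 0 0 0 0 0 0 (-aᵀ)

theorem levi_mem_soAlg (a : Matrix (Fin n) (Fin n) ℝ) : levi a ∈ soAlg n := by
  have := ofBlocks_mem_soAlg (a := a) (b := 0) (c := 0) (g := 0) (h := 0) (by simp) (by simp)
  simpa [levi] using this

/-- $[y, E]$ has $-k\,y_k$ in degree $k$, so the sign and the factor ½ in the definition of `rho`
return exactly $y_1 + y_2$. -/
theorem gradeComp_bracket_gradingElt (y : TMat n) (hy : y ∈ soAlg n) :
    -(gradeComp (gradingElt n) 1 (y * gradingElt n - gradingElt n * y) +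
      (1 / 2 : ℝ) • gradeComp (gradingElt n) 2 (y * gradingElt n - gradingElt n * y)) =
      positivePart (blockTM y) (blockTB y) := by
  conv_lhs => rw [eq_ofBlocks_of_mem_soAlg hy, gradingElt_eq_ofBlocks, ofBlocks_mul, ofBlocks_mul,
    ofBlocks_sub, ← gradingElt_eq_ofBlocks, gradeComp_gradingElt_one, gradeComp_gradingElt_two,
    ofBlocks_smul, ofBlocks_add, ofBlocks_neg]
  rw [positivePart, ofBlocks_inj]
  simp only [Matrix.mul_zero, Matrix.zero_mul, Matrix.mul_one, Matrix.one_mul, Matrix.mul_neg,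
    smul_zero, add_zero, zero_add, neg_zero, true_and, and_true]
  exact ⟨by module, by module, by module⟩

theorem sub_gradeComp_gradingElt (y : TMat n) (hy : y ∈ soAlg n) :
    y - gradeComp (gradingElt n) (-2) y - gradeComp (gradingElt n) (-1) y -
      positivePart (blockTM y) (blockTB y) = levi (blockTT y) := by
  conv_lhs => rw [eq_ofBlocks_of_mem_soAlg hy, gradeComp_gradingElt_neg_two,
    gradeComp_gradingElt_neg_one, ofBlocks_sub, ofBlocks_sub]
  rw [positivePart, ofBlocks_sub, levi, ofBlocks_inj]
  refine ⟨?_, ?_, ?_, ?_, ?_, ?_, ?_, ?_, ?_⟩ <;> (ext i j; simp [blockTM, blockTB])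

end Blocks

/-! ### Local sections of V and the Cartan connection in the adapted frame -/

section Preserved

variable {n : ℕ} {EM EP M Q : Type*}
  [NormedAddCommGroup EM] [NormedSpace ℝ EM] [NormedAddCommGroup EP] [NormedSpace ℝ EP]
  [TopologicalSpace M] [ChartedSpace EM M] [IsManifold 𝓘(ℝ, EM) ∞ M]
  [TopologicalSpace Q] [ChartedSpace EP Q] [IsManifold 𝓘(ℝ, EP) ∞ Q]

namespace CartanGeometry

variable (G : CartanGeometry n EM EP M Q)

theorem form_mem (u : Q) (ξ : TangentSpace 𝓘(ℝ, EP) u) : G.form u ξ ∈ soAlg n := (G.conn u ξ).2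

theorem form_vec (u : Q) {y : TMat n} (hy : y ∈ soAlg n) : G.form u (G.vec u y) = y := by
  rw [form, vec, dif_pos hy, LinearEquiv.apply_symm_apply]

theorem vec_form (u : Q) (ξ : TangentSpace 𝓘(ℝ, EP) u) : G.vec u (G.form u ξ) = ξ := by
  rw [vec, dif_pos (G.form_mem u ξ)]
  exact (G.conn u).symm_apply_apply ξ

namespace TractorSubbundle

variable {G} (V : G.TractorSubbundle n)

/-- Every vector of `V` extends to a local section. -/
theorem exists_section {u : Q} (hu : u ∈ G.proj ⁻¹' V.injLocus) (X : Fin n → ℝ) :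
    ∃ (W : Set M) (s : Q → TVec n), IsOpen W ∧ u ∈ G.proj ⁻¹' W ∧ W ⊆ V.injLocus ∧
      G.IsTractorSection W s ∧ (∀ v ∈ G.proj ⁻¹' W, s v ∈ V.fiber v) ∧ s u = V.liftMat u *ᵥ X := by
  obtain ⟨W, hW, hxW, σ, φ, hσ, hφ, hσp, hσφ⟩ := G.local_triv (G.proj u)
  have hmem : ∀ v ∈ G.proj ⁻¹' (W ∩ V.injLocus), σ (G.proj v) ∈ G.proj ⁻¹' V.injLocus := by
    intro v hv
    rw [Set.mem_preimage, hσp _ hv.1]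
    exact hv.2
  -- The given vector is transported to the frame $\sigma$ over the same point, and its
  -- $H$-coordinates there are kept constant along $\sigma$. Lifting them to $V$ and extending
  -- equivariantly through $\varphi^{-1}$ gives the section.
  set X₀ := hBlock (pmat (φ u) *ᵥ (V.liftMat u *ᵥ X)) with hX₀
  refine ⟨W ∩ V.injLocus, fun v => pmat (φ v)⁻¹ *ᵥ (V.liftMat (σ (G.proj v)) *ᵥ X₀),
    hW.inter V.isOpen_injLocus, ⟨hxW, hu⟩, Set.inter_subset_right, ⟨?_, ?_⟩, ?_, ?_⟩
  · have hσpr : ContMDiffOn 𝓘(ℝ, EP) 𝓘(ℝ, EP) ∞ (fun v => σ (G.proj v))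
        (G.proj ⁻¹' (W ∩ V.injLocus)) :=
      hσ.comp G.contMDiff_proj.contMDiffOn fun v hv => hv.1
    have h1 : MatSmoothOn 𝓘(ℝ, EP) (fun v => pmat (φ v)⁻¹) (G.proj ⁻¹' (W ∩ V.injLocus)) := by
      simp only [pmat_inv_eq]
      have h2 : MatSmoothOn 𝓘(ℝ, EP) (fun v => pmat (φ v)) (G.proj ⁻¹' (W ∩ V.injLocus)) :=
        fun i j => (hφ i j).mono fun v hv => hv.1
      exact ((MatSmoothOn.const _).mul h2.transpose).mul (MatSmoothOn.const _)
    have h3 : MatSmoothOn 𝓘(ℝ, EP) (fun v => V.liftMat (σ (G.proj v))) (G.proj ⁻¹' (W ∩ V.injLocus)) :=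
      fun i j => (V.smoothOn_liftMat i j).comp hσpr hmem
    exact h1.mulVec (h3.mulVec fun j => RealSmoothOn.const _)
  · intro v hv p
    -- The trivialisation is not assumed equivariant; freeness of the action forces it.
    have h1 : φ (G.act v p) = φ v * p := by
      have h2 := hσφ (G.act v p) (by rw [Set.mem_preimage, G.proj_act]; exact hv.1)
      rw [G.proj_act] at h2
      refine G.act_left_injective (u := σ (G.proj v)) ?_
      rw [h2, G.act_mul, hσφ v hv.1]
    simp only
    rw [h1, G.proj_act, _root_.mul_inv_rev, pmat_mul, Matrix.mulVec_mulVec (V.liftMat _ *ᵥ X₀)]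
  · intro v hv
    have h1 := V.equivariant (σ (G.proj v)) (φ v) (pmat (φ v)⁻¹ *ᵥ (V.liftMat (σ (G.proj v)) *ᵥ X₀))
    rw [hσφ v hv.1, pmat_mulVec_inv_mulVec] at h1
    exact h1.2 (V.liftMat_mulVec_mem (hmem v hv) _)
  · have h1 := V.equivariant (σ (G.proj u)) (φ u) (V.liftMat u *ᵥ X)
    rw [hσφ u hxW] at h1
    have h2 := V.eq_liftMat_mulVec (hmem u ⟨hxW, hu⟩) (h1.1 (V.liftMat_mulVec_mem hu X))
    simp only
    rw [hX₀, ← h2, pmat_inv_mulVec_mulVec]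

/-- The tractor connection preserves `V` at `u` in the direction `ξ`. -/
def IsPreservedAt (u : Q) (ξ : TangentSpace 𝓘(ℝ, EP) u) : Prop :=
  ∀ (W : Set M) (s : Q → TVec n), IsOpen W → G.IsTractorSection W s →
    (∀ v ∈ G.proj ⁻¹' W, s v ∈ V.fiber v) → u ∈ G.proj ⁻¹' W → G.tractorDeriv s u ξ ∈ V.fiber u

/-- A section of $V$ is `liftMat` applied to its $H$-coordinates. By the product rule the derivative
of the coordinates contributes a vector of $V$, which can be dropped, so that only a condition on
the matrix `liftMat` at the one point $u$ remains. -/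
theorem matDeriv_liftMat_add {u : Q} (hu : u ∈ G.proj ⁻¹' V.injLocus)
    {ξ : TangentSpace 𝓘(ℝ, EP) u} (h : V.IsPreservedAt u ξ) (X : Fin n → ℝ) :
    ∃ Z, (matDeriv V.liftMat u ξ + G.form u ξ * V.liftMat u) *ᵥ X = V.liftMat u *ᵥ Z := by
  obtain ⟨W, s, hW, huW, hWV, hs, hsV, hsu⟩ := V.exists_section hu X
  have h1 := h W s hW hs hsV huW
  have hWo : IsOpen (G.proj ⁻¹' W) := G.isOpen_preimage_proj hW
  have h2 : vecDeriv s u ξ = vecDeriv (fun v => V.liftMat v *ᵥ hBlock (s v)) u ξ := by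
    refine vecDeriv_congr ξ ?_
    filter_upwards [hWo.mem_nhds huW] with v hv
    exact V.eq_liftMat_mulVec (hWV hv) (hsV v hv)
  have hsX : hBlock (s u) = X := by rw [hsu, V.hBlock_liftMat_mulVec]
  rw [vecDeriv_mulVec (s := fun v => hBlock (s v)) ξ
    (V.smoothOn_liftMat.diffAt V.isOpen_preimage_injLocus hu) (fun j => RealSmoothOn.diffAt (hs.1 _) hWo huW), hsX] at h2
  have h3 : G.tractorDeriv s u ξ = (matDeriv V.liftMat u ξ + G.form u ξ * V.liftMat u) *ᵥ X +
      V.liftMat u *ᵥ vecDeriv (fun v => hBlock (s v)) u ξ := by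
    have h4 : G.tractorDeriv s u ξ = vecDeriv s u ξ + G.form u ξ *ᵥ s u := rfl
    rw [h4, h2, hsu, Matrix.add_mulVec, Matrix.mulVec_mulVec]
    abel
  have h5 := V.eq_liftMat_mulVec hu h1
  rw [h3, ← eq_sub_iff_add_eq, ← Matrix.mulVec_sub] at h5
  exact ⟨_, h5⟩

/-- The frame in which the preferred Weyl structure is the standard grading element. -/
noncomputable def frame (u : Q) : TMat n := weylFrame (V.midCol u) (V.skewMat u)

/-- The inverse of the frame. -/
noncomputable def frameInv (u : Q) : TMat n := weylFrameInv (V.midCol u) (V.skewMat u)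

theorem frame_mul_frameInv (u : Q) : V.frame u * V.frameInv u = 1 := weylFrame_mul_weylFrameInv _ _

theorem frameInv_mul_frame (u : Q) : V.frameInv u * V.frame u = 1 := weylFrameInv_mul_weylFrame _ _

theorem frame_isometry (u : Q) : (V.frame u)ᵀ * Jmat n * V.frame u = Jmat n :=
  weylFrame_isometry (V.skewMat_transpose u)

theorem preferredLift_eq (u : Q) : V.preferredLift u = V.frame u * gradingElt n * V.frameInv u :=
  (weylFrame_conj_gradingElt _ _).symm

theorem liftMat_eq_frame_mul (u : Q) : V.liftMat u = V.frame u * graphMat (V.metricMat u) 0 :=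
  graphMat_eq_weylFrame_mul _ _

theorem smoothOn_frame : MatSmoothOn 𝓘(ℝ, EP) V.frame (G.proj ⁻¹' V.injLocus) :=
  MatSmoothOn.ofBlocks (MatSmoothOn.const _) V.smoothOn_midCol.neg
    (((V.smoothOn_midCol.mul V.smoothOn_midCol.transpose).add V.smoothOn_skewMat).smul _).neg
    (MatSmoothOn.const _) (MatSmoothOn.const _) V.smoothOn_midCol.transpose
    (MatSmoothOn.const _) (MatSmoothOn.const _) (MatSmoothOn.const _)

theorem smoothOn_frameInv : MatSmoothOn 𝓘(ℝ, EP) V.frameInv (G.proj ⁻¹' V.injLocus) :=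
  MatSmoothOn.ofBlocks (MatSmoothOn.const _) V.smoothOn_midCol
    ((V.smoothOn_skewMat.sub (V.smoothOn_midCol.mul V.smoothOn_midCol.transpose)).smul _)
    (MatSmoothOn.const _) (MatSmoothOn.const _) V.smoothOn_midCol.transpose.neg
    (MatSmoothOn.const _) (MatSmoothOn.const _) (MatSmoothOn.const _)

/-- The logarithmic derivative of the frame. -/
noncomputable def frameDeriv (u : Q) (ξ : TangentSpace 𝓘(ℝ, EP) u) : TMat n :=
  V.frameInv u * matDeriv V.frame u ξ

/-- The Cartan connection in the frame. -/
noncomputable def gaugedForm (u : Q) (ξ : TangentSpace 𝓘(ℝ, EP) u) : TMat n :=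
  V.frameInv u * G.form u ξ * V.frame u + V.frameDeriv u ξ

section Derivatives

variable {u : Q} (ξ : TangentSpace 𝓘(ℝ, EP) u)

theorem matDiffAt_frame (hu : u ∈ G.proj ⁻¹' V.injLocus) : MatDiffAt EP V.frame u :=
  V.smoothOn_frame.diffAt V.isOpen_preimage_injLocus hu

theorem matDiffAt_frameInv (hu : u ∈ G.proj ⁻¹' V.injLocus) : MatDiffAt EP V.frameInv u :=
  V.smoothOn_frameInv.diffAt V.isOpen_preimage_injLocus hu

theorem matDiffAt_metricMat (hu : u ∈ G.proj ⁻¹' V.injLocus) : MatDiffAt EP V.metricMat u :=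
  V.smoothOn_metricMat.diffAt V.isOpen_preimage_injLocus hu

theorem matDeriv_frame : matDeriv V.frame u ξ = V.frame u * V.frameDeriv u ξ := by
  rw [frameDeriv, ← Matrix.mul_assoc, frame_mul_frameInv, Matrix.one_mul]

/-- Obtained by differentiating $T^{-1}T = 1$. -/
theorem matDeriv_frameInv (hu : u ∈ G.proj ⁻¹' V.injLocus) : matDeriv V.frameInv u ξ = -(V.frameDeriv u ξ * V.frameInv u) := by
  have h1 := matDeriv_mul ξ (V.matDiffAt_frameInv hu) (V.matDiffAt_frame hu)
  simp only [frameInv_mul_frame] at h1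
  rw [matDeriv_const, matDeriv_frame, ← Matrix.mul_assoc, frameInv_mul_frame, Matrix.one_mul] at h1
  have h2 : matDeriv V.frameInv u ξ * V.frame u = -V.frameDeriv u ξ :=
    eq_neg_of_add_eq_zero_left h1.symm
  rw [← Matrix.neg_mul, ← h2, Matrix.mul_assoc, frame_mul_frameInv, Matrix.mul_one]

/-- Obtained by differentiating $T^TJT = J$. -/
theorem frameDeriv_mem_soAlg (hu : u ∈ G.proj ⁻¹' V.injLocus) : V.frameDeriv u ξ ∈ soAlg n := by
  have h1 := matDeriv_mul ξ ((V.matDiffAt_frame hu).transpose.mul (MatDiffAt.const (Jmat n)))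
    (V.matDiffAt_frame hu)
  rw [matDeriv_mul ξ (V.matDiffAt_frame hu).transpose (MatDiffAt.const (Jmat n))] at h1
  simp only [frame_isometry, matDeriv_const, matDeriv_transpose, Matrix.mul_zero, add_zero] at h1
  rw [mem_soAlg_iff]
  rw [matDeriv_frame, Matrix.transpose_mul] at h1
  have h2 := V.frame_isometry u
  calc (V.frameDeriv u ξ)ᵀ * Jmat n + Jmat n * V.frameDeriv u ξ
      = (V.frameDeriv u ξ)ᵀ * ((V.frame u)ᵀ * Jmat n * V.frame u) +
        ((V.frame u)ᵀ * Jmat n * V.frame u) * V.frameDeriv u ξ := by rw [h2]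
    _ = 0 := by rw [h1]; noncomm_ring

theorem gaugedForm_mem_soAlg (hu : u ∈ G.proj ⁻¹' V.injLocus) : V.gaugedForm u ξ ∈ soAlg n :=
  (soAlg n).add_mem (conj_mem_soAlg (V.frame_isometry u) (V.frame_mul_frameInv u) (G.form_mem u ξ))
    (V.frameDeriv_mem_soAlg ξ hu)

/-- The frame is unipotent and block upper triangular, so its logarithmic derivative has positive
degree. Hence the gauge term leaves the blocks of negative degree alone, and these still represent
the tangent vector. -/
theorem frameDeriv_eq : ∃ b c f, V.frameDeriv u ξ = ofBlocks 0 b c 0 0 f 0 0 0 := by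
  have h1 : matDeriv V.frame u ξ = ofBlocks 0 (matDeriv (fun v => -V.midCol v) u ξ)
      (matDeriv (fun v => -((1 / 2 : ℝ) • (V.midCol v * (V.midCol v)ᵀ + V.skewMat v))) u ξ) 0 0
      (matDeriv (fun v => (V.midCol v)ᵀ) u ξ) 0 0 0 := by
    have h2 := matDeriv_ofBlocks ξ (fun _ => (1 : Matrix (Fin n) (Fin n) ℝ))
      (fun v => -((1 / 2 : ℝ) • (V.midCol v * (V.midCol v)ᵀ + V.skewMat v))) (fun _ => 0) (fun _ => 1)
      (fun v => -V.midCol v) (fun _ => 0) (fun _ => 0) (fun v => (V.midCol v)ᵀ) (fun _ => 1)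
    simp only [matDeriv_const] at h2
    exact h2
  rw [frameDeriv, h1, frameInv, weylFrameInv, ofBlocks_mul]
  simp only [Matrix.mul_zero, Matrix.zero_mul, add_zero]
  exact ⟨_, _, _, rfl⟩

theorem blockBT_gaugedForm :
    blockBT (V.gaugedForm u ξ) = blockBT (V.frameInv u * G.form u ξ * V.frame u) := by
  obtain ⟨b, c, f, h⟩ := V.frameDeriv_eq ξ
  ext i j
  simp [gaugedForm, blockBT, h]

theorem blockBM_gaugedForm :
    blockBM (V.gaugedForm u ξ) = blockBM (V.frameInv u * G.form u ξ * V.frame u) := by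
  obtain ⟨b, c, f, h⟩ := V.frameDeriv_eq ξ
  ext i j
  simp [gaugedForm, blockBM, h]

end Derivatives

end TractorSubbundle

end CartanGeometry

end Preserved

/-! ### Rho-tensor, preferred connection and the equations for a preserved V -/

section Preserved

variable {n : ℕ} {EM EP M Q : Type*}
  [NormedAddCommGroup EM] [NormedSpace ℝ EM] [NormedAddCommGroup EP] [NormedSpace ℝ EP]
  [TopologicalSpace M] [ChartedSpace EM M] [IsManifold 𝓘(ℝ, EM) ∞ M]
  [TopologicalSpace Q] [ChartedSpace EP Q] [IsManifold 𝓘(ℝ, EP) ∞ Q]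

namespace CartanGeometry

namespace TractorSubbundle

variable {G : CartanGeometry n EM EP M Q} (V : G.TractorSubbundle n) {u : Q}

theorem gradeComp_preferredLift (k : ℤ) (y : TMat n) : gradeComp (V.preferredLift u) k y =
    V.frame u * gradeComp (gradingElt n) k (V.frameInv u * y * V.frame u) * V.frameInv u :=
  gradeComp_weylLift k y

theorem frameInv_conj_frame (y : TMat n) :
    V.frameInv u * (V.frame u * y * V.frameInv u) * V.frame u = y := by
  calc V.frameInv u * (V.frame u * y * V.frameInv u) * V.frame u
      = (V.frameInv u * V.frame u) * y * (V.frameInv u * V.frame u) := by noncomm_ring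
    _ = y := by rw [frameInv_mul_frame, Matrix.one_mul, Matrix.mul_one]

theorem frame_conj_frameInv (y : TMat n) :
    V.frame u * (V.frameInv u * y * V.frame u) * V.frameInv u = y := by
  calc V.frame u * (V.frameInv u * y * V.frame u) * V.frameInv u
      = (V.frame u * V.frameInv u) * y * (V.frame u * V.frameInv u) := by noncomm_ring
    _ = y := by rw [frame_mul_frameInv, Matrix.one_mul, Matrix.mul_one]

theorem frameInv_isometry (u : Q) : (V.frameInv u)ᵀ * Jmat n * V.frameInv u = Jmat n := by
  conv_lhs => rw [← V.frame_isometry u]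
  calc (V.frameInv u)ᵀ * ((V.frame u)ᵀ * Jmat n * V.frame u) * V.frameInv u
      = ((V.frameInv u)ᵀ * (V.frame u)ᵀ) * Jmat n * (V.frame u * V.frameInv u) := by noncomm_ring
    _ = Jmat n := by
      rw [← Matrix.transpose_mul, frame_mul_frameInv, Matrix.transpose_one, Matrix.one_mul,
        Matrix.mul_one]

theorem conj_frame_mem_soAlg {y : TMat n} (hy : y ∈ soAlg n) :
    V.frameInv u * y * V.frame u ∈ soAlg n :=
  conj_mem_soAlg (V.frame_isometry u) (V.frame_mul_frameInv u) hy

theorem conj_frameInv_mem_soAlg {y : TMat n} (hy : y ∈ soAlg n) :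
    V.frame u * y * V.frameInv u ∈ soAlg n :=
  conj_mem_soAlg (V.frameInv_isometry u) (V.frameInv_mul_frame u) hy

/-- The Weyl structure is a constant element conjugated by the frame, so in the frame its tractor
derivative is the bracket of the gauged connection with that constant. Together with
`gradeComp_bracket_gradingElt` this identifies the rho-tensor with the part of positive degree of
the gauged connection. -/
theorem matDeriv_preferredLift_add_bracket (hu : u ∈ G.proj ⁻¹' V.injLocus)
    (ξ : TangentSpace 𝓘(ℝ, EP) u) :
    matDeriv V.preferredLift u ξ + ⁅G.form u ξ, V.preferredLift u⁆ =
      V.frame u * (V.gaugedForm u ξ * gradingElt n - gradingElt n * V.gaugedForm u ξ) *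
        V.frameInv u := by
  have h1 : matDeriv V.preferredLift u ξ =
      matDeriv (fun v => V.frame v * gradingElt n * V.frameInv v) u ξ := by
    simp only [← preferredLift_eq]
  rw [h1, matDeriv_mul ξ ((V.matDiffAt_frame hu).mul (MatDiffAt.const _)) (V.matDiffAt_frameInv hu),
    matDeriv_mul ξ (V.matDiffAt_frame hu) (MatDiffAt.const _), matDeriv_const, Matrix.mul_zero,
    add_zero, matDeriv_frame, matDeriv_frameInv _ _ hu, gaugedForm, Ring.lie_def, preferredLift_eq]
  have h2 : V.frame u * V.frameInv u = 1 := V.frame_mul_frameInv u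
  have h3 : ∀ x : TMat n, V.frame u * (V.frameInv u * x) = x := fun x => by
    rw [← Matrix.mul_assoc, h2, Matrix.one_mul]
  simp only [Matrix.mul_add, Matrix.add_mul, Matrix.mul_sub, Matrix.sub_mul, Matrix.mul_assoc, h2, h3,
    Matrix.mul_neg, Matrix.mul_one]
  abel

theorem rho_preferredLift (hu : u ∈ G.proj ⁻¹' V.injLocus) {y : TMat n} (hy : y ∈ soAlg n) :
    G.rho V.preferredLift u y = V.frame u *
      positivePart (blockTM (V.gaugedForm u (G.vec u y))) (blockTB (V.gaugedForm u (G.vec u y))) *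
        V.frameInv u := by
  have h1 := V.matDeriv_preferredLift_add_bracket hu (G.vec u y)
  rw [G.form_vec u hy] at h1
  have h2 : dMat V.preferredLift u (G.vec u y) = matDeriv V.preferredLift u (G.vec u y) := rfl
  rw [rho, h2, h1, gradeComp_preferredLift, gradeComp_preferredLift, frameInv_conj_frame,
    ← gradeComp_bracket_gradingElt _ (V.gaugedForm_mem_soAlg _ hu)]
  simp only [Matrix.mul_neg, Matrix.neg_mul, Matrix.mul_add, Matrix.add_mul, Matrix.mul_smul,
    Matrix.smul_mul]

theorem gradeComp_gaugedForm (ξ : TangentSpace 𝓘(ℝ, EP) u) (hu : u ∈ G.proj ⁻¹' V.injLocus) :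
    gradeComp (gradingElt n) (-2) (V.frameInv u * G.form u ξ * V.frame u) =
      gradeComp (gradingElt n) (-2) (V.gaugedForm u ξ) ∧
    gradeComp (gradingElt n) (-1) (V.frameInv u * G.form u ξ * V.frame u) =
      gradeComp (gradingElt n) (-1) (V.gaugedForm u ξ) := by
  rw [eq_ofBlocks_of_mem_soAlg (V.conj_frame_mem_soAlg (G.form_mem u ξ)),
    eq_ofBlocks_of_mem_soAlg (V.gaugedForm_mem_soAlg ξ hu), gradeComp_gradingElt_neg_two,
    gradeComp_gradingElt_neg_two, gradeComp_gradingElt_neg_one, gradeComp_gradingElt_neg_one,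
    blockBT_gaugedForm, blockBM_gaugedForm]
  exact ⟨rfl, rfl⟩

/-- With the parts of negative and positive degree removed, the gauged connection keeps its part of
degree zero. Undoing the gauge adds the inhomogeneous term of the frame. -/
theorem weylForm_preferredLift (hu : u ∈ G.proj ⁻¹' V.injLocus) (ξ : TangentSpace 𝓘(ℝ, EP) u) :
    G.weylForm V.preferredLift u ξ =
      V.frame u * (levi (blockTT (V.gaugedForm u ξ)) - V.frameDeriv u ξ) * V.frameInv u := by
  have h1 : V.frame u * (V.gaugedForm u ξ - V.frameDeriv u ξ) * V.frameInv u = G.form u ξ := by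
    rw [gaugedForm, add_sub_cancel_right, frame_conj_frameInv]
  rw [weylForm, V.rho_preferredLift hu (G.form_mem u ξ), G.vec_form, gradeComp_preferredLift,
    gradeComp_preferredLift, (V.gradeComp_gaugedForm ξ hu).1, (V.gradeComp_gaugedForm ξ hu).2,
    ← sub_gradeComp_gradingElt _ (V.gaugedForm_mem_soAlg ξ hu)]
  conv_lhs => rw [← h1]
  noncomm_ring

theorem weylForm_mem_soAlg (hu : u ∈ G.proj ⁻¹' V.injLocus) (ξ : TangentSpace 𝓘(ℝ, EP) u) :
    G.weylForm V.preferredLift u ξ ∈ soAlg n := by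
  rw [V.weylForm_preferredLift hu]
  exact V.conj_frameInv_mem_soAlg
    ((soAlg n).sub_mem (levi_mem_soAlg _) (V.frameDeriv_mem_soAlg ξ hu))

theorem frame_bb (y : TMat n) (i : Fin n) (x : TIdx n) :
    (V.frame u * y) (Sum.inr (Sum.inr i)) x = y (Sum.inr (Sum.inr i)) x := by
  simp [frame, weylFrame, Matrix.mul_apply, Fintype.sum_sum_type, Matrix.one_apply]

/-- The action of the preferred connection on `H`. -/
theorem weylForm_bb (hu : u ∈ G.proj ⁻¹' V.injLocus) (ξ : TangentSpace 𝓘(ℝ, EP) u) :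
    (Matrix.of fun i j => G.weylForm V.preferredLift u ξ (Sum.inr (Sum.inr i)) (Sum.inr (Sum.inr j))) =
      -(blockTT (V.gaugedForm u ξ))ᵀ := by
  obtain ⟨b, c, f, h⟩ := V.frameDeriv_eq ξ
  ext i j
  rw [Matrix.of_apply, V.weylForm_preferredLift hu, Matrix.mul_assoc, frame_bb, h, levi, ofBlocks_sub,
    frameInv, weylFrameInv, ofBlocks_mul]
  simp

/-- The components of the parallelity of `V`. -/
theorem preserved_equations (hu : u ∈ G.proj ⁻¹' V.injLocus) {ξ : TangentSpace 𝓘(ℝ, EP) u}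
    (h : V.IsPreservedAt u ξ) :
    matDeriv V.metricMat u ξ + blockTT (V.gaugedForm u ξ) * V.metricMat u + blockTB (V.gaugedForm u ξ) =
      V.metricMat u * (blockBT (V.gaugedForm u ξ) * V.metricMat u - (blockTT (V.gaugedForm u ξ))ᵀ) ∧
    blockTM (V.gaugedForm u ξ) = -(V.metricMat u * blockBM (V.gaugedForm u ξ)) := by
  set m := V.metricMat u with hm
  set w := V.gaugedForm u ξ with hw
  have hwm : w ∈ soAlg n := V.gaugedForm_mem_soAlg ξ hu
  have hd : matDeriv (fun v => graphMat (V.metricMat v) 0) u ξ =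
      Matrix.of fun x j => match x with
        | Sum.inl i => matDeriv V.metricMat u ξ i j
        | Sum.inr _ => 0 := by
    ext (i | i | i) j
    · rfl
    · exact realDeriv_const ξ _
    · exact realDeriv_const ξ _
  have hdiff : MatDiffAt EP (fun v => graphMat (V.metricMat v) 0) u := by
    rintro (i | i | i) j
    · exact V.matDiffAt_metricMat hu i j
    · exact mdifferentiableAt_const
    · exact mdifferentiableAt_const
  have h1 : matDeriv V.liftMat u ξ + G.form u ξ * V.liftMat u =
      V.frame u * (matDeriv (fun v => graphMat (V.metricMat v) 0) u ξ + w * graphMat m 0) := by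
    have h2 : matDeriv V.liftMat u ξ =
        matDeriv (fun v => V.frame v * graphMat (V.metricMat v) 0) u ξ := by
      simp only [← liftMat_eq_frame_mul]
    rw [h2, matDeriv_mul ξ (V.matDiffAt_frame hu) hdiff, liftMat_eq_frame_mul, matDeriv_frame, hw,
      gaugedForm]
    simp only [Matrix.mul_add, Matrix.add_mul, ← Matrix.mul_assoc, frame_mul_frameInv, Matrix.one_mul]
    abel
  -- The same condition in the adapted frame, after the invertible frame is cancelled: $d + w$ maps
  -- the graph of $m$ to itself.
  have key : ∀ X, ∃ Z, (matDeriv (fun v => graphMat (V.metricMat v) 0) u ξ + w * graphMat m 0) *ᵥ X =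
      graphMat m 0 *ᵥ Z := by
    intro X
    obtain ⟨Z, hZ⟩ := V.matDeriv_liftMat_add hu h X
    rw [h1, liftMat_eq_frame_mul, ← Matrix.mulVec_mulVec, ← Matrix.mulVec_mulVec] at hZ
    refine ⟨Z, ?_⟩
    have := congrArg (fun t => V.frameInv u *ᵥ t) hZ
    simpa only [Matrix.mulVec_mulVec, ← Matrix.mul_assoc, frameInv_mul_frame, Matrix.one_mul] using this
  have hblock : ∀ X, topBlock ((matDeriv (fun v => graphMat (V.metricMat v) 0) u ξ +
        w * graphMat m 0) *ᵥ X) = (matDeriv V.metricMat u ξ + blockTT w * m + blockTB w) *ᵥ X ∧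
      midCoord ((matDeriv (fun v => graphMat (V.metricMat v) 0) u ξ +
        w * graphMat m 0) *ᵥ X) = ((-(blockBM w)ᵀ * m - (blockTM w)ᵀ) *ᵥ X) () ∧
      hBlock ((matDeriv (fun v => graphMat (V.metricMat v) 0) u ξ +
        w * graphMat m 0) *ᵥ X) = (blockBT w * m - (blockTT w)ᵀ) *ᵥ X := by
    intro X
    have hT : ∀ s t : TVec n, topBlock (s + t) = topBlock s + topBlock t := fun _ _ => rfl
    have hM : ∀ s t : TVec n, midCoord (s + t) = midCoord s + midCoord t := fun _ _ => rfl
    have hH : ∀ s t : TVec n, hBlock (s + t) = hBlock s + hBlock t := fun _ _ => rfl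
    have e1 : topBlock (matDeriv (fun v => graphMat (V.metricMat v) 0) u ξ *ᵥ X) =
        matDeriv V.metricMat u ξ *ᵥ X := by rw [hd]; rfl
    have e2 : midCoord (matDeriv (fun v => graphMat (V.metricMat v) 0) u ξ *ᵥ X) = 0 := by
      rw [hd]; simp [midCoord, Matrix.mulVec, dotProduct]
    have e3 := matDeriv_graphMat ξ V.metricMat (fun _ => 0) X
    have e4 : (fun _ : Unit => midCoord (graphMat m 0 *ᵥ X)) = 0 := by
      ext
      rw [midCoord_graphMat_mulVec]; simp
    rw [Matrix.add_mulVec, hT, hM, hH, e1, e2, e3, ← Matrix.mulVec_mulVec,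
      eq_ofBlocks_of_mem_soAlg hwm, topBlock_ofBlocks_mulVec, midCoord_ofBlocks_mulVec,
      hBlock_ofBlocks_mulVec, topBlock_graphMat_mulVec, hBlock_graphMat_mulVec, e4,
      ← eq_ofBlocks_of_mem_soAlg hwm]
    simp only [Matrix.mulVec_zero, add_zero, zero_add, Matrix.add_mulVec,
      Matrix.mulVec_mulVec, Matrix.neg_mulVec, add_assoc, sub_eq_add_neg, true_and]
  constructor
  -- The vector $Z$ is its own $H$-block, and on the graph the $H^*$-block is $m$ times the
  -- $H$-block; eliminating $Z$ gives the equation.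
  · refine Matrix.ext_of_mulVec_single fun j => ?_
    obtain ⟨Z, hZ⟩ := key (Pi.single j 1)
    rw [← (hblock _).1, hZ, topBlock_graphMat_mulVec, ← Matrix.mulVec_mulVec, ← (hblock _).2.2, hZ,
      hBlock_graphMat_mulVec]
  -- The graph of $m$ has no middle component, so the middle component of the derivative must
  -- vanish.
  · have h3 : -(blockBM w)ᵀ * m - (blockTM w)ᵀ = 0 := by
      refine Matrix.ext_of_mulVec_single fun j => ?_
      obtain ⟨Z, hZ⟩ := key (Pi.single j 1)
      ext ⟨⟩
      rw [← (hblock _).2.1, hZ, midCoord_graphMat_mulVec]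
      simp
    have h4 := congrArg Matrix.transpose h3
    rw [Matrix.transpose_sub, Matrix.transpose_mul, Matrix.transpose_neg, Matrix.transpose_transpose,
      Matrix.transpose_transpose, hm, metricMat_transpose, Matrix.transpose_zero, sub_eq_zero,
      Matrix.mul_neg] at h4
    exact h4.symm

/-- The metric is parallel in every direction in which `V` is. -/
theorem matDeriv_metricMat (hu : u ∈ G.proj ⁻¹' V.injLocus) {ξ : TangentSpace 𝓘(ℝ, EP) u}
    (h : V.IsPreservedAt u ξ) :
    matDeriv V.metricMat u ξ = -(blockTT (V.gaugedForm u ξ) * V.metricMat u +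
      V.metricMat u * (blockTT (V.gaugedForm u ξ))ᵀ) ∧
    blockTB (V.gaugedForm u ξ) = V.metricMat u * blockBT (V.gaugedForm u ξ) * V.metricMat u := by
  have h1 := (V.preserved_equations hu h).1
  have hwm : V.gaugedForm u ξ ∈ soAlg n := V.gaugedForm_mem_soAlg ξ hu
  have hc := blockTB_transpose hwm
  have hg := blockBT_transpose hwm
  have hm := V.metricMat_transpose u
  have hdm : (matDeriv V.metricMat u ξ)ᵀ = matDeriv V.metricMat u ξ := by
    rw [← matDeriv_transpose]
    simp only [metricMat_transpose]
  generalize blockTT (V.gaugedForm u ξ) = a at *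
  generalize blockTB (V.gaugedForm u ξ) = c at *
  generalize blockBT (V.gaugedForm u ξ) = g at *
  generalize V.metricMat u = m at *
  generalize matDeriv V.metricMat u ξ = d at *
  -- Both sides of $dm + am + ma^T = mgm - c$ are compared with their transposes: the left side is
  -- symmetric, the right side skew as $g$ and $c$ are, so each is zero.
  have h2 := congrArg Matrix.transpose h1
  simp only [Matrix.transpose_add, Matrix.transpose_mul, Matrix.transpose_sub, hc, hg, hm, hdm,
    Matrix.transpose_transpose] at h2
  have e1 : d + a * m + m * aᵀ = m * g * m - c := by
    have : d + a * m + c - c + m * aᵀ = m * (g * m - aᵀ) - c + m * aᵀ := by rw [h1]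
    rw [add_sub_cancel_right] at this
    rw [this]
    noncomm_ring
  have e2 : d + a * m + m * aᵀ = -(m * g * m - c) := by
    have : d + m * aᵀ + -c + c + a * m = (m * -g - a) * m + c + a * m := by rw [h2]
    rw [neg_add_cancel_right] at this
    rw [add_right_comm, this]
    noncomm_ring
  have e3 : m * g * m - c = 0 := by
    have e4 := e1.symm.trans e2
    generalize m * g * m - c = x at e4
    ext i j
    exact self_eq_neg.1 (congrFun (congrFun e4 i) j)
  rw [e3, add_assoc] at e1
  exact ⟨eq_neg_of_add_eq_zero_left e1, (sub_eq_zero.1 e3).symm⟩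

/-- The preferred connection acts on $H$ through $-a^T$, so the covariant derivative has the matrix
$dm + am + ma^T$. Only the one direction $\xi$ enters, which also serves the case where $V$ is
preserved along $H$ only. -/
theorem nablaFormH_eq_zero (hu : u ∈ G.proj ⁻¹' V.injLocus) {ξ : TangentSpace 𝓘(ℝ, EP) u}
    (h : V.IsPreservedAt u ξ) (X Y : Fin n → ℝ) :
    G.nablaFormH V.preferredLift (V.muH V.preferredLift) u ξ X Y = 0 := by
  have h1 : realDeriv (fun v => V.muH V.preferredLift v X Y) u ξ =
      (matDeriv V.metricMat u ξ *ᵥ X) ⬝ᵥ Y := by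
    have h2 : realDeriv (fun v => V.muH V.preferredLift v X Y) u ξ =
        realDeriv (fun v => (V.metricMat v *ᵥ X) ⬝ᵥ Y) u ξ := by
      refine realDeriv_congr ξ ?_
      filter_upwards [V.isOpen_preimage_injLocus.mem_nhds hu] with v hv
      exact V.muH_preferredLift hv X Y
    have h3 : ∀ i, RealDiffAt EP (fun v => (V.metricMat v *ᵥ X) i) u := fun i =>
      RealSmoothOn.diffAt 
        (V.smoothOn_metricMat.mulVec (s := fun _ => X) (fun j => RealSmoothOn.const _) i)
        V.isOpen_preimage_injLocus hu
    rw [h2]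
    simp only [dotProduct]
    rw [realDeriv_sum ξ _ fun i _ => RealDiffAt.mul (h3 i) mdifferentiableAt_const]
    refine Finset.sum_congr rfl fun i _ => ?_
    rw [realDeriv_mul ξ (h3 i) mdifferentiableAt_const, realDeriv_const, mul_zero, add_zero]
    have h4 := congrFun (vecDeriv_mulVec (s := fun _ => X) ξ (V.matDiffAt_metricMat hu)
      (fun j => mdifferentiableAt_const)) i
    have h5 : vecDeriv (fun _ : Q => X) u ξ = 0 := by
      ext j
      exact realDeriv_const ξ _
    rw [h5, Matrix.mulVec_zero, add_zero] at h4
    rw [← h4]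
    rfl
  have h6 : G.nablaFormH V.preferredLift (V.muH V.preferredLift) u ξ X Y =
      realDeriv (fun v => V.muH V.preferredLift v X Y) u ξ -
      V.muH V.preferredLift u ((-(blockTT (V.gaugedForm u ξ))ᵀ) *ᵥ X) Y -
      V.muH V.preferredLift u X ((-(blockTT (V.gaugedForm u ξ))ᵀ) *ᵥ Y) := by
    rw [← V.weylForm_bb hu]
    rfl
  rw [h6, h1, V.muH_preferredLift hu, V.muH_preferredLift hu, (V.matDeriv_metricMat hu h).1,
    Matrix.dotProduct_mulVec, ← Matrix.mulVec_transpose, Matrix.transpose_neg,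
    Matrix.transpose_transpose, Matrix.mulVec_mulVec, Matrix.mulVec_mulVec, ← sub_dotProduct,
    ← sub_dotProduct, ← Matrix.sub_mulVec, ← Matrix.sub_mulVec]
  have : -(blockTT (V.gaugedForm u ξ) * V.metricMat u +
      V.metricMat u * (blockTT (V.gaugedForm u ξ))ᵀ) -
      V.metricMat u * -(blockTT (V.gaugedForm u ξ))ᵀ -
      -blockTT (V.gaugedForm u ξ) * V.metricMat u = 0 := by noncomm_ring
  rw [this, Matrix.zero_mulVec, zero_dotProduct]

end TractorSubbundle

end CartanGeometry

end Preserved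

/-! ### The form on T, its parallelism, and the parallelism of the rho-tensor -/

section Preserved

section Blocks

variable {n : ℕ}

/-- Going back from the adapted frame does not disturb this block, because the last block row of the
frame is that of the identity and the degree $-1$ part has nothing in the lower left corner. -/
theorem tanOne_weylLift (b : Matrix (Fin n) Unit ℝ) (c : Matrix (Fin n) (Fin n) ℝ) (y : TMat n) :
    tanOne (weylLift b c) y = fun i => blockBM (weylFrameInv b c * y * weylFrame b c) i () := by
  ext i
  rw [tanOne, gradeComp_weylLift]
  obtain ⟨a, b', c', d, e, f, g, h, k, hy⟩ :=
    exists_eq_ofBlocks (weylFrameInv b c * y * weylFrame b c)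
  rw [hy, gradeComp_gradingElt_neg_one, weylFrame, weylFrameInv, ofBlocks_mul, ofBlocks_mul]
  simp [midIdx, blockBM]

theorem tanTwo_weylLift (b : Matrix (Fin n) Unit ℝ) (c : Matrix (Fin n) (Fin n) ℝ) (y : TMat n) :
    tanTwo (weylLift b c) y = blockBT (weylFrameInv b c * y * weylFrame b c) := by
  ext i j
  rw [tanTwo, gradeComp_weylLift]
  obtain ⟨a, b', c', d, e, f, g, h, k, hy⟩ :=
    exists_eq_ofBlocks (weylFrameInv b c * y * weylFrame b c)
  rw [hy, gradeComp_gradingElt_neg_two, weylFrame, weylFrameInv, ofBlocks_mul, ofBlocks_mul]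
  simp [blockBT]

theorem covOne_conj_positivePart (b b' : Matrix (Fin n) Unit ℝ) (c c' : Matrix (Fin n) (Fin n) ℝ) :
    covOne (weylFrame b c * positivePart b' c' * weylFrameInv b c) = fun i => b' i () := by
  ext i
  rw [weylFrame, weylFrameInv, positivePart, ofBlocks_mul, ofBlocks_mul]
  simp [covOne, midIdx]

theorem covTwo_conj_positivePart (b b' : Matrix (Fin n) Unit ℝ) (c c' : Matrix (Fin n) (Fin n) ℝ)
    (X X' : Fin n → ℝ) :
    covTwo (weylLift b c) (weylFrame b c * positivePart b' c' * weylFrameInv b c) X X' =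
      -(X' ⬝ᵥ (c' *ᵥ X)) := by
  have h1 : weylFrameInv b c * (weylFrame b c * positivePart b' c' * weylFrameInv b c) *
      weylFrame b c = positivePart b' c' := by
    calc _ = (weylFrameInv b c * weylFrame b c) * positivePart b' c' *
          (weylFrameInv b c * weylFrame b c) := by noncomm_ring
      _ = _ := by rw [weylFrameInv_mul_weylFrame, Matrix.one_mul, Matrix.mul_one]
  have h2 : gradeComp (weylLift b c) 2 (weylFrame b c * positivePart b' c' * weylFrameInv b c) =
      ofBlocks 0 0 c' 0 0 0 0 0 0 := by
    rw [gradeComp_weylLift, h1, positivePart, gradeComp_gradingElt_two, weylFrame, weylFrameInv,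
      ofBlocks_mul, ofBlocks_mul]
    simp
  rw [covTwo, h2]
  simp only [ofBlocks_tb, dotProduct, Matrix.mulVec, Finset.mul_sum]
  congr 1
  exact Finset.sum_congr rfl fun i _ => Finset.sum_congr rfl fun j _ => by ring

/-- The form induced on skew matrices by a symmetric matrix. -/
noncomputable def wedgeTrace (m C C' : Matrix (Fin n) (Fin n) ℝ) : ℝ :=
  (1 / 2) * (Cᵀ * m * C' * m).trace

/-- The trace replaces the fourfold sum, so that the product rule for matrices and cyclicity can be
used. Symmetry of $m$ lets its indices be put in the order of the product. -/
theorem wedgeForm_eq_wedgeTrace {m : Matrix (Fin n) (Fin n) ℝ} (hm : mᵀ = m)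
    {b : (Fin n → ℝ) → (Fin n → ℝ) → ℝ} (hb : ∀ X Y, b X Y = (m *ᵥ X) ⬝ᵥ Y)
    (C C' : Matrix (Fin n) (Fin n) ℝ) : wedgeForm b C C' = wedgeTrace m C C' := by
  have hs : ∀ i j, m i j = m j i := fun i j => by conv_lhs => rw [← hm, Matrix.transpose_apply]
  have hb' : ∀ i k, b (Pi.single i 1) (Pi.single k 1) = m i k := by
    intro i k
    rw [hb, hs i k]
    simp
  rw [wedgeForm, wedgeTrace]
  simp only [hb', Matrix.trace, Matrix.diag_apply, Matrix.mul_apply, Matrix.transpose_apply,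
    Finset.sum_mul]
  congr 1
  rw [Finset.sum_comm]
  refine Finset.sum_congr rfl fun j _ => ?_
  rw [Finset.sum_comm]
  have : ∀ k, (∑ i, ∑ l, C i j * C' k l * m i k * m j l) =
      ∑ l, ∑ i, C i j * m i k * C' k l * m l j := by
    intro k
    rw [Finset.sum_comm]
    refine Finset.sum_congr rfl fun l _ => Finset.sum_congr rfl fun i _ => ?_
    rw [hs l j]
    ring
  rw [Finset.sum_congr rfl fun k _ => this k, Finset.sum_comm]

/-- The form induced on `T` by a symmetric matrix, in the frame. -/
noncomputable def modelForm (m : Matrix (Fin n) (Fin n) ℝ) (y z : TMat n) : ℝ :=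
  ((blockBM z)ᵀ * m * blockBM y).trace + wedgeTrace m (blockBT y) (blockBT z)

/-- The rho-tensor that a symmetric matrix determines, in the frame. -/
def modelRho (m : Matrix (Fin n) (Fin n) ℝ) (y : TMat n) : TMat n :=
  positivePart (-(m * blockBM y)) (m * blockBT y * m)

theorem levi_bracket (a : Matrix (Fin n) (Fin n) ℝ) {y : TMat n} :
    blockBM (levi a * y - y * levi a) = -(aᵀ * blockBM y) ∧
      blockBT (levi a * y - y * levi a) = -(aᵀ * blockBT y + blockBT y * a) := by
  obtain ⟨a', b', c', d, e, f, g, h, k, rfl⟩ := exists_eq_ofBlocks y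
  rw [levi, ofBlocks_mul, ofBlocks_mul, ofBlocks_sub]
  constructor
  · ext i j
    simp [blockBM, Matrix.mul_apply]
  · ext i j
    simp [blockBT, Matrix.mul_apply]
    ring

theorem levi_bracket_positivePart (a c : Matrix (Fin n) (Fin n) ℝ) (b : Matrix (Fin n) Unit ℝ) :
    levi a * positivePart b c - positivePart b c * levi a =
      positivePart (a * b) (a * c + c * aᵀ) := by
  rw [levi, positivePart, positivePart, ofBlocks_mul, ofBlocks_mul, ofBlocks_sub, ofBlocks_inj]
  refine ⟨by simp, by simp, ?_, by simp, by simp, ?_, by simp, by simp, by simp⟩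
  · simp only [Matrix.mul_zero, Matrix.zero_mul, zero_add, add_zero, Matrix.mul_neg]
    abel
  · simp [Matrix.transpose_mul]

theorem positivePart_add (c c' : Matrix (Fin n) (Fin n) ℝ) (b b' : Matrix (Fin n) Unit ℝ) :
    positivePart b c + positivePart b' c' = positivePart (b + b') (c + c') := by
  rw [positivePart, positivePart, positivePart, ofBlocks_add, ofBlocks_inj]
  simp [add_comm]

theorem positivePart_sub (c c' : Matrix (Fin n) (Fin n) ℝ) (b b' : Matrix (Fin n) Unit ℝ) :
    positivePart b c - positivePart b' c' = positivePart (b - b') (c - c') := by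
  rw [positivePart, positivePart, positivePart, ofBlocks_sub, ofBlocks_inj]
  simp [sub_eq_add_neg, add_comm]

theorem bracket_mem_soAlg {y z : TMat n} (hy : y ∈ soAlg n) (hz : z ∈ soAlg n) :
    ⁅y, z⁆ ∈ soAlg n := Matrix.isSkewAdjoint_bracket _ hy hz

end Blocks

variable {n : ℕ} {EM EP M Q : Type*}
  [NormedAddCommGroup EM] [NormedSpace ℝ EM] [NormedAddCommGroup EP] [NormedSpace ℝ EP]
  [TopologicalSpace M] [ChartedSpace EM M] [IsManifold 𝓘(ℝ, EM) ∞ M]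
  [TopologicalSpace Q] [ChartedSpace EP Q] [IsManifold 𝓘(ℝ, EP) ∞ Q]

namespace CartanGeometry

namespace TractorSubbundle

variable {G : CartanGeometry n EM EP M Q} (V : G.TractorSubbundle n) {u : Q}

/-- An element of `𝔤`, in the frame. -/
noncomputable def inFrame (y : TMat n) (u : Q) : TMat n := V.frameInv u * y * V.frame u

theorem tanOne_preferredLift (y : TMat n) :
    tanOne (V.preferredLift u) y = fun i => blockBM (V.inFrame y u) i () := tanOne_weylLift _ _ y

theorem tanTwo_preferredLift (y : TMat n) :
    tanTwo (V.preferredLift u) y = blockBT (V.inFrame y u) := tanTwo_weylLift _ _ y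

theorem muT_preferredLift (hu : u ∈ G.proj ⁻¹' V.injLocus) (y z : TMat n) :
    V.muT V.preferredLift u y z = modelForm (V.metricMat u) (V.inFrame y u) (V.inFrame z u) := by
  rw [muT, modelForm, wedgeForm_eq_wedgeTrace (V.metricMat_transpose u) (V.muH_preferredLift hu),
    tanTwo_preferredLift, tanTwo_preferredLift, V.muH_preferredLift hu, tanOne_preferredLift,
    tanOne_preferredLift]
  congr 1
  rw [dotProduct_comm, Matrix.mul_assoc]
  simp [Matrix.trace, Matrix.mul_apply, dotProduct, Matrix.mulVec]

theorem inFrame_mem_soAlg {y : TMat n} (hy : y ∈ soAlg n) : V.inFrame y u ∈ soAlg n :=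
  V.conj_frame_mem_soAlg hy

theorem smoothOn_inFrame (y : TMat n) : MatSmoothOn 𝓘(ℝ, EP) (V.inFrame y) (G.proj ⁻¹' V.injLocus) :=
  (V.smoothOn_frameInv.mul (MatSmoothOn.const y)).mul V.smoothOn_frame

theorem matDeriv_inFrame (hu : u ∈ G.proj ⁻¹' V.injLocus) (ξ : TangentSpace 𝓘(ℝ, EP) u)
    (y : TMat n) : matDeriv (V.inFrame y) u ξ =
      V.inFrame y u * V.frameDeriv u ξ - V.frameDeriv u ξ * V.inFrame y u := by
  have h1 : matDeriv (V.inFrame y) u ξ = matDeriv (fun v => V.frameInv v * y * V.frame v) u ξ := rfl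
  rw [h1, matDeriv_mul ξ ((V.matDiffAt_frameInv hu).mul (MatDiffAt.const _)) (V.matDiffAt_frame hu),
    matDeriv_mul ξ (V.matDiffAt_frameInv hu) (MatDiffAt.const _), matDeriv_const, Matrix.mul_zero,
    add_zero, matDeriv_frame, matDeriv_frameInv _ _ hu, inFrame]
  noncomm_ring

/-- A fixed $y$ is not constant when seen in the moving frame, and the gauge term of the connection
form accounts exactly for this. Hence the bracket is the derivative of the frame components plus the
action of the degree-zero part. -/
theorem inFrame_bracket_weylForm (hu : u ∈ G.proj ⁻¹' V.injLocus) (ξ : TangentSpace 𝓘(ℝ, EP) u)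
    (y : TMat n) : V.inFrame ⁅G.weylForm V.preferredLift u ξ, y⁆ u = matDeriv (V.inFrame y) u ξ +
      (levi (blockTT (V.gaugedForm u ξ)) * V.inFrame y u -
        V.inFrame y u * levi (blockTT (V.gaugedForm u ξ))) := by
  rw [V.matDeriv_inFrame hu, V.weylForm_preferredLift hu, Ring.lie_def]
  generalize levi (blockTT (V.gaugedForm u ξ)) = a
  generalize V.frameDeriv u ξ = θ
  have h1 : ∀ x, V.frameInv u * (V.frame u * x) = x := fun x => by
    rw [← Matrix.mul_assoc, V.frameInv_mul_frame, Matrix.one_mul]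
  have h2 := V.frameInv_mul_frame u
  simp only [inFrame, Matrix.mul_sub, Matrix.sub_mul, Matrix.mul_assoc, h1, h2, Matrix.mul_one]
  abel

theorem blockBM_inFrame_bracket (hu : u ∈ G.proj ⁻¹' V.injLocus) (ξ : TangentSpace 𝓘(ℝ, EP) u)
    (y : TMat n) : blockBM (V.inFrame ⁅G.weylForm V.preferredLift u ξ, y⁆ u) =
      matDeriv (fun v => blockBM (V.inFrame y v)) u ξ -
        (blockTT (V.gaugedForm u ξ))ᵀ * blockBM (V.inFrame y u) := by
  have h1 : ∀ x z : TMat n, blockBM (x + z) = blockBM x + blockBM z := fun _ _ => rfl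
  rw [V.inFrame_bracket_weylForm hu, h1, (levi_bracket _).1, sub_eq_add_neg]
  rfl

theorem blockBT_inFrame_bracket (hu : u ∈ G.proj ⁻¹' V.injLocus) (ξ : TangentSpace 𝓘(ℝ, EP) u)
    (y : TMat n) : blockBT (V.inFrame ⁅G.weylForm V.preferredLift u ξ, y⁆ u) =
      matDeriv (fun v => blockBT (V.inFrame y v)) u ξ -
        ((blockTT (V.gaugedForm u ξ))ᵀ * blockBT (V.inFrame y u) +
          blockBT (V.inFrame y u) * blockTT (V.gaugedForm u ξ)) := by
  have h1 : ∀ x z : TMat n, blockBT (x + z) = blockBT x + blockBT z := fun _ _ => rfl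
  rw [V.inFrame_bracket_weylForm hu, h1, (levi_bracket _).2, sub_eq_add_neg]
  rfl

theorem matDiffAt_blockBM_inFrame (hu : u ∈ G.proj ⁻¹' V.injLocus) (y : TMat n) :
    MatDiffAt EP (fun v => blockBM (V.inFrame y v)) u :=
  fun _ _ => (V.smoothOn_inFrame y).diffAt V.isOpen_preimage_injLocus hu _ _

theorem matDiffAt_blockBT_inFrame (hu : u ∈ G.proj ⁻¹' V.injLocus) (y : TMat n) :
    MatDiffAt EP (fun v => blockBT (V.inFrame y v)) u :=
  fun _ _ => (V.smoothOn_inFrame y).diffAt V.isOpen_preimage_injLocus hu _ _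

/-- The derivatives of the components of $y$ and $z$ cancel against those inside the bracket terms.
What is left is built from $dm + am + ma^T$, which is zero. -/
theorem nablaFormT_eq_zero (hu : u ∈ G.proj ⁻¹' V.injLocus) {ξ : TangentSpace 𝓘(ℝ, EP) u}
    (h : V.IsPreservedAt u ξ) (y z : TMat n) :
    G.nablaFormT V.preferredLift (V.muT V.preferredLift) u ξ y z = 0 := by
  have hM := V.matDiffAt_metricMat hu
  have hy1 := V.matDiffAt_blockBM_inFrame hu y
  have hz1 := V.matDiffAt_blockBM_inFrame hu z
  have hy2 := V.matDiffAt_blockBT_inFrame hu y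
  have hz2 := V.matDiffAt_blockBT_inFrame hu z
  have h0 : G.nablaFormT V.preferredLift (V.muT V.preferredLift) u ξ y z =
      realDeriv (fun v => modelForm (V.metricMat v) (V.inFrame y v) (V.inFrame z v)) u ξ -
        modelForm (V.metricMat u) (V.inFrame ⁅G.weylForm V.preferredLift u ξ, y⁆ u) (V.inFrame z u) -
        modelForm (V.metricMat u) (V.inFrame y u) (V.inFrame ⁅G.weylForm V.preferredLift u ξ, z⁆ u) := by
    rw [← V.muT_preferredLift hu, ← V.muT_preferredLift hu]
    have : realDeriv (fun v => V.muT V.preferredLift v y z) u ξ =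
        realDeriv (fun v => modelForm (V.metricMat v) (V.inFrame y v) (V.inFrame z v)) u ξ := by
      refine realDeriv_congr ξ ?_
      filter_upwards [V.isOpen_preimage_injLocus.mem_nhds hu] with v hv
      exact V.muT_preferredLift hv y z
    rw [← this]
    rfl
  have hd := (V.matDeriv_metricMat hu h).1
  rw [h0]
  simp only [modelForm, wedgeTrace, V.blockBM_inFrame_bracket hu, V.blockBT_inFrame_bracket hu]
  rw [realDeriv_add ξ (RealDiffAt.trace ((hz1.transpose.mul hM).mul hy1))
    (RealDiffAt.mul mdifferentiableAt_const
      (RealDiffAt.trace (((hy2.transpose.mul hM).mul hz2).mul hM))),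
    realDeriv_mul ξ mdifferentiableAt_const
      (RealDiffAt.trace (((hy2.transpose.mul hM).mul hz2).mul hM)),
    realDeriv_const, zero_mul, zero_add, realDeriv_trace ξ ((hz1.transpose.mul hM).mul hy1),
    realDeriv_trace ξ (((hy2.transpose.mul hM).mul hz2).mul hM),
    matDeriv_mul ξ (hz1.transpose.mul hM) hy1, matDeriv_mul ξ hz1.transpose hM,
    matDeriv_mul ξ ((hy2.transpose.mul hM).mul hz2) hM, matDeriv_mul ξ (hy2.transpose.mul hM) hz2,
    matDeriv_mul ξ hy2.transpose hM, matDeriv_transpose, matDeriv_transpose, hd]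
  generalize matDeriv (fun v => blockBM (V.inFrame y v)) u ξ = dh
  generalize matDeriv (fun v => blockBT (V.inFrame y v)) u ξ = dg
  generalize matDeriv (fun v => blockBM (V.inFrame z v)) u ξ = dh'
  generalize matDeriv (fun v => blockBT (V.inFrame z v)) u ξ = dg'
  generalize blockBM (V.inFrame y u) = hh
  generalize blockBM (V.inFrame z u) = hh'
  generalize blockBT (V.inFrame y u) = g
  generalize blockBT (V.inFrame z u) = g'
  generalize blockTT (V.gaugedForm u ξ) = a
  generalize V.metricMat u = m
  -- In the $H \wedge H$ part everything cancels as matrices except these two products, which agree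
  -- only under the trace.
  have hc : (aᵀ * gᵀ * m * g' * m).trace = (gᵀ * m * g' * m * aᵀ).trace := by
    rw [Matrix.mul_assoc, Matrix.mul_assoc, Matrix.mul_assoc, Matrix.trace_mul_comm]
    simp only [Matrix.mul_assoc]
  simp only [Matrix.transpose_sub, Matrix.transpose_add, Matrix.transpose_mul,
    Matrix.transpose_transpose, Matrix.mul_add, Matrix.add_mul, Matrix.sub_mul, Matrix.mul_sub,
    Matrix.mul_neg, Matrix.neg_mul, Matrix.trace_add, Matrix.trace_sub, Matrix.trace_neg,
    ← Matrix.mul_assoc, neg_add, hc]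
  ring

/-- Here the rho-tensor becomes algebraic in $m$: preservation expresses the blocks of positive
degree of the gauged connection through those of negative degree, and the latter are blocks of $y$
in the frame. -/
theorem rho_eq (hu : u ∈ G.proj ⁻¹' V.injLocus) (h : ∀ ξ, V.IsPreservedAt u ξ) {y : TMat n}
    (hy : y ∈ soAlg n) : G.rho V.preferredLift u y =
      V.frame u * modelRho (V.metricMat u) (V.inFrame y u) * V.frameInv u := by
  rw [V.rho_preferredLift hu hy, (V.preserved_equations hu (h _)).2, (V.matDeriv_metricMat hu (h _)).2,
    blockBT_gaugedForm, blockBM_gaugedForm, G.form_vec u hy]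
  rfl

/-- The rho-tensor is differentiated, so its algebraic formula is needed near $u$ and not only at
$u$; therefore preservation is required at all points over the locus. The rest is $\nabla m = 0$ and
the Leibniz rule. -/
theorem nablaRho_eq_zero (hu : u ∈ G.proj ⁻¹' V.injLocus)
    (h : ∀ v ∈ G.proj ⁻¹' V.injLocus, ∀ ξ, V.IsPreservedAt v ξ) (ξ : TangentSpace 𝓘(ℝ, EP) u)
    {y : TMat n} (hy : y ∈ soAlg n) : G.nablaRho V.preferredLift u ξ y = 0 := by
  have hM := V.matDiffAt_metricMat hu
  have hy1 := V.matDiffAt_blockBM_inFrame hu y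
  have hy2 := V.matDiffAt_blockBT_inFrame hu y
  have hd := (V.matDeriv_metricMat hu (h u hu ξ)).1
  have hMs := V.smoothOn_metricMat
  have hRd : MatDiffAt EP (fun v => modelRho (V.metricMat v) (V.inFrame y v)) u := by
    have h1 : MatSmoothOn 𝓘(ℝ, EP) (fun v => V.metricMat v * blockBM (V.inFrame y v))
        (G.proj ⁻¹' V.injLocus) := hMs.mul fun i j => V.smoothOn_inFrame y _ _
    have h2 : MatSmoothOn 𝓘(ℝ, EP) (fun v => V.metricMat v * blockBT (V.inFrame y v) * V.metricMat v)
        (G.proj ⁻¹' V.injLocus) := (hMs.mul fun i j => V.smoothOn_inFrame y _ _).mul hMs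
    exact (MatSmoothOn.ofBlocks (MatSmoothOn.const _) h1.neg h2 (MatSmoothOn.const _)
      (MatSmoothOn.const _) h1.neg.transpose.neg (MatSmoothOn.const _) (MatSmoothOn.const _)
      (MatSmoothOn.const _)).diffAt V.isOpen_preimage_injLocus hu
  have hRder : matDeriv (fun v => modelRho (V.metricMat v) (V.inFrame y v)) u ξ =
      positivePart (matDeriv (fun v => -(V.metricMat v * blockBM (V.inFrame y v))) u ξ)
        (matDeriv (fun v => V.metricMat v * blockBT (V.inFrame y v) * V.metricMat v) u ξ) := by
    have h1 := matDeriv_ofBlocks ξ (fun _ => (0 : Matrix (Fin n) (Fin n) ℝ))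
      (fun v => V.metricMat v * blockBT (V.inFrame y v) * V.metricMat v) (fun _ => 0) (fun _ => 0)
      (fun v => -(V.metricMat v * blockBM (V.inFrame y v))) (fun _ => 0) (fun _ => 0)
      (fun v => -(-(V.metricMat v * blockBM (V.inFrame y v)))ᵀ) (fun _ => 0)
    rw [matDeriv_neg (f := fun v => (-(V.metricMat v * blockBM (V.inFrame y v)))ᵀ) ξ
      fun i j => (hMs.mul (g := fun v => blockBM (V.inFrame y v))
        fun i j => V.smoothOn_inFrame y _ _).neg.diffAt V.isOpen_preimage_injLocus hu j i] at h1
    simp only [matDeriv_const] at h1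
    exact h1
  have h0 : dMat (fun v => G.rho V.preferredLift v y) u ξ =
      V.frame u * (V.frameDeriv u ξ * modelRho (V.metricMat u) (V.inFrame y u) +
        matDeriv (fun v => modelRho (V.metricMat v) (V.inFrame y v)) u ξ -
        modelRho (V.metricMat u) (V.inFrame y u) * V.frameDeriv u ξ) * V.frameInv u := by
    have h1 : dMat (fun v => G.rho V.preferredLift v y) u ξ =
        matDeriv (fun v => V.frame v * modelRho (V.metricMat v) (V.inFrame y v) * V.frameInv v) u ξ := by
      refine (show _ = matDeriv (fun v => G.rho V.preferredLift v y) u ξ from rfl).trans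
        (matDeriv_congr ξ ?_)
      filter_upwards [V.isOpen_preimage_injLocus.mem_nhds hu] with v hv
      exact V.rho_eq hv (h v hv) hy
    rw [h1, matDeriv_mul ξ ((V.matDiffAt_frame hu).mul hRd) (V.matDiffAt_frameInv hu),
      matDeriv_mul ξ (V.matDiffAt_frame hu) hRd, matDeriv_frame, matDeriv_frameInv _ _ hu]
    noncomm_ring
  have hw := V.weylForm_mem_soAlg hu ξ
  rw [nablaRho, h0, V.rho_eq hu (h u hu) hy, V.rho_eq hu (h u hu) (bracket_mem_soAlg hw hy),
    hRder]
  have hR : modelRho (V.metricMat u) (V.inFrame y u) =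
    positivePart (-(V.metricMat u * blockBM (V.inFrame y u)))
      (V.metricMat u * blockBT (V.inFrame y u) * V.metricMat u) := rfl
  -- The statement in the adapted frame, where only the degree-zero part of the connection acts; the
  -- logarithmic derivative of the frame cancels separately at the end.
  have hfin : positivePart (matDeriv (fun v => -(V.metricMat v * blockBM (V.inFrame y v))) u ξ)
        (matDeriv (fun v => V.metricMat v * blockBT (V.inFrame y v) * V.metricMat v) u ξ) +
      (levi (blockTT (V.gaugedForm u ξ)) * modelRho (V.metricMat u) (V.inFrame y u) -
        modelRho (V.metricMat u) (V.inFrame y u) * levi (blockTT (V.gaugedForm u ξ))) -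
      modelRho (V.metricMat u) (V.inFrame ⁅G.weylForm V.preferredLift u ξ, y⁆ u) = 0 := by
    rw [hR, levi_bracket_positivePart, modelRho, V.blockBM_inFrame_bracket hu,
      V.blockBT_inFrame_bracket hu, matDeriv_neg ξ (hM.mul hy1), matDeriv_mul ξ hM hy1,
      matDeriv_mul ξ (hM.mul hy2) hM, matDeriv_mul ξ hM hy2, hd, positivePart_add, positivePart_sub]
    have z1 : positivePart (0 : Matrix (Fin n) Unit ℝ) 0 = 0 := by
      simp [positivePart, zero_eq_ofBlocks]
    rw [← z1]
    congr 1
    · simp only [Matrix.add_mul, Matrix.mul_sub, Matrix.mul_neg, Matrix.neg_mul,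
        ← Matrix.mul_assoc]
      abel
    · noncomm_ring
  rw [sub_eq_zero] at hfin
  rw [← hfin, V.weylForm_preferredLift hu, Ring.lie_def]
  have h1 : ∀ x, V.frameInv u * (V.frame u * x) = x := fun x => by
    rw [← Matrix.mul_assoc, V.frameInv_mul_frame, Matrix.one_mul]
  simp only [Matrix.mul_sub, Matrix.sub_mul, Matrix.mul_add, Matrix.add_mul, Matrix.mul_assoc, h1]
  abel

/-! ### The components of the rho-tensor -/

section Components

theorem inFrame_gradeComp (k : ℤ) (y : TMat n) :
    V.inFrame (gradeComp (V.preferredLift u) k y) u = gradeComp (gradingElt n) k (V.inFrame y u) := by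
  rw [gradeComp_preferredLift, inFrame, frameInv_conj_frame]
  rfl

theorem gradeComp_neg_one_mem_soAlg {y : TMat n} (hy : y ∈ soAlg n) :
    gradeComp (V.preferredLift u) (-1) y ∈ soAlg n := by
  rw [gradeComp_preferredLift]
  refine V.conj_frameInv_mem_soAlg ?_
  rw [eq_ofBlocks_of_mem_soAlg (V.conj_frame_mem_soAlg hy), gradeComp_gradingElt_neg_one]
  simpa using ofBlocks_mem_soAlg (a := 0) (b := 0) (c := 0) (g := 0)
    (h := blockBM (V.frameInv u * y * V.frame u)) (by simp) (by simp)

theorem gradeComp_neg_two_mem_soAlg {y : TMat n} (hy : y ∈ soAlg n) :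
    gradeComp (V.preferredLift u) (-2) y ∈ soAlg n := by
  rw [gradeComp_preferredLift]
  refine V.conj_frameInv_mem_soAlg ?_
  rw [eq_ofBlocks_of_mem_soAlg (V.conj_frame_mem_soAlg hy), gradeComp_gradingElt_neg_two]
  simpa using ofBlocks_mem_soAlg (a := 0) (b := 0) (c := 0) (h := 0) (by simp)
    (blockBT_transpose (V.conj_frame_mem_soAlg hy))

theorem rho_gradeComp_neg_one (hu : u ∈ G.proj ⁻¹' V.injLocus) (h : ∀ ξ, V.IsPreservedAt u ξ)
    {y : TMat n} (hy : y ∈ soAlg n) :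
    G.rho V.preferredLift u (gradeComp (V.preferredLift u) (-1) y) =
      V.frame u * positivePart (-(V.metricMat u * blockBM (V.inFrame y u))) 0 * V.frameInv u := by
  rw [V.rho_eq hu h (V.gradeComp_neg_one_mem_soAlg hy), inFrame_gradeComp, modelRho]
  obtain ⟨a, b', c', d, e, f, g, k, l, hy⟩ := exists_eq_ofBlocks (V.inFrame y u)
  rw [hy, gradeComp_gradingElt_neg_one]
  have : blockBT (ofBlocks 0 0 0 d 0 0 0 k 0) = (0 : Matrix (Fin n) (Fin n) ℝ) := rfl
  rw [this, Matrix.mul_zero, Matrix.zero_mul]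
  rfl

theorem rho_gradeComp_neg_two (hu : u ∈ G.proj ⁻¹' V.injLocus) (h : ∀ ξ, V.IsPreservedAt u ξ)
    {y : TMat n} (hy : y ∈ soAlg n) :
    G.rho V.preferredLift u (gradeComp (V.preferredLift u) (-2) y) =
      V.frame u * positivePart 0 (V.metricMat u * blockBT (V.inFrame y u) * V.metricMat u) *
        V.frameInv u := by
  rw [V.rho_eq hu h (V.gradeComp_neg_two_mem_soAlg hy), inFrame_gradeComp, modelRho]
  obtain ⟨a, b', c', d, e, f, g, k, l, hy⟩ := exists_eq_ofBlocks (V.inFrame y u)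
  rw [hy, gradeComp_gradingElt_neg_two]
  have : blockBM (ofBlocks 0 0 0 0 0 0 g 0 0) = (0 : Matrix (Fin n) Unit ℝ) := rfl
  rw [this, Matrix.mul_zero, neg_zero]
  rfl

theorem covTwo_rho_neg_one (hu : u ∈ G.proj ⁻¹' V.injLocus) (h : ∀ ξ, V.IsPreservedAt u ξ)
    {y : TMat n} (hy : y ∈ soAlg n) (X X' : Fin n → ℝ) :
    covTwo (V.preferredLift u)
      (G.rho V.preferredLift u (gradeComp (V.preferredLift u) (-1) y)) X X' = 0 := by
  rw [V.rho_gradeComp_neg_one hu h hy, preferredLift, frame, frameInv, covTwo_conj_positivePart]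
  simp

theorem covOne_rho_neg_two (hu : u ∈ G.proj ⁻¹' V.injLocus) (h : ∀ ξ, V.IsPreservedAt u ξ)
    {y : TMat n} (hy : y ∈ soAlg n) :
    covOne (G.rho V.preferredLift u (gradeComp (V.preferredLift u) (-2) y)) = 0 := by
  rw [V.rho_gradeComp_neg_two hu h hy, frame, frameInv, covOne_conj_positivePart]
  rfl

theorem covOne_rho_neg_one (hu : u ∈ G.proj ⁻¹' V.injLocus) (h : ∀ ξ, V.IsPreservedAt u ξ)
    {y : TMat n} (hy : y ∈ soAlg n) :
    covOne (G.rho V.preferredLift u (gradeComp (V.preferredLift u) (-1) y)) =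
      -V.mu V.preferredLift u (tanOne (V.preferredLift u) y) := by
  rw [V.rho_gradeComp_neg_one hu h hy, frame, frameInv, covOne_conj_positivePart,
    V.mu_preferredLift hu, tanOne_preferredLift]
  rfl

theorem covTwo_rho_neg_two (hu : u ∈ G.proj ⁻¹' V.injLocus) (h : ∀ ξ, V.IsPreservedAt u ξ)
    {y : TMat n} (hy : y ∈ soAlg n) (X X' : Fin n → ℝ) :
    covTwo (V.preferredLift u)
      (G.rho V.preferredLift u (gradeComp (V.preferredLift u) (-2) y)) X X' =
      -wedgeForm (V.muH V.preferredLift u) (tanTwo (V.preferredLift u) y) (bivector X X') := by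
  rw [V.rho_gradeComp_neg_two hu h hy, frame, frameInv, preferredLift, covTwo_conj_positivePart,
    ← preferredLift, tanTwo_preferredLift,
    wedgeForm_eq_wedgeTrace (V.metricMat_transpose u) (V.muH_preferredLift hu)]
  have hg := blockBT_transpose (V.inFrame_mem_soAlg (u := u) hy)
  have hm := V.metricMat_transpose u
  generalize blockBT (V.inFrame y u) = g at hg ⊢
  generalize V.metricMat u = m at hm ⊢
  have hB : bivector X X' = Matrix.vecMulVec X' X - Matrix.vecMulVec X X' := by
    ext i j
    simp [bivector, Matrix.vecMulVec_apply]
  -- A bivector is a difference of two matrices of rank one, and against such a matrix the trace is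
  -- a single pairing.
  have key : ∀ v w : Fin n → ℝ, (gᵀ * m * Matrix.vecMulVec v w * m).trace =
      -(w ⬝ᵥ ((m * g * m) *ᵥ v)) := by
    intro v w
    rw [Matrix.mul_assoc, Matrix.vecMulVec_mul, Matrix.mul_vecMulVec, Matrix.trace_vecMulVec, hg,
      dotProduct_comm, ← Matrix.dotProduct_mulVec, Matrix.mulVec_mulVec, ← Matrix.mul_assoc]
    simp [Matrix.neg_mulVec]
  -- Skewness of $mgm$ makes the two contributions equal, which absorbs the factor ½ of
  -- `wedgeTrace`.
  have hskew : X ⬝ᵥ ((m * g * m) *ᵥ X') = -(X' ⬝ᵥ ((m * g * m) *ᵥ X)) := by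
    have hA : (m * g * m)ᵀ = -(m * g * m) := by
      rw [Matrix.transpose_mul, Matrix.transpose_mul, hg, hm]
      noncomm_ring
    rw [Matrix.dotProduct_mulVec, ← Matrix.mulVec_transpose, hA, Matrix.neg_mulVec, neg_dotProduct,
      dotProduct_comm]
  rw [wedgeTrace, hB, Matrix.mul_sub, Matrix.sub_mul, Matrix.trace_sub, key, key, hskew]
  ring

end Components

end TractorSubbundle

end CartanGeometry

end Preserved

/-! ### One-parameter subgroups of P -/

section ParabolicCurves

variable {n : ℕ}

theorem hBlock_pmat_mulVec_of_hBlock (p : Parabolic n) {t : TVec n} (ht : hBlock t = 0) :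
    hBlock (pmat p *ᵥ t) = 0 := (hBlock_pmat_mulVec_eq_zero p).2 ht

theorem pmat_bt (p : Parabolic n) (i j : Fin n) :
    pmat p (Sum.inr (Sum.inr i)) (Sum.inl j) = 0 := by
  have h : hBlock (Pi.single (Sum.inl j) 1 : TVec n) = 0 := by
    ext i
    simp [hBlock]
  have := congrFun (hBlock_pmat_mulVec_of_hBlock p h) i
  simpa [hBlock] using this

theorem pmat_bm (p : Parabolic n) (i : Fin n) (u : Unit) :
    pmat p (Sum.inr (Sum.inr i)) (Sum.inr (Sum.inl u)) = 0 := by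
  have h : hBlock (Pi.single (Sum.inr (Sum.inl u)) 1 : TVec n) = 0 := by
    ext i
    simp [hBlock]
  have := congrFun (hBlock_pmat_mulVec_of_hBlock p h) i
  simpa [hBlock] using this

/-- The level of an index in the filtration. -/
def level : TIdx n → ℕ
  | Sum.inl _ => 0
  | Sum.inr (Sum.inl _) => 1
  | Sum.inr (Sum.inr _) => 2

theorem inTop_mulVec_of_blockTriangular {g : TMat n} (hg : g.BlockTriangular level) {t : TVec n}
    (ht : InTop t) : InTop (g *ᵥ t) := by
  obtain ⟨a, b, c, d, e, f, g', h, k, rfl⟩ := exists_eq_ofBlocks g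
  have hd : d = 0 := by
    ext i j
    exact hg (i := Sum.inr (Sum.inl i)) (j := Sum.inl j) (by simp [level])
  have hg' : g' = 0 := by
    ext i j
    exact hg (i := Sum.inr (Sum.inr i)) (j := Sum.inl j) (by simp [level])
  have h0 : (fun _ : Unit => midCoord t) = 0 := by ext; simp [ht.1]
  constructor
  · rw [midCoord_ofBlocks_mulVec, hd, ht.2, h0]; simp
  · rw [hBlock_ofBlocks_mulVec, hg', ht.2, h0]; simp

/-- Skewness says that $y^T$ is the conjugate of $-y$ by $J$, so $\exp(y)^T$ is the conjugate of
$\exp(-y)$. -/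
theorem exp_isometry {y : TMat n} (hy : y ∈ soAlg n) :
    (NormedSpace.exp y)ᵀ * Jmat n * NormedSpace.exp y = Jmat n := by
  have hJ : (Jmat n)⁻¹ = Jmat n := Matrix.inv_eq_left_inv Jmat_mul_self
  have hu : IsUnit (Jmat n) := IsUnit.of_mul_eq_one _ Jmat_mul_self
  have h1 : yᵀ = Jmat n * -y * (Jmat n)⁻¹ := by
    rw [hJ, Matrix.mul_neg, ← eq_neg_of_add_eq_zero_left (mem_soAlg_iff.1 hy), Matrix.mul_assoc,
      Jmat_mul_self, Matrix.mul_one]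
  rw [← Matrix.exp_transpose, h1, Matrix.exp_conj _ _ hu, hJ]
  calc Jmat n * NormedSpace.exp (-y) * Jmat n * Jmat n * NormedSpace.exp y
      = Jmat n * NormedSpace.exp (-y) * (Jmat n * Jmat n) * NormedSpace.exp y := by noncomm_ring
    _ = Jmat n * (NormedSpace.exp (-y) * NormedSpace.exp y) := by
      rw [Jmat_mul_self]; noncomm_ring
    _ = Jmat n := by
      rw [← Matrix.exp_add_of_commute _ _ (Commute.neg_left (Commute.refl y)), neg_add_cancel,
        NormedSpace.exp_zero, Matrix.mul_one]

/-- $\exp y$ is the square of the isometry $\exp(y/2)$, whose determinant squares to 1. -/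
theorem det_exp_eq_one {y : TMat n} (hy : y ∈ soAlg n) : (NormedSpace.exp y).det = 1 := by
  have h1 : NormedSpace.exp y =
      NormedSpace.exp ((1 / 2 : ℝ) • y) * NormedSpace.exp ((1 / 2 : ℝ) • y) := by
    rw [← Matrix.exp_add_of_commute _ _ (Commute.refl _), ← add_smul]
    norm_num
  have h2 := congrArg Matrix.det (exp_isometry ((soAlg n).smul_mem (1 / 2 : ℝ) hy))
  rw [Matrix.det_mul, Matrix.det_mul, Matrix.det_transpose] at h2
  have h3 : (Jmat n).det ≠ 0 := by
    have := congrArg Matrix.det (Jmat_mul_self (n := n))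
    rw [Matrix.det_mul, Matrix.det_one] at this
    exact left_ne_zero_of_mul_eq_one this
  rw [h1, Matrix.det_mul]
  exact mul_right_cancel₀ h3 (by rw [one_mul]; linarith)

theorem blockTriangular_of_mem_soAlg {y : TMat n} (hy : y ∈ soAlg n) (h1 : blockBT y = 0)
    (h2 : blockBM y = 0) : y.BlockTriangular level := by
  rw [eq_ofBlocks_of_mem_soAlg hy, h1, h2]
  rintro (i | i | i) (j | j | j) hij <;> simp [level] at hij ⊢

/-- The exponential of an element of `𝔭`. -/
noncomputable def expParabolic {y : TMat n} (hy : y ∈ soAlg n) (h1 : blockBT y = 0)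
    (h2 : blockBM y = 0) : Parabolic n :=
  have e1 : NormedSpace.exp y * NormedSpace.exp (-y) = 1 := by
    rw [← Matrix.exp_add_of_commute _ _ (Commute.neg_right (Commute.refl y)), add_neg_cancel,
      NormedSpace.exp_zero]
  have e2 : NormedSpace.exp (-y) * NormedSpace.exp y = 1 := mul_eq_one_comm.1 e1
  -- Block triangularity passes to $\exp(\pm y)$, so both this matrix and its inverse map the
  -- isotropic plane into itself.
  have t := blockTriangular_of_mem_soAlg hy h1 h2
  ⟨⟨NormedSpace.exp y, NormedSpace.exp (-y), e1, e2⟩, exp_isometry hy, det_exp_eq_one hy, fun s =>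
    ⟨fun hs => by
      have := inTop_mulVec_of_blockTriangular t.neg.exp hs
      rwa [Matrix.mulVec_mulVec, e2, Matrix.one_mulVec] at this,
    fun hs => inTop_mulVec_of_blockTriangular t.exp hs⟩⟩

theorem contDiff_exp_smul (y : TMat n) (i j : TIdx n) :
    ContDiff ℝ ∞ (fun r : ℝ => NormedSpace.exp (r • y) i j) ∧
      deriv (fun r : ℝ => NormedSpace.exp (r • y) i j) 0 = y i j := by
  -- An auxiliary norm, used for the calculus of the exponential; the statement concerns entries
  -- only.
  let _ : NormedRing (TMat n) := Matrix.linftyOpNormedRing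
  let _ : NormedAlgebra ℝ (TMat n) := Matrix.linftyOpNormedAlgebra
  let ℓ : TMat n →L[ℝ] ℝ := LinearMap.toContinuousLinearMap (Matrix.entryLinearMap ℝ ℝ i j)
  have h1 : ContDiff ℝ ∞ (NormedSpace.exp : TMat n → TMat n) :=
    contDiff_iff_contDiffAt.2 fun x => (NormedSpace.exp_analytic (𝕂 := ℝ) x).contDiffAt
  have h2 : HasDerivAt (fun r : ℝ => NormedSpace.exp (r • y)) y 0 := by
    have := hasDerivAt_exp_smul_const (𝕂 := ℝ) y (0 : ℝ)
    rwa [zero_smul, NormedSpace.exp_zero, one_mul] at this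
  refine ⟨ℓ.contDiff.comp (h1.comp (contDiff_id.smul contDiff_const)), ?_⟩
  exact (ℓ.hasFDerivAt.comp_hasDerivAt (0 : ℝ) h2).deriv

end ParabolicCurves

/-! ### Vertical vectors and the kernel of the differential of the projection -/

section Vertical

variable {n : ℕ} {EM EP M Q : Type*}
  [NormedAddCommGroup EM] [NormedSpace ℝ EM] [NormedAddCommGroup EP] [NormedSpace ℝ EP]
  [TopologicalSpace M] [ChartedSpace EM M] [IsManifold 𝓘(ℝ, EM) ∞ M]
  [TopologicalSpace Q] [ChartedSpace EP Q] [IsManifold 𝓘(ℝ, EP) ∞ Q]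

namespace CartanGeometry

variable (G : CartanGeometry n EM EP M Q)

/-- The differential of the projection. -/
noncomputable abbrev dproj (u : Q) : TangentSpace 𝓘(ℝ, EP) u →L[ℝ] TangentSpace 𝓘(ℝ, EM) (G.proj u) :=
  mfderiv 𝓘(ℝ, EP) 𝓘(ℝ, EM) G.proj u

theorem mdifferentiableAt_proj (u : Q) : MDifferentiableAt 𝓘(ℝ, EP) 𝓘(ℝ, EM) G.proj u :=
  G.contMDiff_proj.mdifferentiable (by simp) u

theorem contMDiff_act_curve (f : ℝ → Parabolic n) (hf : ∀ i j, ContDiff ℝ ∞ fun r => pmat (f r) i j) :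
    ContMDiff (𝓘(ℝ, EP).prod 𝓘(ℝ, ℝ)) 𝓘(ℝ, EP) ∞ fun q : Q × ℝ => G.act q.1 (f q.2) := by
  have h1 := G.contMDiff_act 1 (fun x => f (x 0)) fun i j => (hf i j).comp (contDiff_apply ℝ ℝ 0)
  have h2 : ContMDiff 𝓘(ℝ, ℝ) 𝓘(ℝ, Fin 1 → ℝ) ∞ (fun r : ℝ => fun _ : Fin 1 => r) :=
    (contDiff_pi.2 fun _ => contDiff_id).contMDiff
  exact h1.comp (contMDiff_fst.prodMk (h2.comp contMDiff_snd))

theorem contMDiff_act_const (p : Parabolic n) :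
    ContMDiff 𝓘(ℝ, EP) 𝓘(ℝ, EP) ∞ fun v => G.act v p := by
  have h1 := G.contMDiff_act_curve (fun _ => p) fun i j => contDiff_const
  exact h1.comp (contMDiff_id.prodMk (contMDiff_const (c := (0 : ℝ))))

theorem contMDiff_orbit (u : Q) (f : ℝ → Parabolic n)
    (hf : ∀ i j, ContDiff ℝ ∞ fun r => pmat (f r) i j) :
    ContMDiff 𝓘(ℝ, ℝ) 𝓘(ℝ, EP) ∞ fun r => G.act u (f r) :=
  (G.contMDiff_act_curve f hf).comp (contMDiff_const.prodMk contMDiff_id)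

/-- The orbit of $u$ under the one-parameter group of $y$ stays in one fibre, and its velocity is
the fundamental vector, on which $\omega$ takes the value $y$. -/
theorem dproj_vec_eq_zero (u : Q) {y : TMat n} (hy : y ∈ soAlg n) (h1 : blockBT y = 0)
    (h2 : blockBM y = 0) : G.dproj u (G.vec u y) = 0 := by
  have hlin : ∀ r : ℝ, blockBT (r • y) = 0 ∧ blockBM (r • y) = 0 := fun r => by
    have e1 : blockBT (r • y) = r • blockBT y := rfl
    have e2 : blockBM (r • y) = r • blockBM y := rfl
    rw [e1, e2, h1, h2, smul_zero, smul_zero]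
    exact ⟨rfl, rfl⟩
  let c : ℝ → Parabolic n := fun r =>
    expParabolic ((soAlg n).smul_mem r hy) (hlin r).1 (hlin r).2
  have hc : ∀ i j, ContDiff ℝ ∞ fun r => pmat (c r) i j := fun i j => (contDiff_exp_smul y i j).1
  have hc0 : c 0 = 1 := by
    apply Subtype.ext
    apply Units.ext
    change NormedSpace.exp ((0 : ℝ) • y) = 1
    rw [zero_smul, NormedSpace.exp_zero]
  -- The vector is hidden behind an existential at the point `act u (c 0)`, so that the base point
  -- can be rewritten to `u` without transporting a tangent vector.
  have key : ∃ ξ : TangentSpace 𝓘(ℝ, EP) (G.act u (c 0)),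
      G.form (G.act u (c 0)) ξ = y ∧ G.dproj (G.act u (c 0)) ξ = 0 := by
    refine ⟨mfderiv 𝓘(ℝ, ℝ) 𝓘(ℝ, EP) (fun r => G.act u (c r)) 0 (1 : ℝ), ?_, ?_⟩
    · ext i j
      exact (G.conn_fundamental u c hc hc0 i j).trans (contDiff_exp_smul y i j).2
    · have h3 := mfderiv_comp_apply (I := 𝓘(ℝ, ℝ)) (I' := 𝓘(ℝ, EP)) (I'' := 𝓘(ℝ, EM))
        (g := G.proj) (f := fun r => G.act u (c r)) (0 : ℝ) (G.mdifferentiableAt_proj _)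
        ((G.contMDiff_orbit u c hc).mdifferentiable (by simp) 0) (1 : ℝ)
      have h4 : G.proj ∘ (fun r => G.act u (c r)) = fun _ => G.proj u := by
        ext r
        exact G.proj_act u (c r)
      rw [← h3, h4, mfderiv_const]
      rfl
  rw [hc0, G.act_one] at key
  obtain ⟨ξ, hξ, h3⟩ := key
  rw [← hξ, G.vec_form]
  exact h3

theorem exists_section_through (u : Q) : ∃ (W : Set M) (σ : M → Q), IsOpen W ∧ G.proj u ∈ W ∧
    ContMDiffOn 𝓘(ℝ, EM) 𝓘(ℝ, EP) ∞ σ W ∧ (∀ y ∈ W, G.proj (σ y) = y) ∧ σ (G.proj u) = u := by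
  obtain ⟨W, hW, hx, σ, φ, hσ, -, hσp, hσφ⟩ := G.local_triv (G.proj u)
  refine ⟨W, fun y => G.act (σ y) (φ u), hW, hx, ?_, fun y hy => ?_, hσφ u hx⟩
  · exact (G.contMDiff_act_const (φ u)).comp_contMDiffOn hσ
  · rw [G.proj_act, hσp y hy]

theorem dproj_section {W : Set M} {σ : M → Q} (hW : IsOpen W)
    (hσ : ContMDiffOn 𝓘(ℝ, EM) 𝓘(ℝ, EP) ∞ σ W) (hσp : ∀ y ∈ W, G.proj (σ y) = y) {x : M}
    (hx : x ∈ W) (a : TangentSpace 𝓘(ℝ, EM) x) :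
    (G.dproj (σ x) (mfderiv 𝓘(ℝ, EM) 𝓘(ℝ, EP) σ x a) : EM) = a := by
  have h1 : MDifferentiableAt 𝓘(ℝ, EM) 𝓘(ℝ, EP) σ x :=
    (hσ.contMDiffAt (hW.mem_nhds hx)).mdifferentiableAt (by simp)
  have h2 := mfderiv_comp_apply (I'' := 𝓘(ℝ, EM)) x (G.mdifferentiableAt_proj (σ x)) h1 a
  have h3 : G.proj ∘ σ =ᶠ[nhds x] id := by
    filter_upwards [hW.mem_nhds hx] with y hy
    exact hσp y hy
  refine h2.symm.trans ?_
  have h4 := h3.mfderiv_eq (I := 𝓘(ℝ, EM)) (I' := 𝓘(ℝ, EM))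
  rw [mfderiv_id] at h4
  exact congrArg (fun L : EM →L[ℝ] EM => L a) h4

theorem dproj_surjective (u : Q) : Function.Surjective (G.dproj u) := by
  intro a
  obtain ⟨W, σ, hW, hx, hσ, hσp, hσu⟩ := G.exists_section_through u
  have h := G.dproj_section hW hσ hσp hx a
  have key : ∃ ξ : TangentSpace 𝓘(ℝ, EP) (σ (G.proj u)), (G.dproj (σ (G.proj u)) ξ : EM) = a :=
    ⟨_, h⟩
  rw [hσu] at key
  exact key

/-- Multiplied by $f(0)^{-1}$, the curve starts at the identity and its orbit through $v$ is the
same. The value of $\omega$ is then the derivative of a curve in $P$, whose blocks below the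
diagonal vanish identically. -/
theorem blocks_form_orbit (u v : Q) (f : ℝ → Parabolic n)
    (hf : ∀ i j, ContDiff ℝ ∞ fun r => pmat (f r) i j) (hv : G.act u (f 0) = v)
    (ξ : TangentSpace 𝓘(ℝ, EP) v)
    (hξ : (mfderiv 𝓘(ℝ, ℝ) 𝓘(ℝ, EP) (fun r => G.act u (f r)) 0 (1 : ℝ) : EP) = ξ) :
    blockBT (G.form v ξ) = 0 ∧ blockBM (G.form v ξ) = 0 := by
  let c : ℝ → Parabolic n := fun r => (f 0)⁻¹ * f r
  have hc : ∀ i j, ContDiff ℝ ∞ fun r => pmat (c r) i j := by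
    intro i j
    have : ∀ r, pmat (c r) i j = ∑ k, pmat (f 0)⁻¹ i k * pmat (f r) k j := fun r => by
      rw [pmat_mul, Matrix.mul_apply]
    simp only [this]
    exact ContDiff.sum fun k _ => contDiff_const.mul (hf k j)
  have hc0 : c 0 = 1 := inv_mul_cancel _
  have hact : ∀ r, G.act v (c r) = G.act u (f r) := fun r => by
    rw [← hv, ← G.act_mul, mul_inv_cancel_left]
  have key : ∀ i j, G.form (G.act v (c 0))
      (mfderiv 𝓘(ℝ, ℝ) 𝓘(ℝ, EP) (fun r => G.act v (c r)) 0 (1 : ℝ)) i j =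
        deriv (fun r => pmat (c r) i j) 0 := fun i j => G.conn_fundamental v c hc hc0 i j
  have hcongr : ∀ (w : Q) (ζ : TangentSpace 𝓘(ℝ, EP) w), w = v → (ζ : EP) = ξ →
      G.form w ζ = G.form v ξ := by
    rintro w ζ rfl h
    exact congrArg (G.form w) h
  have hform : G.form (G.act v (c 0))
      (mfderiv 𝓘(ℝ, ℝ) 𝓘(ℝ, EP) (fun r => G.act v (c r)) 0 (1 : ℝ)) = G.form v ξ := by
    refine hcongr _ _ (by rw [hc0, G.act_one]) ?_
    refine Eq.trans ?_ hξ
    exact congrArg (fun g : ℝ → Q => (mfderiv 𝓘(ℝ, ℝ) 𝓘(ℝ, EP) g 0 (1 : ℝ) : EP)) (funext hact)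
  constructor
  · ext i j
    have := key (Sum.inr (Sum.inr i)) (Sum.inl j)
    rw [hform] at this
    simp only [pmat_bt, deriv_const] at this
    exact this
  · ext i j
    have := key (Sum.inr (Sum.inr i)) (Sum.inr (Sum.inl j))
    rw [hform] at this
    simp only [pmat_bm, deriv_const] at this
    exact this

/-- Every tangent vector is, up to scale, the velocity of a curve that stays in a given neighbourhood. -/
theorem exists_curve (u : Q) (ξ : EP) {O : Set Q} (hO : IsOpen O) (hu : u ∈ O) :
    ∃ (γ : ℝ → Q) (ε : ℝ), 0 < ε ∧ ContMDiff 𝓘(ℝ, ℝ) 𝓘(ℝ, EP) ∞ γ ∧ (∀ r, γ r ∈ O) ∧ γ 0 = u ∧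
      (mfderiv 𝓘(ℝ, ℝ) 𝓘(ℝ, EP) γ 0 (1 : ℝ) : EP) = ε • ξ := by
  set e := extChartAt 𝓘(ℝ, EP) u with he
  have hT : IsOpen (e.target ∩ e.symm ⁻¹' O) :=
    (continuousOn_extChartAt_symm u).isOpen_inter_preimage (isOpen_extChartAt_target u) hO
  have hmem : e u ∈ e.target ∩ e.symm ⁻¹' O :=
    ⟨mem_extChartAt_target u, by rw [Set.mem_preimage, extChartAt_to_inv]; exact hu⟩
  obtain ⟨δ, hδ, hball⟩ := Metric.isOpen_iff.1 hT _ hmem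
  set ε := δ / (2 * (‖ξ‖ + 1)) with hε
  have hpos : 0 < ‖ξ‖ + 1 := by positivity
  have hε0 : 0 < ε := by positivity
  -- The sine is bounded by 1 and has derivative 1 at 0, so the curve is defined on the whole line,
  -- never leaves the ball of radius $\delta$ in the chart, and has velocity $\varepsilon\xi$.
  let κ : ℝ → EP := fun r => e u + (Real.sin r * ε) • ξ
  have hκmem : ∀ r, κ r ∈ e.target ∩ e.symm ⁻¹' O := by
    intro r
    refine hball ?_
    rw [Metric.mem_ball, dist_eq_norm, add_sub_cancel_left, norm_smul, Real.norm_eq_abs, abs_mul,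
      abs_of_pos hε0]
    have h1 : |Real.sin r| ≤ 1 := Real.abs_sin_le_one r
    calc |Real.sin r| * ε * ‖ξ‖ ≤ 1 * ε * ‖ξ‖ := by gcongr
      _ ≤ ε * (‖ξ‖ + 1) := by nlinarith [norm_nonneg ξ]
      _ = δ / 2 := by rw [hε]; field_simp
      _ < δ := by linarith
  have hκ : ContDiff ℝ ∞ κ :=
    contDiff_const.add (((Real.contDiff_sin).mul contDiff_const).smul contDiff_const)
  have hκ0 : κ 0 = e u := by simp [κ]
  have hκd : HasDerivAt κ (ε • ξ) 0 := by
    have h1 : HasDerivAt (fun r => Real.sin r * ε) ε 0 := by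
      simpa using (Real.hasDerivAt_sin 0).mul_const ε
    exact (h1.smul_const ξ).const_add (e u)
  refine ⟨fun r => e.symm (κ r), ε, hε0, ?_, fun r => (hκmem r).2, ?_, ?_⟩
  · rw [← contMDiffOn_univ]
    exact (contMDiffOn_extChartAt_symm u).comp hκ.contMDiff.contMDiffOn fun r _ => (hκmem r).1
  · simp only [hκ0, he, extChartAt_to_inv]
  · have h1 : MDifferentiableAt 𝓘(ℝ, EP) 𝓘(ℝ, EP) e.symm (e u) := by
      have := mdifferentiableWithinAt_extChartAt_symm (I := 𝓘(ℝ, EP)) (mem_extChartAt_target u)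
      rwa [ModelWithCorners.range_eq_univ, mdifferentiableWithinAt_univ] at this
    have h2 : (mfderiv 𝓘(ℝ, ℝ) 𝓘(ℝ, EP) (e.symm ∘ κ) 0 (1 : ℝ) : EP) =
        mfderiv 𝓘(ℝ, EP) 𝓘(ℝ, EP) e.symm (e u) (mfderiv 𝓘(ℝ, ℝ) 𝓘(ℝ, EP) κ 0 (1 : ℝ) : EP) :=
      mfderiv_comp_apply_of_eq (I := 𝓘(ℝ, ℝ)) (0 : ℝ) h1
        (hκ.contMDiff.mdifferentiable (by simp) 0) hκ0 (1 : ℝ)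
    have h3 := mfderivWithin_range_extChartAt_symm (I := 𝓘(ℝ, EP)) (x := u)
    rw [ModelWithCorners.range_eq_univ, mfderivWithin_univ] at h3
    have h4 : (mfderiv 𝓘(ℝ, ℝ) 𝓘(ℝ, EP) κ 0 (1 : ℝ) : EP) = ε • ξ := by
      have h5 : (mfderiv 𝓘(ℝ, ℝ) 𝓘(ℝ, EP) κ 0 (1 : ℝ) : EP) = fderiv ℝ κ 0 1 :=
        congrArg (fun L : ℝ →L[ℝ] EP => L 1) (mfderiv_eq_fderiv (f := κ) (x := 0))
      rw [h5, fderiv_apply_one_eq_deriv, hκd.deriv]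
    refine h2.trans ?_
    rw [h4]
    exact congrArg (fun L : EP →L[ℝ] EP => L (ε • ξ)) h3

/-- Tangent vectors to the fibres have values in `𝔭`. -/
theorem blocks_form_of_dproj_eq_zero (u : Q) (ξ : TangentSpace 𝓘(ℝ, EP) u) (h : G.dproj u ξ = 0) :
    blockBT (G.form u ξ) = 0 ∧ blockBM (G.form u ξ) = 0 := by
  obtain ⟨W, hW, hx, σ, φ, hσ, hφ, hσp, hσφ⟩ := G.local_triv (G.proj u)
  obtain ⟨γ, ε, hε, hγ, hγW, hγ0, hγd⟩ := exists_curve (EP := EP) u ξ (G.isOpen_preimage_proj hW) hx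
  -- In the trivialisation $\gamma(r) = \sigma(\pi\gamma(r)) \cdot f(r)$. As $d\pi(\xi) = 0$, the
  -- first factor has velocity zero, so $\gamma$ has the velocity of an orbit curve, to which
  -- `blocks_form_orbit` applies.
  let f : ℝ → Parabolic n := fun r => φ (γ r)
  have hf : ∀ i j, ContDiff ℝ ∞ fun r => pmat (f r) i j := by
    intro i j
    rw [← contMDiff_iff_contDiff, ← contMDiffOn_univ]
    exact (hφ i j).comp hγ.contMDiffOn fun r _ => hγW r
  have hq : G.act (σ (G.proj u)) (f 0) = u := by
    have := hσφ u hx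
    simp only [f, hγ0]
    exact this
  have hτ : ContMDiff 𝓘(ℝ, ℝ) 𝓘(ℝ, EP) ∞ fun r => σ (G.proj (γ r)) := by
    rw [← contMDiffOn_univ]
    exact hσ.comp (G.contMDiff_proj.comp hγ).contMDiffOn fun r _ => hγW r
  have hΨ := G.contMDiff_act_curve f hf
  have hγeq : (fun r => G.act (σ (G.proj (γ r))) (f r)) = γ := funext fun r => hσφ _ (hγW r)
  have hτd : (mfderiv 𝓘(ℝ, ℝ) 𝓘(ℝ, EP) (fun r => σ (G.proj (γ r))) 0 (1 : ℝ) : EP) = 0 := by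
    have h1 : (mfderiv 𝓘(ℝ, ℝ) 𝓘(ℝ, EP) (σ ∘ (G.proj ∘ γ)) 0 (1 : ℝ) : EP) =
        mfderiv 𝓘(ℝ, EM) 𝓘(ℝ, EP) σ (G.proj u)
          (mfderiv 𝓘(ℝ, ℝ) 𝓘(ℝ, EM) (G.proj ∘ γ) 0 (1 : ℝ) : EM) :=
      mfderiv_comp_apply_of_eq (I := 𝓘(ℝ, ℝ)) (0 : ℝ)
        ((hσ.contMDiffAt (hW.mem_nhds hx)).mdifferentiableAt (by simp))
        ((G.contMDiff_proj.comp hγ).mdifferentiable (by simp) 0) (by simp [hγ0]) (1 : ℝ)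
    have h2 : (mfderiv 𝓘(ℝ, ℝ) 𝓘(ℝ, EM) (G.proj ∘ γ) 0 (1 : ℝ) : EM) =
        mfderiv 𝓘(ℝ, EP) 𝓘(ℝ, EM) G.proj u (mfderiv 𝓘(ℝ, ℝ) 𝓘(ℝ, EP) γ 0 (1 : ℝ) : EP) :=
      mfderiv_comp_apply_of_eq (I := 𝓘(ℝ, ℝ)) (0 : ℝ) (G.mdifferentiableAt_proj u)
        (hγ.mdifferentiable (by simp) 0) hγ0 (1 : ℝ)
    have h3 : (mfderiv 𝓘(ℝ, EP) 𝓘(ℝ, EM) G.proj u (ε • ξ : EP) : EM) = 0 := by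
      refine ((G.dproj u).map_smul ε ξ).trans ?_
      rw [h, smul_zero]
    have h4 : (mfderiv 𝓘(ℝ, ℝ) 𝓘(ℝ, EM) (G.proj ∘ γ) 0 (1 : ℝ) : EM) = 0 :=
      h2.trans ((congrArg (fun w : EP => (mfderiv 𝓘(ℝ, EP) 𝓘(ℝ, EM) G.proj u w : EM)) hγd).trans h3)
    exact h1.trans ((congrArg (fun w : EM => (mfderiv 𝓘(ℝ, EM) 𝓘(ℝ, EP) σ (G.proj u) w : EP)) h4).trans
      (mfderiv 𝓘(ℝ, EM) 𝓘(ℝ, EP) σ (G.proj u)).map_zero)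
  -- Chain rule through the action map $Q \times \mathbb R \to Q$: two curves with the same velocity
  -- in the product, one with moving and one with fixed first factor, have images with the same
  -- velocity.
  have hsum : (mfderiv 𝓘(ℝ, ℝ) 𝓘(ℝ, EP) γ 0 (1 : ℝ) : EP) =
      mfderiv 𝓘(ℝ, ℝ) 𝓘(ℝ, EP) (fun r => G.act (σ (G.proj u)) (f r)) 0 (1 : ℝ) := by
    have h1 : (mfderiv 𝓘(ℝ, ℝ) 𝓘(ℝ, EP) ((fun q : Q × ℝ => G.act q.1 (f q.2)) ∘
          fun r => (σ (G.proj (γ r)), r)) 0 (1 : ℝ) : EP) =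
        mfderiv (𝓘(ℝ, EP).prod 𝓘(ℝ, ℝ)) 𝓘(ℝ, EP) (fun q : Q × ℝ => G.act q.1 (f q.2))
          (σ (G.proj u), 0) (mfderiv 𝓘(ℝ, ℝ) (𝓘(ℝ, EP).prod 𝓘(ℝ, ℝ))
            (fun r => (σ (G.proj (γ r)), r)) 0 (1 : ℝ) : EP × ℝ) :=
      mfderiv_comp_apply_of_eq (I := 𝓘(ℝ, ℝ)) (0 : ℝ) (hΨ.mdifferentiable (by simp) _)
        ((hτ.prodMk contMDiff_id).mdifferentiable (by simp) 0) (by simp [hγ0]) (1 : ℝ)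
    have h2 : (mfderiv 𝓘(ℝ, ℝ) 𝓘(ℝ, EP) ((fun q : Q × ℝ => G.act q.1 (f q.2)) ∘
          fun r : ℝ => (σ (G.proj u), r)) 0 (1 : ℝ) : EP) =
        mfderiv (𝓘(ℝ, EP).prod 𝓘(ℝ, ℝ)) 𝓘(ℝ, EP) (fun q : Q × ℝ => G.act q.1 (f q.2))
          (σ (G.proj u), 0) (mfderiv 𝓘(ℝ, ℝ) (𝓘(ℝ, EP).prod 𝓘(ℝ, ℝ))
            (fun r : ℝ => (σ (G.proj u), r)) 0 (1 : ℝ) : EP × ℝ) :=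
      mfderiv_comp_apply_of_eq (I := 𝓘(ℝ, ℝ)) (0 : ℝ) (hΨ.mdifferentiable (by simp) _)
        ((contMDiff_const.prodMk contMDiff_id).mdifferentiable (n := ∞) (by simp) 0) rfl (1 : ℝ)
    have h3 : (mfderiv 𝓘(ℝ, ℝ) (𝓘(ℝ, EP).prod 𝓘(ℝ, ℝ)) (fun r => (σ (G.proj (γ r)), r)) 0
          (1 : ℝ) : EP × ℝ) =
        ((mfderiv 𝓘(ℝ, ℝ) 𝓘(ℝ, EP) (fun r => σ (G.proj (γ r))) 0 (1 : ℝ) : EP),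
          (mfderiv 𝓘(ℝ, ℝ) 𝓘(ℝ, ℝ) (fun r : ℝ => r) 0 (1 : ℝ) : ℝ)) :=
      congrArg (fun L : ℝ →L[ℝ] EP × ℝ => L 1)
        (mfderiv_prodMk (hτ.mdifferentiable (by simp) 0) mdifferentiableAt_id)
    have h4 : (mfderiv 𝓘(ℝ, ℝ) (𝓘(ℝ, EP).prod 𝓘(ℝ, ℝ)) (fun r : ℝ => (σ (G.proj u), r)) 0
          (1 : ℝ) : EP × ℝ) =
        ((mfderiv 𝓘(ℝ, ℝ) 𝓘(ℝ, EP) (fun _ : ℝ => σ (G.proj u)) 0 (1 : ℝ) : EP),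
          (mfderiv 𝓘(ℝ, ℝ) 𝓘(ℝ, ℝ) (fun r : ℝ => r) 0 (1 : ℝ) : ℝ)) :=
      congrArg (fun L : ℝ →L[ℝ] EP × ℝ => L 1)
        (mfderiv_prodMk (I := 𝓘(ℝ, ℝ)) (I' := 𝓘(ℝ, EP)) (I'' := 𝓘(ℝ, ℝ)) (x := (0 : ℝ))
          (f := fun _ : ℝ => σ (G.proj u)) (g := fun r : ℝ => r)
          mdifferentiableAt_const mdifferentiableAt_id)
    have h5 : (mfderiv 𝓘(ℝ, ℝ) 𝓘(ℝ, EP) (fun _ : ℝ => σ (G.proj u)) 0 (1 : ℝ) : EP) = 0 :=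
      congrArg (fun L : ℝ →L[ℝ] EP => L 1) (mfderiv_const (c := σ (G.proj u)) (x := (0 : ℝ)))
    have h6 : (mfderiv 𝓘(ℝ, ℝ) (𝓘(ℝ, EP).prod 𝓘(ℝ, ℝ)) (fun r => (σ (G.proj (γ r)), r)) 0
          (1 : ℝ) : EP × ℝ) =
        mfderiv 𝓘(ℝ, ℝ) (𝓘(ℝ, EP).prod 𝓘(ℝ, ℝ)) (fun r : ℝ => (σ (G.proj u), r)) 0 (1 : ℝ) :=
      h3.trans ((congrArg (fun w : EP =>
        (w, (mfderiv 𝓘(ℝ, ℝ) 𝓘(ℝ, ℝ) (fun r : ℝ => r) 0 (1 : ℝ) : ℝ))) (hτd.trans h5.symm)).trans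
        h4.symm)
    have h7 := h1.trans ((congrArg (fun w : EP × ℝ =>
      (mfderiv (𝓘(ℝ, EP).prod 𝓘(ℝ, ℝ)) 𝓘(ℝ, EP) (fun q : Q × ℝ => G.act q.1 (f q.2))
        (σ (G.proj u), (0 : ℝ)) w : EP)) h6).trans h2.symm)
    exact (congrArg (fun c : ℝ → Q => (mfderiv 𝓘(ℝ, ℝ) 𝓘(ℝ, EP) c 0 (1 : ℝ) : EP))
      hγeq.symm).trans h7
  have hfin := G.blocks_form_orbit (σ (G.proj u)) u f hf hq (ε • ξ) (hsum.symm.trans hγd)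
  have hs : G.form u (ε • ξ) = ε • G.form u ξ := by
    simp [form]
  rw [hs] at hfin
  have e1 : blockBT (ε • G.form u ξ) = ε • blockBT (G.form u ξ) := rfl
  have e2 : blockBM (ε • G.form u ξ) = ε • blockBM (G.form u ξ) := rfl
  rw [e1, e2] at hfin
  exact ⟨(smul_eq_zero.1 hfin.1).resolve_left hε.ne', (smul_eq_zero.1 hfin.2).resolve_left hε.ne'⟩

/-- The kernel of the projection to the tangent space of the base. -/
theorem dproj_eq_zero_iff (u : Q) (ξ : TangentSpace 𝓘(ℝ, EP) u) :
    G.dproj u ξ = 0 ↔ blockBT (G.form u ξ) = 0 ∧ blockBM (G.form u ξ) = 0 := by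
  refine ⟨G.blocks_form_of_dproj_eq_zero u ξ, fun h => ?_⟩
  rw [← G.vec_form u ξ]
  exact G.dproj_vec_eq_zero u (G.form_mem u ξ) h.1 h.2

end CartanGeometry

end Vertical

/-! ### Block-diagonal changes of frame and the algebra of the form on T -/

section FrameChange

variable {n : ℕ}

theorem exists_eq_ofBlocks_of_commute_gradingElt {q : TMat n}
    (h : q * gradingElt n = gradingElt n * q) :
    ∃ (A : Matrix (Fin n) (Fin n) ℝ) (e : Matrix Unit Unit ℝ) (K : Matrix (Fin n) (Fin n) ℝ),
      q = ofBlocks A 0 0 0 e 0 0 0 K := by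
  obtain ⟨a, b, c, d, e, f, g, l, k, rfl⟩ := exists_eq_ofBlocks q
  rw [gradingElt_eq_ofBlocks, ofBlocks_mul, ofBlocks_mul, ofBlocks_inj] at h
  simp only [Matrix.mul_zero, Matrix.zero_mul, Matrix.mul_one, Matrix.one_mul, add_zero, zero_add,
    Matrix.mul_neg, Matrix.neg_mul] at h
  obtain ⟨-, hb, hc, hd, -, hf, hg, hl, -⟩ := h
  have key : ∀ x : Matrix (Fin n) (Fin n) ℝ, x = -x → x = 0 := fun x hx => by
    ext i j
    have := congrFun (congrFun hx i) j
    rw [Matrix.neg_apply] at this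
    exact self_eq_neg.1 this
  refine ⟨a, e, k, ?_⟩
  rw [ofBlocks_inj]
  exact ⟨rfl, hb.symm, key c hc.symm, hd, rfl, neg_eq_zero.1 hf, key g hg, zero_eq_neg.1 hl, rfl⟩

/-- $A$ and $K$ act on $H^*$ and $H$ and are dual to each other, so they cancel in pairs inside the
products, and the outer factors cancel by cyclicity of the trace. The middle entry $e$ is a sign
that occurs twice. -/
theorem modelForm_frame_change {m A K : Matrix (Fin n) (Fin n) ℝ} {e : Matrix Unit Unit ℝ}
    (hAK : A * Kᵀ = 1) (he : e * eᵀ = 1) {y z y' z' : TMat n}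
    (hy : blockBM y' = Aᵀ * blockBM y * e) (hy' : blockBT y' = Aᵀ * blockBT y * A)
    (hz : blockBM z' = Aᵀ * blockBM z * e) (hz' : blockBT z' = Aᵀ * blockBT z * A) :
    modelForm (Kᵀ * m * K) y' z' = modelForm m y z := by
  have hKA : K * Aᵀ = 1 := by
    rw [← Matrix.transpose_one, ← hAK, Matrix.transpose_mul, Matrix.transpose_transpose]
  have h1 : (Aᵀ * blockBM z * e)ᵀ * (Kᵀ * m * K) * (Aᵀ * blockBM y * e) =
      eᵀ * ((blockBM z)ᵀ * m * blockBM y * e) := by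
    rw [Matrix.transpose_mul, Matrix.transpose_mul, Matrix.transpose_transpose]
    calc _ = eᵀ * ((blockBM z)ᵀ * (A * Kᵀ) * m * (K * Aᵀ) * blockBM y * e) := by
          simp only [Matrix.mul_assoc]
      _ = _ := by rw [hAK, hKA, Matrix.mul_one, Matrix.mul_one]
  have h2 : (Aᵀ * blockBT y * A)ᵀ * (Kᵀ * m * K) * (Aᵀ * blockBT z * A) * (Kᵀ * m * K) =
      Aᵀ * ((blockBT y)ᵀ * m * blockBT z * m * K) := by
    rw [Matrix.transpose_mul, Matrix.transpose_mul, Matrix.transpose_transpose]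
    calc _ = Aᵀ * ((blockBT y)ᵀ * (A * Kᵀ) * m * (K * Aᵀ) * blockBT z * (A * Kᵀ) * m * K) := by
          simp only [Matrix.mul_assoc]
      _ = _ := by rw [hAK, hKA, Matrix.mul_one, Matrix.mul_one, Matrix.mul_one]
  rw [modelForm, modelForm, wedgeTrace, wedgeTrace, hy, hy', hz, hz', h1, h2, Matrix.trace_mul_comm,
    Matrix.trace_mul_comm Aᵀ, Matrix.mul_assoc _ e, he, Matrix.mul_assoc _ K, hKA, Matrix.mul_one,
    Matrix.mul_one]

theorem modelForm_comm {m : Matrix (Fin n) (Fin n) ℝ} (hm : mᵀ = m) (y z : TMat n) :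
    modelForm m y z = modelForm m z y := by
  have h1 : (blockBM z)ᵀ * m * blockBM y = ((blockBM y)ᵀ * m * blockBM z)ᵀ := by
    rw [Matrix.transpose_mul, Matrix.transpose_mul, Matrix.transpose_transpose, hm, Matrix.mul_assoc]
  have h2 : ((blockBT y)ᵀ * m * blockBT z * m)ᵀ = m * ((blockBT z)ᵀ * m * blockBT y) := by
    simp only [Matrix.transpose_mul, Matrix.transpose_transpose, hm, Matrix.mul_assoc]
  rw [modelForm, modelForm, wedgeTrace, wedgeTrace, h1, Matrix.trace_transpose,
    ← Matrix.trace_transpose ((blockBT y)ᵀ * m * blockBT z * m), h2, Matrix.trace_mul_comm m]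

theorem modelForm_add_left (m : Matrix (Fin n) (Fin n) ℝ) (y y' z : TMat n) :
    modelForm m (y + y') z = modelForm m y z + modelForm m y' z := by
  have h1 : blockBM (y + y') = blockBM y + blockBM y' := rfl
  have h2 : blockBT (y + y') = blockBT y + blockBT y' := rfl
  simp only [modelForm, wedgeTrace, h1, h2, Matrix.transpose_add, Matrix.mul_add, Matrix.add_mul,
    Matrix.trace_add]
  ring

theorem modelForm_smul_left (m : Matrix (Fin n) (Fin n) ℝ) (r : ℝ) (y z : TMat n) :
    modelForm m (r • y) z = r * modelForm m y z := by
  have h1 : blockBM (r • y) = r • blockBM y := rfl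
  have h2 : blockBT (r • y) = r • blockBT y := rfl
  simp only [modelForm, wedgeTrace, h1, h2, Matrix.transpose_smul, Matrix.mul_smul, Matrix.smul_mul,
    Matrix.trace_smul, smul_eq_mul]
  ring

theorem modelForm_congr (m : Matrix (Fin n) (Fin n) ℝ) {y y' z z' : TMat n}
    (h1 : blockBM y = blockBM y') (h2 : blockBT y = blockBT y') (h3 : blockBM z = blockBM z')
    (h4 : blockBT z = blockBT z') : modelForm m y z = modelForm m y' z' := by
  rw [modelForm, modelForm, h1, h2, h3, h4]

end FrameChange

/-! ### Invariance of the form under P -/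

section Metric

variable {n : ℕ} {EM EP M Q : Type*}
  [NormedAddCommGroup EM] [NormedSpace ℝ EM] [NormedAddCommGroup EP] [NormedSpace ℝ EP]
  [TopologicalSpace M] [ChartedSpace EM M] [IsManifold 𝓘(ℝ, EM) ∞ M]
  [TopologicalSpace Q] [ChartedSpace EP Q] [IsManifold 𝓘(ℝ, EP) ∞ Q]

namespace CartanGeometry

namespace TractorSubbundle

variable {G : CartanGeometry n EM EP M Q} (V : G.TractorSubbundle n) {u : Q}

theorem blockBT_inFrame (y : TMat n) : blockBT (V.inFrame y u) = blockBT y := by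
  obtain ⟨a, b, c, d, e, f, g, h, k, rfl⟩ := exists_eq_ofBlocks y
  rw [inFrame, frame, frameInv, weylFrame, weylFrameInv, ofBlocks_mul, ofBlocks_mul]
  ext i j
  simp [blockBT]

/-- $T/H$ is canonical, so the lower left block does not see the splitting; the $H$-component does,
and is shifted by the degree-one part of the Weyl structure. -/
theorem blockBM_inFrame (y : TMat n) :
    blockBM (V.inFrame y u) = blockBM y - blockBT y * V.midCol u := by
  obtain ⟨a, b, c, d, e, f, g, h, k, rfl⟩ := exists_eq_ofBlocks y
  have h1 : blockBT (ofBlocks a b c d e f g h k) = g := rfl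
  have h2 : blockBM (ofBlocks a b c d e f g h k) = h := rfl
  rw [h1, h2, inFrame, frame, frameInv, weylFrame, weylFrameInv, ofBlocks_mul, ofBlocks_mul]
  ext i j
  simp [blockBM, neg_add_eq_sub]

/-- Let $q = T_u^{-1}\,p\,T_{u\cdot p}$ be the action of $p$ between the adapted frames.
Equivariance of the preferred lift says that $q$ commutes with the grading element, so $q$ is block
diagonal, and the isometry relation ties its blocks together. -/
theorem exists_frame_change (hu : u ∈ G.proj ⁻¹' V.injLocus) (p : Parabolic n) :
    ∃ (A K : Matrix (Fin n) (Fin n) ℝ) (e : Matrix Unit Unit ℝ), A * Kᵀ = 1 ∧ e * eᵀ = 1 ∧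
      V.metricMat (G.act u p) = Kᵀ * V.metricMat u * K ∧
      ∀ y, blockBM (V.inFrame (pmat p⁻¹ * y * pmat p) (G.act u p)) =
          Aᵀ * blockBM (V.inFrame y u) * e ∧
        blockBT (V.inFrame (pmat p⁻¹ * y * pmat p) (G.act u p)) = Aᵀ * blockBT (V.inFrame y u) * A := by
  set v := G.act u p with hv
  have hvD : v ∈ G.proj ⁻¹' V.injLocus := V.act_mem_preimage_injLocus hu p
  have e1 := V.frame_mul_frameInv u
  have e2 := V.frameInv_mul_frame u
  have e3 := V.frame_mul_frameInv v
  have e4 := V.frameInv_mul_frame v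
  have e5 : pmat p * pmat p⁻¹ = 1 := pmat_mul_inv p
  have e6 : pmat p⁻¹ * pmat p = 1 := pmat_inv_mul p
  set q := V.frameInv u * pmat p * V.frame v with hq
  set q' := V.frameInv v * pmat p⁻¹ * V.frame u with hq'
  have hqq : q * q' = 1 := by
    calc q * q' = V.frameInv u * (pmat p * (V.frame v * V.frameInv v) * pmat p⁻¹) * V.frame u := by
          rw [hq, hq']; noncomm_ring
      _ = 1 := by rw [e3, Matrix.mul_one, e5, Matrix.mul_one, e2]
  have hqq' : q' * q = 1 := mul_eq_one_comm.1 hqq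
  have hN : V.frame v * gradingElt n * V.frameInv v =
      pmat p⁻¹ * (V.frame u * gradingElt n * V.frameInv u) * pmat p := by
    rw [← V.preferredLift_eq, ← V.preferredLift_eq]
    exact V.preferredLift_act hu p
  have hcomm : q * gradingElt n = gradingElt n * q := by
    calc q * gradingElt n = V.frameInv u * pmat p * (V.frame v * gradingElt n *
          (V.frameInv v * V.frame v)) := by rw [hq, e4]; noncomm_ring
      _ = V.frameInv u * pmat p * (V.frame v * gradingElt n * V.frameInv v) * V.frame v := by
          noncomm_ring
      _ = (V.frameInv u * (pmat p * pmat p⁻¹) * V.frame u) * gradingElt n * V.frameInv u * pmat p *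
          V.frame v := by rw [hN]; noncomm_ring
      _ = gradingElt n * q := by rw [e5, Matrix.mul_one, e2, hq]; noncomm_ring
  have hcomm' : q' * gradingElt n = gradingElt n * q' := by
    calc q' * gradingElt n = q' * gradingElt n * (q * q') := by rw [hqq, Matrix.mul_one]
      _ = q' * (gradingElt n * q) * q' := by noncomm_ring
      _ = (q' * q) * gradingElt n * q' := by rw [← hcomm]; noncomm_ring
      _ = gradingElt n * q' := by rw [hqq', Matrix.one_mul]
  have hiso : qᵀ * Jmat n * q = Jmat n := by
    calc qᵀ * Jmat n * q = (V.frame v)ᵀ * ((pmat p)ᵀ * ((V.frameInv u)ᵀ * Jmat n * V.frameInv u) *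
          pmat p) * V.frame v := by
          rw [hq, Matrix.transpose_mul, Matrix.transpose_mul]; noncomm_ring
      _ = Jmat n := by rw [V.frameInv_isometry, pmat_isometry, V.frame_isometry]
  obtain ⟨A, e, K, hqA⟩ := exists_eq_ofBlocks_of_commute_gradingElt hcomm
  obtain ⟨A', e', K', hqA'⟩ := exists_eq_ofBlocks_of_commute_gradingElt hcomm'
  rw [hqA, ofBlocks_transpose, Jmat_eq_ofBlocks, ofBlocks_mul, ofBlocks_mul, ofBlocks_inj] at hiso
  rw [hqA, hqA', ofBlocks_mul, one_eq_ofBlocks, ofBlocks_inj] at hqq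
  simp only [Matrix.mul_zero, Matrix.zero_mul, Matrix.mul_one, add_zero, zero_add,
    Matrix.transpose_zero] at hiso hqq
  obtain ⟨-, -, hAK, -, hee, -, hKA, -, -⟩ := hiso
  obtain ⟨-, -, -, -, hee', -, -, -, hKK⟩ := hqq
  have hK' : K' = Aᵀ := by
    calc K' = Aᵀ * (K * K') := by rw [← Matrix.mul_assoc, hAK, Matrix.one_mul]
      _ = Aᵀ := by rw [hKK, Matrix.mul_one]
  refine ⟨A, K, e, ?_, mul_eq_one_comm.1 hee, ?_, fun y => ?_⟩
  · exact mul_eq_one_comm.1 hKA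
  · have hp : pmat p * V.frame v = V.frame u * q := by
      calc pmat p * V.frame v = (V.frame u * V.frameInv u) * pmat p * V.frame v := by
            rw [e1, Matrix.one_mul]
        _ = V.frame u * q := by rw [hq]; noncomm_ring
    -- Since $p$ maps the fibre of $V$ at $u\cdot p$ to that at $u$, it acts on the graph
    -- coordinates by $K$; invariance of $h$ then gives the transformation of $m$.
    have hH : ∀ X, hBlock (pmat p *ᵥ (V.liftMat v *ᵥ X)) = K *ᵥ X := by
      intro X
      rw [V.liftMat_eq_frame_mul, Matrix.mulVec_mulVec, ← Matrix.mul_assoc, hp, hqA, Matrix.mul_assoc,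
        ← Matrix.mulVec_mulVec, ← Matrix.mulVec_mulVec, frame, weylFrame, hBlock_ofBlocks_mulVec,
        hBlock_ofBlocks_mulVec, hBlock_graphMat_mulVec]
      simp
    refine matrix_eq_of_dotProduct fun X Y => ?_
    rw [← V.tractorMetric_liftMat, ← tractorMetric_mulVec (pmat_isometry p),
      V.eq_liftMat_mulVec hu ((V.equivariant u p _).1 (V.liftMat_mulVec_mem hvD X)),
      V.eq_liftMat_mulVec hu ((V.equivariant u p _).1 (V.liftMat_mulVec_mem hvD Y)),
      V.tractorMetric_liftMat, hH, hH, ← Matrix.mulVec_mulVec, ← Matrix.mulVec_mulVec,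
      Matrix.dotProduct_mulVec, ← Matrix.mulVec_transpose]
  · have h1 : V.inFrame (pmat p⁻¹ * y * pmat p) v = q' * V.inFrame y u * q := by
      calc V.inFrame (pmat p⁻¹ * y * pmat p) v = V.frameInv v * pmat p⁻¹ * (V.frame u * V.frameInv u) *
            y * (V.frame u * V.frameInv u) * pmat p * V.frame v := by
            rw [e1, inFrame]; noncomm_ring
        _ = q' * V.inFrame y u * q := by rw [hq, hq', inFrame]; noncomm_ring
    obtain ⟨a, b, c, d, e'', f, g, h, k, hy⟩ := exists_eq_ofBlocks (V.inFrame y u)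
    rw [h1, hy, hqA, hqA', hK', ofBlocks_mul, ofBlocks_mul]
    constructor
    · change _ = Aᵀ * h * e
      ext i j
      simp [blockBM]
    · change _ = Aᵀ * g * A
      ext i j
      simp [blockBT]

theorem modelForm_act (hu : u ∈ G.proj ⁻¹' V.injLocus) (p : Parabolic n) (y z : TMat n) :
    modelForm (V.metricMat (G.act u p)) (V.inFrame (pmat p⁻¹ * y * pmat p) (G.act u p))
      (V.inFrame (pmat p⁻¹ * z * pmat p) (G.act u p)) =
      modelForm (V.metricMat u) (V.inFrame y u) (V.inFrame z u) := by
  obtain ⟨A, K, e, hAK, he, hm, h⟩ := V.exists_frame_change hu p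
  rw [hm]
  exact modelForm_frame_change hAK he (h y).1 (h y).2 (h z).1 (h z).2

end TractorSubbundle

end CartanGeometry

end Metric

/-! ### Descent of the form to the base, and its smoothness -/

section BaseMetric

variable {n : ℕ} {EM EP M Q : Type*}
  [NormedAddCommGroup EM] [NormedSpace ℝ EM] [NormedAddCommGroup EP] [NormedSpace ℝ EP]
  [TopologicalSpace M] [ChartedSpace EM M] [IsManifold 𝓘(ℝ, EM) ∞ M]
  [TopologicalSpace Q] [ChartedSpace EP Q] [IsManifold 𝓘(ℝ, EP) ∞ Q]

namespace CartanGeometry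

section Base

variable (G : CartanGeometry n EM EP M Q)

theorem proj_surjective : Function.Surjective G.proj := fun x => by
  obtain ⟨W, -, hx, σ, -, -, -, hσ, -⟩ := G.local_triv x
  exact ⟨σ x, hσ x hx⟩

theorem dproj_act (u : Q) (p : Parabolic n) (ξ : TangentSpace 𝓘(ℝ, EP) u) :
    (G.dproj (G.act u p) (mfderiv 𝓘(ℝ, EP) 𝓘(ℝ, EP) (fun v => G.act v p) u ξ) : EM) =
      G.dproj u ξ := by
  have h1 := mfderiv_comp_apply (I'' := 𝓘(ℝ, EM)) u (G.mdifferentiableAt_proj (G.act u p))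
    ((G.contMDiff_act_const p).mdifferentiable (by simp) u) ξ
  have h2 : G.proj ∘ (fun v => G.act v p) = G.proj := funext fun v => G.proj_act v p
  refine h1.symm.trans ?_
  exact congrArg (fun f : Q → M => (mfderiv 𝓘(ℝ, EP) 𝓘(ℝ, EM) f u ξ : EM)) h2

/-- A linear choice of horizontal lifts at a point. -/
noncomputable def horizontal (u : Q) : EM →ₗ[ℝ] TangentSpace 𝓘(ℝ, EP) u :=
  ((G.dproj u).toLinearMap.exists_rightInverse_of_surjective
    (LinearMap.range_eq_top.2 (G.dproj_surjective u))).choose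

theorem dproj_horizontal (u : Q) (a : EM) : (G.dproj u (G.horizontal u a) : EM) = a :=
  LinearMap.congr_fun ((G.dproj u).toLinearMap.exists_rightInverse_of_surjective
    (LinearMap.range_eq_top.2 (G.dproj_surjective u))).choose_spec a

theorem form_add (u : Q) (ξ ζ : TangentSpace 𝓘(ℝ, EP) u) :
    G.form u (ξ + ζ) = G.form u ξ + G.form u ζ := by
  simp [form]

theorem form_smul (u : Q) (r : ℝ) (ξ : TangentSpace 𝓘(ℝ, EP) u) :
    G.form u (r • ξ) = r • G.form u ξ := by
  simp [form]

theorem form_neg (u : Q) (ξ : TangentSpace 𝓘(ℝ, EP) u) : G.form u (-ξ) = -G.form u ξ := by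
  simp [form]

theorem form_act (u : Q) (p : Parabolic n) (ξ : TangentSpace 𝓘(ℝ, EP) u) :
    G.form (G.act u p) (mfderiv 𝓘(ℝ, EP) 𝓘(ℝ, EP) (fun v => G.act v p) u ξ) =
      pmat p⁻¹ * G.form u ξ * pmat p := G.conn_equivariant u p ξ

/-- The blocks of `ω` that represent a tangent vector of the base are determined by it. -/
theorem dproj_eq_dproj_iff (u : Q) (ξ ζ : TangentSpace 𝓘(ℝ, EP) u) :
    G.dproj u ξ = G.dproj u ζ ↔
      blockBT (G.form u ξ) = blockBT (G.form u ζ) ∧ blockBM (G.form u ξ) = blockBM (G.form u ζ) := by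
  have h1 : G.form u (ξ - ζ) = G.form u ξ - G.form u ζ := by
    rw [sub_eq_add_neg, G.form_add, G.form_neg, sub_eq_add_neg]
  rw [← sub_eq_zero, ← map_sub, G.dproj_eq_zero_iff, h1]
  change blockBT (G.form u ξ) - blockBT (G.form u ζ) = 0 ∧
    blockBM (G.form u ξ) - blockBM (G.form u ζ) = 0 ↔ _
  rw [sub_eq_zero, sub_eq_zero]

end Base

namespace TractorSubbundle

variable {G : CartanGeometry n EM EP M Q} (V : G.TractorSubbundle n) {u : Q}

/-- The form on `T`, evaluated on elements of `𝔤` in the frame. -/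
noncomputable def formAt (u : Q) (y z : TMat n) : ℝ :=
  modelForm (V.metricMat u) (V.inFrame y u) (V.inFrame z u)

theorem formAt_comm (u : Q) (y z : TMat n) : V.formAt u y z = V.formAt u z y :=
  modelForm_comm (V.metricMat_transpose u) _ _

theorem formAt_add_left (u : Q) (y y' z : TMat n) :
    V.formAt u (y + y') z = V.formAt u y z + V.formAt u y' z := by
  have : V.inFrame (y + y') u = V.inFrame y u + V.inFrame y' u := by
    simp only [inFrame, Matrix.mul_add, Matrix.add_mul]
  rw [formAt, this, modelForm_add_left]
  rfl

theorem formAt_smul_left (u : Q) (r : ℝ) (y z : TMat n) :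
    V.formAt u (r • y) z = r * V.formAt u y z := by
  have : V.inFrame (r • y) u = r • V.inFrame y u := by
    simp only [inFrame, Matrix.mul_smul, Matrix.smul_mul]
  rw [formAt, this, modelForm_smul_left]
  rfl

theorem formAt_congr {y y' z z' : TMat n} (h1 : blockBT y = blockBT y' ∧ blockBM y = blockBM y')
    (h2 : blockBT z = blockBT z' ∧ blockBM z = blockBM z') : V.formAt u y z = V.formAt u y' z' := by
  refine modelForm_congr _ ?_ ?_ ?_ ?_ <;> simp only [blockBM_inFrame, blockBT_inFrame, h1, h2]

/-- The form on the tangent space of the base, computed at a point of the fibre. -/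
noncomputable def baseForm (u : Q) : EM →ₗ[ℝ] EM →ₗ[ℝ] ℝ :=
  LinearMap.mk₂ ℝ (fun a b => V.formAt u (G.form u (G.horizontal u a)) (G.form u (G.horizontal u b)))
    (fun a a' b => by rw [map_add, G.form_add, formAt_add_left])
    (fun r a b => by rw [map_smul, G.form_smul, formAt_smul_left, smul_eq_mul])
    (fun a b b' => by
      rw [map_add, G.form_add, formAt_comm, formAt_add_left, V.formAt_comm u (G.form u (G.horizontal u b)),
        V.formAt_comm u (G.form u (G.horizontal u b'))])
    (fun r a b => by
      rw [map_smul, G.form_smul, formAt_comm, formAt_smul_left, V.formAt_comm u (G.form u (G.horizontal u b)),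
        smul_eq_mul])

theorem baseForm_dproj (u : Q) (ξ ζ : TangentSpace 𝓘(ℝ, EP) u) :
    V.baseForm u (G.dproj u ξ) (G.dproj u ζ) = V.formAt u (G.form u ξ) (G.form u ζ) :=
  V.formAt_congr ((G.dproj_eq_dproj_iff u _ _).1 (G.dproj_horizontal u _))
    ((G.dproj_eq_dproj_iff u _ _).1 (G.dproj_horizontal u _))

theorem baseForm_act (hu : u ∈ G.proj ⁻¹' V.injLocus) (p : Parabolic n) :
    V.baseForm (G.act u p) = V.baseForm u := by
  ext a b
  have h : ∀ a : EM, a = G.dproj (G.act u p)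
      (mfderiv 𝓘(ℝ, EP) 𝓘(ℝ, EP) (fun v => G.act v p) u (G.horizontal u a)) := fun a =>
    (G.dproj_horizontal u a).symm.trans (G.dproj_act u p _).symm
  have h1 : V.baseForm (G.act u p) a b = _ := congrArg₂ (fun a b => V.baseForm (G.act u p) a b) (h a) (h b)
  refine h1.trans ((V.baseForm_dproj (G.act u p) _ _).trans ?_)
  rw [G.form_act, G.form_act]
  exact V.modelForm_act hu p _ _

/-- The form `μ` on the tangent bundle of the base. -/
noncomputable def baseMetric (x : M) :
    TangentSpace 𝓘(ℝ, EM) x →ₗ[ℝ] TangentSpace 𝓘(ℝ, EM) x →ₗ[ℝ] ℝ :=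
  V.baseForm (G.proj_surjective x).choose

/-- The arbitrary point of the fibre used in `baseMetric` differs from $u$ by an element of $P$, and
over the locus the form does not notice. -/
theorem baseMetric_eq (hu : u ∈ G.proj ⁻¹' V.injLocus) {x : M} (hx : G.proj u = x) :
    V.baseMetric x = V.baseForm u := by
  subst hx
  obtain ⟨p, hp⟩ := (G.proj_eq_iff u _).1 (G.proj_surjective (G.proj u)).choose_spec.symm
  rw [baseMetric, ← hp]
  exact V.baseForm_act hu p

theorem baseMetric_dproj (hu : u ∈ G.proj ⁻¹' V.injLocus) (ξ ζ : TangentSpace 𝓘(ℝ, EP) u) :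
    V.baseMetric (G.proj u) (G.dproj u ξ) (G.dproj u ζ) = V.formAt u (G.form u ξ) (G.form u ζ) := by
  rw [V.baseMetric_eq hu rfl]
  exact V.baseForm_dproj u ξ ζ

/-- The chosen points and horizontal lifts in the definition need not vary smoothly. Locally both
are replaced by a smooth section $\sigma$ and its differential, and the value becomes a polynomial
in the entries of $m$, of the frame with its inverse, and of $\omega$ composed with the tangent map
of $\sigma$. -/
theorem smooth_baseMetric : ContMDiffOn 𝓘(ℝ, EM).tangent 𝓘(ℝ, ℝ) ∞
    (fun v : TangentBundle 𝓘(ℝ, EM) M => V.baseMetric v.proj v.snd v.snd)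
      {v | v.proj ∈ V.injLocus} := by
  intro v₀ hv₀
  obtain ⟨u, hu⟩ := G.proj_surjective v₀.proj
  obtain ⟨W, σ, hW, hxW, hσ, hσp, -⟩ := G.exists_section_through u
  rw [hu] at hxW
  set W' := W ∩ V.injLocus with hW'
  have hWo : IsOpen W' := hW.inter V.isOpen_injLocus
  have hσ' : ContMDiffOn 𝓘(ℝ, EM) 𝓘(ℝ, EP) ∞ σ W' := hσ.mono Set.inter_subset_left
  set B : Set (TangentBundle 𝓘(ℝ, EM) M) := Bundle.TotalSpace.proj ⁻¹' W' with hB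
  have hproj : ContMDiff 𝓘(ℝ, EM).tangent 𝓘(ℝ, EM) ∞
      (Bundle.TotalSpace.proj : TangentBundle 𝓘(ℝ, EM) M → M) := Bundle.contMDiff_proj _
  have hBo : IsOpen B := hWo.preimage hproj.continuous
  have hmaps : ∀ v ∈ B, σ v.proj ∈ G.proj ⁻¹' V.injLocus := fun v hv => by
    rw [Set.mem_preimage, hσp _ hv.1]
    exact hv.2
  have hs : ContMDiffOn 𝓘(ℝ, EM).tangent 𝓘(ℝ, EP) ∞
      (fun v : TangentBundle 𝓘(ℝ, EM) M => σ v.proj) B := hσ'.comp hproj.contMDiffOn fun v hv => hv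
  have hmat : ∀ {α β : Type} {f : Q → Matrix α β ℝ}, MatSmoothOn 𝓘(ℝ, EP) f (G.proj ⁻¹' V.injLocus) →
      MatSmoothOn 𝓘(ℝ, EM).tangent (fun v : TangentBundle 𝓘(ℝ, EM) M => f (σ v.proj)) B :=
    fun hf i j => (hf i j).comp hs hmaps
  have hform : MatSmoothOn 𝓘(ℝ, EM).tangent (fun v : TangentBundle 𝓘(ℝ, EM) M =>
      G.form (σ v.proj) (mfderiv 𝓘(ℝ, EM) 𝓘(ℝ, EP) σ v.proj v.snd)) B := by
    intro i j
    have h1 := hσ'.contMDiffOn_tangentMapWithin (m := ∞) (by simp) hWo.uniqueMDiffOn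
    refine ((G.contMDiff_conn i j).comp_contMDiffOn h1).congr fun v hv => ?_
    have h2 : mfderivWithin 𝓘(ℝ, EM) 𝓘(ℝ, EP) σ W' v.proj = mfderiv 𝓘(ℝ, EM) 𝓘(ℝ, EP) σ v.proj :=
      mfderivWithin_of_isOpen hWo hv
    simp only [Function.comp, tangentMapWithin, h2]
    rfl
  have hfr := ((hmat V.smoothOn_frameInv).mul hform).mul (hmat V.smoothOn_frame)
  set Z : TangentBundle 𝓘(ℝ, EM) M → TMat n := fun v => V.frameInv (σ v.proj) *
    G.form (σ v.proj) (mfderiv 𝓘(ℝ, EM) 𝓘(ℝ, EP) σ v.proj v.snd) * V.frame (σ v.proj) with hZ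
  have hBM : MatSmoothOn 𝓘(ℝ, EM).tangent (fun v => blockBM (Z v)) B := fun i j => hfr _ _
  have hBT : MatSmoothOn 𝓘(ℝ, EM).tangent (fun v => blockBT (Z v)) B := fun i j => hfr _ _
  have hm := hmat V.smoothOn_metricMat
  have htr : ∀ {α : Type} [Fintype α] {f : TangentBundle 𝓘(ℝ, EM) M → Matrix α α ℝ},
      MatSmoothOn 𝓘(ℝ, EM).tangent f B → RealSmoothOn 𝓘(ℝ, EM).tangent (fun v => (f v).trace) B :=
    fun hf => RealSmoothOn.sum fun i _ => hf i i
  have hsm : RealSmoothOn 𝓘(ℝ, EM).tangent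
      (fun v => modelForm (V.metricMat (σ v.proj)) (Z v) (Z v)) B :=
    (htr ((hBM.transpose.mul hm).mul hBM)).add
      (RealSmoothOn.const_mul _ (htr (((hBT.transpose.mul hm).mul hBT).mul hm)))
  have heq : ∀ v ∈ B, V.baseMetric v.proj v.snd v.snd =
      modelForm (V.metricMat (σ v.proj)) (Z v) (Z v) := by
    rintro ⟨x, a⟩ hv
    have h3 : V.baseMetric x = V.baseForm (σ x) := V.baseMetric_eq (hmaps _ hv) (hσp x hv.1)
    have h4 : (G.dproj (σ x) (mfderiv 𝓘(ℝ, EM) 𝓘(ℝ, EP) σ x a) : EM) = a :=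
      G.dproj_section hW hσ hσp hv.1 a
    have h5 := V.baseForm_dproj (σ x) (mfderiv 𝓘(ℝ, EM) 𝓘(ℝ, EP) σ x a)
      (mfderiv 𝓘(ℝ, EM) 𝓘(ℝ, EP) σ x a)
    refine (congrArg (fun L : EM →ₗ[ℝ] EM →ₗ[ℝ] ℝ => L a a) h3).trans ?_
    exact (congrArg (fun c : EM => V.baseForm (σ x) c c) h4.symm).trans h5
  exact ((hsm.congr heq).contMDiffAt (hBo.mem_nhds ⟨hxW, hv₀⟩)).contMDiffWithinAt

theorem isMetricOf_baseMetric : V.IsMetricOf V.injLocus V.preferredLift V.baseMetric where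
  pullback _ hu ξ ζ := (V.baseMetric_dproj hu ξ ζ).trans (V.muT_preferredLift hu _ _).symm
  symm _ _ _ _ := V.formAt_comm _ _ _
  smooth := V.smooth_baseMetric

end TractorSubbundle

end CartanGeometry

end BaseMetric

/-! ### Non-degeneracy and positivity of the form on skew matrices -/

section DefiniteForms

variable {n : ℕ} {m : Matrix (Fin n) (Fin n) ℝ}

theorem trace_transpose_mul_self_eq_zero_iff {α β : Type*} [Fintype α] [Fintype β]
    {A : Matrix α β ℝ} : (Aᵀ * A).trace = 0 ↔ A = 0 := by
  rw [← Matrix.conjTranspose_eq_transpose_of_trivial, Matrix.trace_conjTranspose_mul_self_eq_zero_iff]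

theorem trace_transpose_mul_self_nonneg {α β : Type*} [Fintype α] [Fintype β] (A : Matrix α β ℝ) :
    0 ≤ (Aᵀ * A).trace :=
  Finset.sum_nonneg fun i _ => by
    rw [Matrix.diag_apply, Matrix.mul_apply]
    exact Finset.sum_nonneg fun j _ => mul_self_nonneg (A j i)

theorem eq_zero_of_mul_eq_zero_of_mulVec {β : Type*} (hm : ∀ X, m *ᵥ X = 0 → X = 0)
    {N : Matrix (Fin n) β ℝ} (h : m * N = 0) : N = 0 := by
  ext i j
  exact congrFun (hm (fun k => N k j) (funext fun l => congrFun (congrFun h l) j)) i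

theorem eq_zero_of_conj_eq_zero (hs : mᵀ = m) (hm : ∀ X, m *ᵥ X = 0 → X = 0)
    {C : Matrix (Fin n) (Fin n) ℝ} (h : m * C * m = 0) : C = 0 := by
  rw [Matrix.mul_assoc] at h
  have h1 := eq_zero_of_mul_eq_zero_of_mulVec hm h
  have h2 : m * Cᵀ = 0 := by
    rw [← Matrix.transpose_zero, ← h1, Matrix.transpose_mul, hs]
  rw [← Matrix.transpose_transpose C, eq_zero_of_mul_eq_zero_of_mulVec hm h2, Matrix.transpose_zero]

/-- Paired with $mCm$, a matrix $C$ gives half the squared norm of $mCm$. This proves non-degeneracy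
in any signature without diagonalising $m$. -/
theorem wedgeTrace_conj_self (hs : mᵀ = m) (C : Matrix (Fin n) (Fin n) ℝ) :
    wedgeTrace m C (m * C * m) = (1 / 2) * ((m * C * m)ᵀ * (m * C * m)).trace := by
  have h : (m * C * m)ᵀ * (m * C * m) = m * (Cᵀ * m * (m * C * m)) := by
    simp only [Matrix.transpose_mul, hs, Matrix.mul_assoc]
  rw [wedgeTrace, h, Matrix.trace_mul_comm m]

theorem exists_eq_transpose_mul_self (hs : mᵀ = m) (hm : ∀ X, X ≠ 0 → 0 < (m *ᵥ X) ⬝ᵥ X) :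
    ∃ B : Matrix (Fin n) (Fin n) ℝ, m = Bᵀ * B := by
  have h : m.PosDef := Matrix.PosDef.of_dotProduct_mulVec_pos hs fun X hX => by
    rw [star_trivial, dotProduct_comm]
    exact hm X hX
  open scoped MatrixOrder in
  obtain ⟨B, hB⟩ := CStarAlgebra.nonneg_iff_eq_star_mul_self.mp h.posSemidef.nonneg
  exact ⟨B, hB⟩

/-- With $m = B^TB$, cyclicity distributes the factors evenly and exhibits a squared norm. -/
theorem wedgeTrace_self (B C : Matrix (Fin n) (Fin n) ℝ) :
    wedgeTrace (Bᵀ * B) C C = (1 / 2) * ((B * C * Bᵀ)ᵀ * (B * C * Bᵀ)).trace := by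
  rw [wedgeTrace, Matrix.transpose_mul, Matrix.transpose_mul, Matrix.transpose_transpose,
    Matrix.mul_assoc B, Matrix.trace_mul_comm B]
  simp only [Matrix.mul_assoc]

theorem mulVec_eq_zero_of_posDef (hm : ∀ X, X ≠ 0 → 0 < (m *ᵥ X) ⬝ᵥ X) (X : Fin n → ℝ)
    (h : m *ᵥ X = 0) : X = 0 := by
  by_contra hX
  have := hm X hX
  rw [h, zero_dotProduct] at this
  exact lt_irrefl _ this

theorem wedgeTrace_nonneg (hs : mᵀ = m) (hm : ∀ X, X ≠ 0 → 0 < (m *ᵥ X) ⬝ᵥ X)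
    (C : Matrix (Fin n) (Fin n) ℝ) : 0 ≤ wedgeTrace m C C := by
  obtain ⟨B, rfl⟩ := exists_eq_transpose_mul_self hs hm
  rw [wedgeTrace_self]
  exact mul_nonneg (by norm_num) (trace_transpose_mul_self_nonneg _)

theorem eq_zero_of_wedgeTrace_eq_zero (hs : mᵀ = m) (hm : ∀ X, X ≠ 0 → 0 < (m *ᵥ X) ⬝ᵥ X)
    {C : Matrix (Fin n) (Fin n) ℝ} (h : wedgeTrace m C C = 0) : C = 0 := by
  obtain ⟨B, rfl⟩ := exists_eq_transpose_mul_self hs hm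
  rw [wedgeTrace_self, mul_eq_zero, or_iff_right (by norm_num),
    trace_transpose_mul_self_eq_zero_iff] at h
  refine eq_zero_of_conj_eq_zero hs (mulVec_eq_zero_of_posDef hm) ?_
  calc Bᵀ * B * C * (Bᵀ * B) = Bᵀ * (B * C * Bᵀ) * B := by simp only [Matrix.mul_assoc]
    _ = 0 := by rw [h, Matrix.mul_zero, Matrix.zero_mul]

theorem trace_col (m : Matrix (Fin n) (Fin n) ℝ) (h : Matrix (Fin n) Unit ℝ) :
    (hᵀ * m * h).trace = (m *ᵥ fun i => h i ()) ⬝ᵥ fun i => h i () := by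
  rw [dotProduct_comm, Matrix.mul_assoc]
  simp [Matrix.trace, Matrix.mul_apply, dotProduct, Matrix.mulVec]

/-- The element of `so(n+1,n)` with the given blocks of negative degree. -/
def negativePart (C : Matrix (Fin n) (Fin n) ℝ) (h : Matrix (Fin n) Unit ℝ) : TMat n :=
  ofBlocks 0 0 0 (-hᵀ) 0 0 C h 0

theorem negativePart_mem_soAlg {C : Matrix (Fin n) (Fin n) ℝ} (hC : Cᵀ = -C)
    (h : Matrix (Fin n) Unit ℝ) : negativePart C h ∈ soAlg n := by
  have := ofBlocks_mem_soAlg (a := 0) (b := 0) (c := 0) (g := C) (h := h) (by simp) hC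
  simpa [negativePart] using this

end DefiniteForms

/-! ### Comparison of h on V with the metric on H and on T -/

section Definiteness

variable {n : ℕ} {EM EP M Q : Type*}
  [NormedAddCommGroup EM] [NormedSpace ℝ EM] [NormedAddCommGroup EP] [NormedSpace ℝ EP]
  [TopologicalSpace M] [ChartedSpace EM M] [IsManifold 𝓘(ℝ, EM) ∞ M]
  [TopologicalSpace Q] [ChartedSpace EP Q] [IsManifold 𝓘(ℝ, EP) ∞ Q]

namespace CartanGeometry

theorem alongH_iff (G : CartanGeometry n EM EP M Q) (u : Q) (ξ : TangentSpace 𝓘(ℝ, EP) u) :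
    G.AlongH u ξ ↔ blockBT (G.form u ξ) = 0 :=
  ⟨fun h => Matrix.ext h, fun h i j => congrFun (congrFun h i) j⟩

namespace TractorSubbundle

variable {G : CartanGeometry n EM EP M Q} (V : G.TractorSubbundle n) {u : Q}

theorem isNondegAt_iff (hu : u ∈ G.proj ⁻¹' V.injLocus) :
    V.IsNondegAt u ↔ ∀ X, V.metricMat u *ᵥ X = 0 → X = 0 := by
  constructor
  · intro H X hX
    have := H _ (V.liftMat_mulVec_mem hu X) fun t ht => by
      rw [V.eq_liftMat_mulVec hu ht, V.tractorMetric_liftMat, hX, zero_dotProduct]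
    rw [← V.hBlock_liftMat_mulVec u X, this]
    rfl
  · intro H s hs h
    have h1 : hBlock s = 0 := H _ <| dotProduct_self_eq_zero.1 <| by
      have := h _ (V.liftMat_mulVec_mem hu (V.metricMat u *ᵥ hBlock s))
      rwa [V.eq_liftMat_mulVec hu hs, V.tractorMetric_liftMat, V.hBlock_liftMat_mulVec] at this
    rw [V.eq_liftMat_mulVec hu hs, h1, Matrix.mulVec_zero]

theorem isPosDefAt_iff (hu : u ∈ G.proj ⁻¹' V.injLocus) :
    V.IsPosDefAt u ↔ ∀ X, X ≠ 0 → 0 < (V.metricMat u *ᵥ X) ⬝ᵥ X := by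
  constructor
  · intro H X hX
    rw [← V.tractorMetric_liftMat]
    refine H _ (V.liftMat_mulVec_mem hu X) fun h => hX ?_
    rw [← V.hBlock_liftMat_mulVec u X, h]
    rfl
  · intro H s hs h
    rw [V.eq_liftMat_mulVec hu hs, V.tractorMetric_liftMat]
    refine H _ fun h1 => h ?_
    rw [V.eq_liftMat_mulVec hu hs, h1, Matrix.mulVec_zero]

/-- The component in `H` of the image in `T` of a tangent vector of the total space. -/
noncomputable def tangentOne (u : Q) (ξ : TangentSpace 𝓘(ℝ, EP) u) : Matrix (Fin n) Unit ℝ :=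
  blockBM (V.inFrame (G.form u ξ) u)

theorem dproj_eq_zero_iff_blocks (ξ : TangentSpace 𝓘(ℝ, EP) u) :
    G.dproj u ξ = 0 ↔ blockBT (G.form u ξ) = 0 ∧ V.tangentOne u ξ = 0 := by
  rw [G.dproj_eq_zero_iff, tangentOne, blockBM_inFrame]
  refine and_congr_right fun h => ?_
  rw [h, Matrix.zero_mul, sub_zero]

theorem formAt_form (ξ ζ : TangentSpace 𝓘(ℝ, EP) u) : V.formAt u (G.form u ξ) (G.form u ζ) =
    ((V.tangentOne u ζ)ᵀ * V.metricMat u * V.tangentOne u ξ).trace +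
      wedgeTrace (V.metricMat u) (blockBT (G.form u ξ)) (blockBT (G.form u ζ)) := by
  rw [formAt, modelForm, blockBT_inFrame, blockBT_inFrame]
  rfl

/-- The summand $C \cdot$ `midCol` undoes the shift in `blockBM_inFrame`, so both components of a
test vector can be prescribed freely. -/
theorem exists_blocks_eq (u : Q) {C : Matrix (Fin n) (Fin n) ℝ} (hC : Cᵀ = -C)
    (h : Matrix (Fin n) Unit ℝ) : ∃ ξ : TangentSpace 𝓘(ℝ, EP) u,
      blockBT (G.form u ξ) = C ∧ V.tangentOne u ξ = h := by
  refine ⟨G.vec u (negativePart C (h + C * V.midCol u)), ?_, ?_⟩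
  · rw [G.form_vec u (negativePart_mem_soAlg hC _)]
    rfl
  · rw [tangentOne, blockBM_inFrame, G.form_vec u (negativePart_mem_soAlg hC _)]
    exact add_sub_cancel_right h _

theorem eq_zero_of_formAt_eq_zero (hm : ∀ X, V.metricMat u *ᵥ X = 0 → X = 0)
    (ξ : TangentSpace 𝓘(ℝ, EP) u)
    (h : ∀ ζ, G.AlongH u ζ → V.formAt u (G.form u ξ) (G.form u ζ) = 0) : V.tangentOne u ξ = 0 := by
  -- The test vector lies in $H$ and has the coordinates of $mX$, where $X$ is the $H$-component of
  -- $\xi$; the form then returns the squared norm of $mX$.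
  obtain ⟨ζ, h1, h2⟩ := V.exists_blocks_eq u (C := 0) (by simp) (V.metricMat u * V.tangentOne u ξ)
  have h3 := h ζ ((G.alongH_iff u ζ).2 h1)
  rw [formAt_form, h1, h2, wedgeTrace, Matrix.mul_zero, Matrix.zero_mul, Matrix.trace_zero, mul_zero,
    add_zero, Matrix.mul_assoc, trace_transpose_mul_self_eq_zero_iff] at h3
  exact eq_zero_of_mul_eq_zero_of_mulVec hm h3

theorem blockBT_eq_zero_of_formAt_eq_zero (hm : ∀ X, V.metricMat u *ᵥ X = 0 → X = 0)
    (ξ : TangentSpace 𝓘(ℝ, EP) u)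
    (h : ∀ ζ, V.formAt u (G.form u ξ) (G.form u ζ) = 0) : blockBT (G.form u ξ) = 0 := by
  have hs := V.metricMat_transpose u
  obtain ⟨ζ, h1, h2⟩ := V.exists_blocks_eq u
    (C := V.metricMat u * blockBT (G.form u ξ) * V.metricMat u)
    (by rw [Matrix.transpose_mul, Matrix.transpose_mul, hs, blockBT_transpose (G.form_mem u ξ),
      Matrix.neg_mul, Matrix.mul_neg, Matrix.mul_assoc]) 0
  have h3 := h ζ
  rw [formAt_form, h1, h2, wedgeTrace_conj_self hs, Matrix.transpose_zero, Matrix.zero_mul,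
    Matrix.zero_mul, Matrix.trace_zero, zero_add, mul_eq_zero, or_iff_right (by norm_num),
    trace_transpose_mul_self_eq_zero_iff] at h3
  exact eq_zero_of_conj_eq_zero hs hm h3

theorem isNondegAt_iff_alongH (hu : u ∈ G.proj ⁻¹' V.injLocus) :
    V.IsNondegAt u ↔ ∀ ξ, G.AlongH u ξ → (∀ ζ, G.AlongH u ζ →
      V.baseMetric (G.proj u) (G.dproj u ξ) (G.dproj u ζ) = 0) → G.dproj u ξ = 0 := by
  rw [V.isNondegAt_iff hu]
  constructor
  · intro hm ξ hξ h
    refine (V.dproj_eq_zero_iff_blocks ξ).2 ⟨(G.alongH_iff u ξ).1 hξ,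
      V.eq_zero_of_formAt_eq_zero hm ξ fun ζ hζ => ?_⟩
    rw [← V.baseMetric_dproj hu]
    exact h ζ hζ
  · intro H X hX
    -- A kernel vector of $m$, seen as a tangent vector in $H$, is orthogonal to everything.
    obtain ⟨ξ, h1, h2⟩ := V.exists_blocks_eq u (C := 0) (by simp) (Matrix.of fun i _ => X i)
    have h3 := H ξ ((G.alongH_iff u ξ).2 h1) fun ζ _ => by
      have h4 : V.metricMat u * (Matrix.of fun i (_ : Unit) => X i) = 0 :=
        Matrix.ext fun i _ => congrFun hX i
      rw [V.baseMetric_dproj hu, formAt_form, h1, h2, wedgeTrace, Matrix.mul_assoc, h4]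
      simp
    rw [V.dproj_eq_zero_iff_blocks, h2] at h3
    exact funext fun i => congrFun (congrFun h3.2 i) ()

theorem isNondegAt_iff_baseMetric (hu : u ∈ G.proj ⁻¹' V.injLocus) :
    V.IsNondegAt u ↔ ∀ a, (∀ b, V.baseMetric (G.proj u) a b = 0) → a = 0 := by
  constructor
  · intro hm a h
    rw [V.isNondegAt_iff hu] at hm
    obtain ⟨ξ, rfl⟩ := G.dproj_surjective u a
    have h1 : ∀ ζ, V.formAt u (G.form u ξ) (G.form u ζ) = 0 := fun ζ => by
      rw [← V.baseMetric_dproj hu]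
      exact h _
    exact (V.dproj_eq_zero_iff_blocks ξ).2 ⟨V.blockBT_eq_zero_of_formAt_eq_zero hm ξ h1,
      V.eq_zero_of_formAt_eq_zero hm ξ fun ζ _ => h1 ζ⟩
  · intro H
    rw [V.isNondegAt_iff hu]
    intro X hX
    obtain ⟨ξ, h1, h2⟩ := V.exists_blocks_eq u (C := 0) (by simp) (Matrix.of fun i _ => X i)
    have h3 := H (G.dproj u ξ) fun b => by
      obtain ⟨ζ, rfl⟩ := G.dproj_surjective u b
      have h4 : V.metricMat u * (Matrix.of fun i (_ : Unit) => X i) = 0 :=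
        Matrix.ext fun i _ => congrFun hX i
      rw [V.baseMetric_dproj hu, formAt_form, h1, h2, wedgeTrace, Matrix.mul_assoc, h4]
      simp
    rw [V.dproj_eq_zero_iff_blocks, h2] at h3
    exact funext fun i => congrFun (congrFun h3.2 i) ()

/-- The two summands of $T$ are orthogonal and both contribute non-negatively; a non-zero vector has
a non-zero component in one of them, where the contribution is strict. -/
theorem formAt_self_pos (hm : ∀ X, X ≠ 0 → 0 < (V.metricMat u *ᵥ X) ⬝ᵥ X)
    (ξ : TangentSpace 𝓘(ℝ, EP) u) (hξ : G.dproj u ξ ≠ 0) :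
    0 < V.formAt u (G.form u ξ) (G.form u ξ) := by
  have hs := V.metricMat_transpose u
  rw [formAt_form, trace_col]
  by_cases h : V.tangentOne u ξ = 0
  · have h1 : blockBT (G.form u ξ) ≠ 0 := fun h1 => hξ ((V.dproj_eq_zero_iff_blocks ξ).2 ⟨h1, h⟩)
    have h2 : (fun i => V.tangentOne u ξ i ()) = 0 := funext fun i => by rw [h]; rfl
    rw [h2, dotProduct_zero, zero_add]
    exact (wedgeTrace_nonneg hs hm _).lt_of_ne
      fun h3 => h1 (eq_zero_of_wedgeTrace_eq_zero hs hm h3.symm)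
  · refine add_pos_of_pos_of_nonneg (hm _ fun h1 => h ?_) (wedgeTrace_nonneg hs hm _)
    exact Matrix.ext fun i _ => congrFun h1 i

theorem isPosDefAt_iff_alongH (hu : u ∈ G.proj ⁻¹' V.injLocus) :
    V.IsPosDefAt u ↔ ∀ ξ, G.AlongH u ξ → G.dproj u ξ ≠ 0 →
      0 < V.baseMetric (G.proj u) (G.dproj u ξ) (G.dproj u ξ) := by
  rw [V.isPosDefAt_iff hu]
  constructor
  · intro hm ξ _ hξ
    rw [V.baseMetric_dproj hu]
    exact V.formAt_self_pos hm ξ hξ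
  · intro H X hX
    obtain ⟨ξ, h1, h2⟩ := V.exists_blocks_eq u (C := 0) (by simp) (Matrix.of fun i _ => X i)
    have h3 := H ξ ((G.alongH_iff u ξ).2 h1) fun h => by
      rw [V.dproj_eq_zero_iff_blocks, h2] at h
      exact hX (funext fun i => congrFun (congrFun h.2 i) ())
    rw [V.baseMetric_dproj hu, formAt_form, h1, h2, trace_col, wedgeTrace, Matrix.mul_zero,
      Matrix.zero_mul, Matrix.trace_zero, mul_zero, add_zero] at h3
    exact h3

theorem isPosDefAt_iff_baseMetric (hu : u ∈ G.proj ⁻¹' V.injLocus) :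
    V.IsPosDefAt u ↔ ∀ a, a ≠ 0 → 0 < V.baseMetric (G.proj u) a a := by
  constructor
  · intro hm a ha
    rw [V.isPosDefAt_iff hu] at hm
    obtain ⟨ξ, rfl⟩ := G.dproj_surjective u a
    rw [V.baseMetric_dproj hu]
    exact V.formAt_self_pos hm ξ ha
  · intro H
    exact (V.isPosDefAt_iff_alongH hu).2 fun ξ _ hξ => H _ hξ

end TractorSubbundle

end CartanGeometry

end Definiteness

/-! ### The theorem -/

theorem mainTheorem5 {n : ℕ} {EM EP M Q : Type*}
    [NormedAddCommGroup EM] [NormedSpace ℝ EM] [FiniteDimensional ℝ EM]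
    [NormedAddCommGroup EP] [NormedSpace ℝ EP] [FiniteDimensional ℝ EP]
    [TopologicalSpace M] [ChartedSpace EM M] [IsManifold 𝓘(ℝ, EM) ∞ M]
    [TopologicalSpace Q] [ChartedSpace EP Q] [IsManifold 𝓘(ℝ, EP) ∞ Q]
    (G : CartanGeometry n EM EP M Q) (V : G.TractorSubbundle n) (hV : V.IsGeneric) :
    ∃ η : Q → TMat n,
      -- existence, strong preferredness and uniqueness
      V.IsStronglyPreferred V.injLocus η ∧
      (∀ η' : Q → TMat n, V.IsPreferred V.injLocus η' →
        Set.EqOn η' η (G.proj ⁻¹' V.injLocus)) ∧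
      -- the metric on `M`, and the sub-Riemannian structure on `H`
      (∃ g : ∀ x : M, TangentSpace 𝓘(ℝ, EM) x →ₗ[ℝ] TangentSpace 𝓘(ℝ, EM) x →ₗ[ℝ] ℝ,
        V.IsMetricOf V.injLocus η g ∧
        ∀ u ∈ G.proj ⁻¹' V.injLocus,
          (V.IsNondegAt u ↔ ∀ a, (∀ b, g (G.proj u) a b = 0) → a = 0) ∧
          (V.IsNondegAt u ↔ ∀ ξ, G.AlongH u ξ →
            (∀ ζ, G.AlongH u ζ → g (G.proj u) (mfderiv 𝓘(ℝ, EP) 𝓘(ℝ, EM) G.proj u ξ)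
              (mfderiv 𝓘(ℝ, EP) 𝓘(ℝ, EM) G.proj u ζ) = 0) →
            mfderiv 𝓘(ℝ, EP) 𝓘(ℝ, EM) G.proj u ξ = 0) ∧
          (V.IsPosDefAt u ↔ ∀ a, a ≠ 0 → 0 < g (G.proj u) a a) ∧
          (V.IsPosDefAt u ↔ ∀ ξ, G.AlongH u ξ →
            mfderiv 𝓘(ℝ, EP) 𝓘(ℝ, EM) G.proj u ξ ≠ 0 →
            0 < g (G.proj u) (mfderiv 𝓘(ℝ, EP) 𝓘(ℝ, EM) G.proj u ξ)
              (mfderiv 𝓘(ℝ, EP) 𝓘(ℝ, EM) G.proj u ξ))) ∧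
      -- if `V` is preserved by the tractor connection
      (V.IsPreserved → ∀ u ∈ G.proj ⁻¹' V.injLocus,
        -- `∇ μ = 0`, on `H` and on `T`
        (∀ ξ X Y, G.nablaFormH η (V.muH η) u ξ X Y = 0) ∧
        (∀ ξ, ∀ y ∈ soAlg n, ∀ z ∈ soAlg n, G.nablaFormT η (V.muT η) u ξ y z = 0) ∧
        -- `P_{12} = 0` and `P_{21} = 0`
        (∀ y ∈ soAlg n, ∀ X X', covTwo (η u) (G.rho η u (gradeComp (η u) (-1) y)) X X' = 0) ∧
        (∀ y ∈ soAlg n, covOne (G.rho η u (gradeComp (η u) (-2) y)) = 0) ∧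
        -- `P_{11} = - μ` and `P_{22} = - μ`
        (∀ y ∈ soAlg n, covOne (G.rho η u (gradeComp (η u) (-1) y)) =
          -V.mu η u (tanOne (η u) y)) ∧
        (∀ y ∈ soAlg n, ∀ X X', covTwo (η u) (G.rho η u (gradeComp (η u) (-2) y)) X X' =
          -wedgeForm (V.muH η u) (tanTwo (η u) y) (bivector X X')) ∧
        -- `∇ P = 0`
        (∀ ξ, ∀ y ∈ soAlg n, G.nablaRho η u ξ y = 0)) ∧
      -- if `V` is preserved along `H`, then `μ` on `H` is parallel along `H`
      (V.IsPreservedAlongH → ∀ u ∈ G.proj ⁻¹' V.injLocus, ∀ ξ, G.AlongH u ξ →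
        ∀ X Y, G.nablaFormH η (V.muH η) u ξ X Y = 0) := by
  refine ⟨V.preferredLift, V.isStronglyPreferred_preferredLift,
    fun η' hη' => V.eqOn_preferredLift hη', ⟨V.baseMetric, V.isMetricOf_baseMetric, fun u hu =>
      ⟨V.isNondegAt_iff_baseMetric hu, V.isNondegAt_iff_alongH hu, V.isPosDefAt_iff_baseMetric hu,
        V.isPosDefAt_iff_alongH hu⟩⟩, fun h u hu => ?_, fun h u hu ξ hξ X Y => ?_⟩
  · have hP : ∀ v ∈ G.proj ⁻¹' V.injLocus, ∀ ξ, V.IsPreservedAt v ξ :=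
      fun v _ ξ W s hW hs hsV hv => h W s hW hs hsV v hv ξ
    exact ⟨fun ξ X Y => V.nablaFormH_eq_zero hu (hP u hu ξ) X Y,
      fun ξ y _ z _ => V.nablaFormT_eq_zero hu (hP u hu ξ) y z,
      fun y hy X X' => V.covTwo_rho_neg_one hu (hP u hu) hy X X',
      fun y hy => V.covOne_rho_neg_two hu (hP u hu) hy,
      fun y hy => V.covOne_rho_neg_one hu (hP u hu) hy,
      fun y hy X X' => V.covTwo_rho_neg_two hu (hP u hu) hy X X',
      fun ξ y hy => V.nablaRho_eq_zero hu hP ξ hy⟩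
  -- The parallelism of $\mu$ on $H$ was proved direction by direction, so preservation along $H$ is
  -- enough for $\xi$ in $H$.
  · exact V.nablaFormH_eq_zero hu (fun W s hW hs hsV hv => h W s hW hs hsV u hv ξ hξ) X Y
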